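/- Let $V:\mathbb R^3\to\mathbb R$ be an integrable radial function with $V\ge 0$, $V\not\equiv 0$ (i.e. $V$ is not almost everywhere zero), and let $\widehat V(p)=\int_{\mathbb R^3}e^{-ip\cdot x}V(x)\,dx$. Assume that $\widehat V\ge 0$, $\widehat V\in C^1(\mathbb R^3)\cap L^1(\mathbb R^3)$, $\|\widehat V\|_\infty<\infty$, $\|\nabla\widehat V\|_2<\infty$ and $\|\nabla\widehat V\|_\infty<\infty$. Assume in addition that $\widehat V\in C^3(\mathbb R^3)$ and that all derivatives of $\widehat V$ up to third order are bounded. Let $\mathcal D$ be the set of triples $(\gamma,\alpha,\rho_0)$ in which $\gamma,\alpha:\mathbb R^3\to\mathbb R$ are measurable, $\gamma\in L^1((1+p^2)\,dp)$, $\gamma\ge 0$ and $\alpha^2\le\gamma(1+\gamma)$ almost everywhere, and $\rho_0\ge 0$. Write $\rho_\gamma=(2\pi)^{-3}\int_{\mathbb R^3}\gamma(p)\,dp$. For every $\rho\ge 0$ the canonical minimization problem at temperature $T=0$ and density $\rho$ has a minimizer: among all $(\gamma,\alpha,\rho_0)\in\mathcal D$ with $\rho_0+\rho_\gamma=\rho$,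 the functional $$\begin{aligned}\mathcal F^{\rm can}(\gamma,\alpha,\rho_0)={}&(2\pi)^{-3}\int_{\mathbb R^3} p^2\gamma(p)\,dp+\tfrac12\widehat V(0)\rho^2+\rho_0(2\pi)^{-3}\int_{\mathbb R^3}\widehat V(p)\bigl(\gamma(p)+\alpha(p)\bigr)\,dp\\&+\tfrac12(2\pi)^{-6}\iint_{\mathbb R^3\times\mathbb R^3}\widehat V(p-q)\bigl(\alpha(p)\alpha(q)+\gamma(p)\gamma(q)\bigr)\,dp\,dq\end{aligned}$$ attains its infimum. -/

import Mathlib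

open MeasureTheory

noncomputable section

namespace Bogoliubov

/-- Three-dimensional Euclidean space (used both for positions `x` and momenta `p`). -/
abbrev E3 : Type := EuclideanSpace ℝ (Fin 3)

/-- A function on `ℝ³` is radial if its value depends only on the norm of the argument. -/
def IsRadial (f : E3 → ℝ) : Prop := ∀ x y : E3, ‖x‖ = ‖y‖ → f x = f y

/-- The Fourier integral `∫ e^{-i p·x} V(x) dx`, as a complex number. -/
def fourierC (V : E3 → ℝ) (p : E3) : ℂ :=
  ∫ x : E3, Complex.exp (-(Complex.I * ((inner ℝ p x : ℝ) : ℂ))) * (V x : ℂ)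

/-- The Fourier transform `V̂(p)` as a real number. For radial `V` the Fourier integral is
real, so that nothing is lost by taking the real part: see `ofReal_fourier`. -/
def fourier (V : E3 → ℝ) (p : E3) : ℝ := (fourierC V p).re

theorem ofReal_fourier {V : E3 → ℝ} (hV : IsRadial V) (p : E3) :
    ((fourier V p : ℝ) : ℂ) = fourierC V p := by
  have h : (starRingEnd ℂ) (fourierC V p) = fourierC V p := by
    unfold fourierC
    rw [← integral_conj, ← integral_neg_eq_self]
    congr 1
    funext x
    rw [map_mul, ← Complex.exp_conj, hV (-x) x (norm_neg x)]
    simp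
  exact Complex.conj_eq_iff_re.mp h

/-- The standing assumptions on the two-body interaction potential `V`. Integrability is what
gives a meaning to the Fourier integral. -/
structure IsInteractionPotential (V : E3 → ℝ) : Prop where
  integrable : Integrable V
  radial : IsRadial V
  nonneg : ∀ x, 0 ≤ V x
  ne_zero : ¬ (V =ᵐ[volume] 0)
  fourier_nonneg : ∀ p, 0 ≤ fourier V p
  fourier_contDiff : ContDiff ℝ 1 (fourier V)
  fourier_integrable : Integrable (fourier V)
  fourier_bounded : MemLp (fourier V) ⊤
  gradient_memLp_two : MemLp (gradient (fourier V)) 2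
  gradient_bounded : MemLp (gradient (fourier V)) ⊤

/-- `ρ_γ = (2π)⁻³ ∫ γ(p) dp`. -/
def rhoGamma (γ : E3 → ℝ) : ℝ := ((2 * Real.pi) ^ 3)⁻¹ * ∫ p, γ p

/-- `β(p) = √((1/2 + γ(p))² - α(p)²)`. -/
def beta (γ α : E3 → ℝ) (p : E3) : ℝ := √((1 / 2 + γ p) ^ 2 - α p ^ 2)

/-- `s(β) = (β + 1/2) ln (β + 1/2) - (β - 1/2) ln (β - 1/2)`, with `0 ln 0 = 0`. -/
def entropyDensity (b : ℝ) : ℝ :=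
  (b + 1 / 2) * Real.log (b + 1 / 2) - (b - 1 / 2) * Real.log (b - 1 / 2)

/-- The entropy `S(γ, α)`. -/
def entropy (γ α : E3 → ℝ) : ℝ :=
  ((2 * Real.pi) ^ 3)⁻¹ * ∫ p, entropyDensity (beta γ α p)

/-- The domain `𝒟` of triples `(γ, α, ρ₀)`: `γ` and `α` are measurable functions, subject to
`γ ∈ L¹((1 + p²) dp)`, `γ ≥ 0` and `α² ≤ γ (1 + γ)` almost everywhere, and `ρ₀ ≥ 0`. -/
def domain : Set ((E3 → ℝ) × (E3 → ℝ) × ℝ) :=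
  {u | Integrable (fun p => (1 + ‖p‖ ^ 2) * u.1 p) ∧
    AEStronglyMeasurable u.2.1 volume ∧
    (∀ᵐ p, 0 ≤ u.1 p) ∧
    (∀ᵐ p, u.2.1 p ^ 2 ≤ u.1 p * (1 + u.1 p)) ∧
    0 ≤ u.2.2}

/-- The triples of `𝒟` with total density `ρ₀ + ρ_γ = ρ`. -/
def canonicalDomain (ρ : ℝ) : Set ((E3 → ℝ) × (E3 → ℝ) × ℝ) :=
  {u | u ∈ domain ∧ u.2.2 + rhoGamma u.1 = ρ}

/-- The canonical free energy functional at temperature `T`, where `ρ = ρ₀ + ρ_γ`. -/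
def canonicalFreeEnergy (V : E3 → ℝ) (T : ℝ) (u : (E3 → ℝ) × (E3 → ℝ) × ℝ) : ℝ :=
  let γ := u.1
  let α := u.2.1
  let ρ₀ := u.2.2
  ((2 * Real.pi) ^ 3)⁻¹ * (∫ p, ‖p‖ ^ 2 * γ p)
    - T * entropy γ α
    + fourier V 0 / 2 * (ρ₀ + rhoGamma γ) ^ 2
    + ρ₀ * (((2 * Real.pi) ^ 3)⁻¹ * ∫ p, fourier V p * (γ p + α p))
    + 1 / 2 * ((2 * Real.pi) ^ 6)⁻¹ *
        ∫ p, ∫ q, fourier V (p - q) * (α p * α q + γ p * γ q)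

end Bogoliubov

end

/-!
After elimination of the condensate density `ρ₀ = ρ - ρ_γ` the energy is convex up to a term in the
mass `∫ γ`, because the interaction has positive type (`V ≥ 0`). If its infimum is nonnegative, the
vanishing pair is a minimizer. Otherwise add a weighted `L²` penalty `ε`, so that minimizing
sequences with convergent masses are Cauchy and minimizers exist; they are radial by convexity. Up
to the penalty, their Euler equations read `α² = γ (1 + γ)` and `2 α A = -B (2 γ + 1)`, where the
fields `A`, `B` are convolutions of `V̂` with `γ`, `α` plus explicit terms; the negative infimum
provides `A ≥ p² + δ`.

The fields are bounded and Lipschitz with quadratically small second differences, uniformly in `ε`,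
so that they converge along a sequence `ε → 0`. The limiting gap `A - |B|` cannot vanish on a sphere
`|p| = s > 0`: by radial symmetry it would vanish quadratically there and force `γ ≳ 1 / ||p| - s|`,
which is not integrable. Hence `γ` is dominated away from `p = 0`, and mass can be lost only at zero
momentum. There it is moved into the condensate, at a cost that vanishes in the limit once the sign
of `α` has been chosen well.
-/

noncomputable section

namespace Bogoliubov

open Filter Topology

open scoped NNReal ENNReal

/-! ### Interaction kernels -/

lemma abs_integral_le_integral_of_abs_le {X : Type*} [MeasurableSpace X] {μ : Measure X}
    {f g : X → ℝ} (hg : Integrable g μ) (h : ∀ x, |f x| ≤ g x) : |∫ x, f x ∂μ| ≤ ∫ x, g x ∂μ :=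
  norm_integral_le_of_norm_le (f := f) hg (.of_forall h)

section Kernel

variable {E : Type*} [NormedAddCommGroup E] [InnerProductSpace ℝ E] [FiniteDimensional ℝ E]
  [MeasurableSpace E] [BorelSpace E]

/-- The convolution `k * f`, with the two factors in the order in which they occur in the
interaction energy. -/
def conv (k f : E → ℝ) (p : E) : ℝ := ∫ q, k (p - q) * f q

/-- The bilinear form `∬ k(p - q) f(p) g(q) dp dq` of a convolution kernel `k`. -/
def pairing (k f g : E → ℝ) : ℝ := ∫ p, f p * conv k g p

/-- The properties of the interaction kernel `k` (a positive multiple of `V̂`) that the existence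
proof relies on: `k` is a nonnegative radial function of positive type, bounded by `M`, with
Lipschitz constant `L`, and its second differences are of order `C ‖h‖²`. -/
structure IsKernel (k : E → ℝ) (M : ℝ) (L : ℝ≥0) (C : ℝ) : Prop where
  nonneg : ∀ p, 0 ≤ k p
  integrable : Integrable k
  le : ∀ p, k p ≤ M
  radial : ∀ x y, ‖x‖ = ‖y‖ → k x = k y
  lipschitz : LipschitzWith L k
  abs_second_diff_le : ∀ x h, |k (x + h) + k (x - h) - 2 * k x| ≤ C * ‖h‖ ^ 2
  pairing_self_nonneg : ∀ f, Integrable f → 0 ≤ pairing k f f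

variable {k : E → ℝ} {M : ℝ} {L : ℝ≥0} {C : ℝ} {f g h : E → ℝ}

lemma conv_const_mul (c : ℝ) (p : E) : conv k (fun q => c * f q) p = c * conv k f p := by
  simp only [conv, mul_left_comm _ c, integral_const_mul]

lemma conv_const_mul_kernel (c : ℝ) (p : E) : conv (fun q => c * k q) f p = c * conv k f p := by
  simp only [conv, mul_assoc, integral_const_mul]

lemma pairing_const_mul_left (c : ℝ) : pairing k (fun p => c * f p) g = c * pairing k f g := by
  simp only [pairing, mul_assoc, integral_const_mul]

lemma pairing_const_mul_right (c : ℝ) : pairing k f (fun p => c * g p) = c * pairing k f g := by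
  simp only [pairing, conv_const_mul, mul_left_comm _ c, integral_const_mul]

lemma pairing_const_mul_kernel (c : ℝ) : pairing (fun p => c * k p) f g = c * pairing k f g := by
  simp only [pairing, conv_const_mul_kernel, mul_left_comm _ c, integral_const_mul]

lemma pairing_eq_integral_integral :
    pairing k f g = ∫ p, ∫ q, k (p - q) * (f p * g q) := by
  simp only [pairing, conv, ← integral_const_mul, mul_left_comm (f _)]

namespace IsKernel

lemma continuous (hk : IsKernel k M L C) : Continuous k := hk.lipschitz.continuous

lemma abs_le (hk : IsKernel k M L C) (p : E) : |k p| ≤ M :=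
  (abs_of_nonneg (hk.nonneg p)).trans_le (hk.le p)

lemma bound_nonneg (hk : IsKernel k M L C) : 0 ≤ M := (hk.nonneg 0).trans (hk.le 0)

lemma abs_sub_le (hk : IsKernel k M L C) (x y : E) : |k x - k y| ≤ L * ‖x - y‖ :=
  hk.lipschitz.norm_sub_le x y

lemma sub_comm (hk : IsKernel k M L C) (p q : E) : k (p - q) = k (q - p) :=
  hk.radial _ _ (norm_sub_rev p q)

lemma const_mul (hk : IsKernel k M L C) (c : ℝ≥0) :
    IsKernel (fun p => c * k p) (c * M) (c * L) (c * C) where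
  nonneg p := mul_nonneg c.coe_nonneg (hk.nonneg p)
  integrable := hk.integrable.const_mul _
  le p := mul_le_mul_of_nonneg_left (hk.le p) c.coe_nonneg
  radial x y hxy := congrArg _ (hk.radial x y hxy)
  lipschitz := by
    refine LipschitzWith.of_dist_le_mul fun x y => ?_
    rw [Real.dist_eq, ← mul_sub, abs_mul, abs_of_nonneg c.coe_nonneg, NNReal.coe_mul, mul_assoc,
      dist_eq_norm]
    exact mul_le_mul_of_nonneg_left (hk.abs_sub_le x y) c.coe_nonneg
  abs_second_diff_le x h := by
    rw [show c * k (x + h) + c * k (x - h) - 2 * (c * k x)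
      = c * (k (x + h) + k (x - h) - 2 * k x) by ring, abs_mul, abs_of_nonneg c.coe_nonneg,
      mul_assoc]
    exact mul_le_mul_of_nonneg_left (hk.abs_second_diff_le x h) c.coe_nonneg
  pairing_self_nonneg f hf := by
    rw [pairing_const_mul_kernel]
    exact mul_nonneg c.coe_nonneg (hk.pairing_self_nonneg f hf)

lemma integrable_mul (hk : IsKernel k M L C) (hf : Integrable f) :
    Integrable fun q => k q * f q :=
  hf.bdd_mul hk.continuous.aestronglyMeasurable (.of_forall hk.abs_le)

lemma integrable_sub_mul (hk : IsKernel k M L C) (hf : Integrable f) (p : E) :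
    Integrable fun q => k (p - q) * f q :=
  hf.bdd_mul (hk.continuous.comp (by fun_prop)).aestronglyMeasurable
    (.of_forall fun _ => hk.abs_le _)

lemma conv_zero (hk : IsKernel k M L C) : conv k f 0 = ∫ q, k q * f q := by
  simp only [conv, hk.sub_comm 0, sub_zero]

lemma conv_nonneg (hk : IsKernel k M L C) (hf : ∀ᵐ p, 0 ≤ f p) (x : E) : 0 ≤ conv k f x :=
  integral_nonneg_of_ae (hf.mono fun _ hq => mul_nonneg (hk.nonneg _) hq)

lemma abs_conv_le (hk : IsKernel k M L C) (hf : Integrable f) (x : E) :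
    |conv k f x| ≤ M * ∫ q, |f q| := by
  rw [← integral_const_mul]
  refine abs_integral_le_integral_of_abs_le (hf.abs.const_mul _) fun q => ?_
  rw [abs_mul]
  exact mul_le_mul_of_nonneg_right (hk.abs_le _) (abs_nonneg _)

lemma abs_conv_sub_le (hk : IsKernel k M L C) (hf : Integrable f) (x y : E) :
    |conv k f x - conv k f y| ≤ L * ‖x - y‖ * ∫ q, |f q| := by
  rw [conv, conv, ← integral_sub (hk.integrable_sub_mul hf x) (hk.integrable_sub_mul hf y),
    ← integral_const_mul]
  refine abs_integral_le_integral_of_abs_le (hf.abs.const_mul _) fun q => ?_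
  have hq := hk.abs_sub_le (x - q) (y - q)
  rw [sub_sub_sub_cancel_right] at hq
  rw [← sub_mul, abs_mul]
  exact mul_le_mul_of_nonneg_right hq (abs_nonneg _)

lemma abs_conv_second_diff_le (hk : IsKernel k M L C) (hf : Integrable f) (x h : E) :
    |conv k f (x + h) + conv k f (x - h) - 2 * conv k f x| ≤ C * ‖h‖ ^ 2 * ∫ q, |f q| := by
  have hsum : Integrable fun q => k (x + h - q) * f q + k (x - h - q) * f q :=
    (hk.integrable_sub_mul hf _).add (hk.integrable_sub_mul hf _)
  simp only [conv]
  rw [← integral_add (hk.integrable_sub_mul hf _) (hk.integrable_sub_mul hf _),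
    ← integral_const_mul, ← integral_sub hsum ((hk.integrable_sub_mul hf _).const_mul _),
    ← integral_const_mul]
  refine abs_integral_le_integral_of_abs_le (hf.abs.const_mul _) fun q => ?_
  have hfactor : k (x + h - q) * f q + k (x - h - q) * f q - 2 * (k (x - q) * f q)
      = (k (x - q + h) + k (x - q - h) - 2 * k (x - q)) * f q := by
    rw [show x + h - q = x - q + h by abel, show x - h - q = x - q - h by abel]; ring
  rw [hfactor, abs_mul]
  exact mul_le_mul_of_nonneg_right (hk.abs_second_diff_le (x - q) h) (abs_nonneg _)

lemma continuous_conv (hk : IsKernel k M L C) (hf : Integrable f) : Continuous (conv k f) := by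
  have hlip : LipschitzWith (L * (∫ q, |f q|).toNNReal) (conv k f) := by
    refine LipschitzWith.of_dist_le_mul fun x y => ?_
    rw [NNReal.coe_mul, Real.coe_toNNReal _ (integral_nonneg fun _ => abs_nonneg _), mul_right_comm,
      Real.dist_eq, dist_eq_norm]
    exact hk.abs_conv_sub_le hf x y
  exact hlip.continuous

lemma radial_conv (hk : IsKernel k M L C)
    (hf : ∀ R : E ≃ₗᵢ[ℝ] E, (fun p => f (R p)) =ᵐ[volume] f) {x y : E} (hxy : ‖x‖ = ‖y‖) :
    conv k f x = conv k f y := by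
  obtain ⟨R, rfl⟩ : ∃ R : E ≃ₗᵢ[ℝ] E, R x = y := ⟨_, Submodule.reflection_sub hxy⟩
  have hrot : conv k f (R x) = ∫ q, k (R x - R q) * f (R q) :=
    (R.measurePreserving.integral_comp R.toHomeomorph.measurableEmbedding
      fun q => k (R x - q) * f q).symm
  rw [hrot]
  refine integral_congr_ae ((hf R).mono fun q hq => ?_)
  dsimp only at hq ⊢
  rw [hq, ← map_sub, hk.radial (R (x - q)) (x - q) (R.norm_map _)]

lemma integrable_mul_conv (hk : IsKernel k M L C) (hf : Integrable f) (hg : Integrable g) :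
    Integrable fun p => f p * conv k g p :=
  hf.mul_bdd (hk.continuous_conv hg).aestronglyMeasurable (.of_forall fun _ => hk.abs_conv_le hg _)

lemma integrable_sub_mul_mul (hk : IsKernel k M L C) (hf : Integrable f) (hg : Integrable g) :
    Integrable (fun z : E × E => k (z.1 - z.2) * (f z.1 * g z.2)) (volume.prod volume) :=
  (hf.mul_prod hg).bdd_mul (hk.continuous.comp (by fun_prop)).aestronglyMeasurable
    (.of_forall fun _ => hk.abs_le _)

lemma pairing_comm (hk : IsKernel k M L C) (hf : Integrable f) (hg : Integrable g) :
    pairing k f g = pairing k g f := by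
  rw [pairing_eq_integral_integral, pairing_eq_integral_integral,
    integral_integral_swap (hk.integrable_sub_mul_mul hf hg)]
  simp only [hk.sub_comm, mul_comm (f _)]

lemma pairing_add_left (hk : IsKernel k M L C) (hf : Integrable f) (hg : Integrable g)
    (hh : Integrable h) : pairing k (fun p => f p + g p) h = pairing k f h + pairing k g h := by
  simp only [pairing, add_mul]
  exact integral_add (hk.integrable_mul_conv hf hh) (hk.integrable_mul_conv hg hh)

lemma pairing_add_right (hk : IsKernel k M L C) (hf : Integrable f) (hg : Integrable g)
    (hh : Integrable h) : pairing k h (fun p => f p + g p) = pairing k h f + pairing k h g := by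
  rw [hk.pairing_comm hh (hf.add hg : Integrable fun p => f p + g p), hk.pairing_comm hh hf,
    hk.pairing_comm hh hg, hk.pairing_add_left hf hg hh]

lemma abs_pairing_le (hk : IsKernel k M L C) (hf : Integrable f) (hg : Integrable g) :
    |pairing k f g| ≤ M * (∫ q, |f q|) * ∫ q, |g q| := by
  rw [mul_right_comm, mul_comm, ← integral_mul_const]
  refine abs_integral_le_integral_of_abs_le (hf.abs.mul_const _) fun q => ?_
  rw [abs_mul]
  exact mul_le_mul_of_nonneg_left (hk.abs_conv_le hg q) (abs_nonneg _)

lemma pairing_add_mul_self (hk : IsKernel k M L C) (hf : Integrable f) (hg : Integrable g)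
    (t : ℝ) : pairing k (fun p => f p + t * g p) (fun p => f p + t * g p)
      = pairing k f f + t * (2 * pairing k g f) + t ^ 2 * pairing k g g := by
  have htg : Integrable fun p => t * g p := hg.const_mul t
  rw [hk.pairing_add_left hf htg (hf.add htg : Integrable fun p => f p + t * g p),
    hk.pairing_add_right hf htg hf, hk.pairing_add_right hf htg htg, pairing_const_mul_left,
    pairing_const_mul_left, pairing_const_mul_right, pairing_const_mul_right,
    hk.pairing_comm hf hg]
  ring

end IsKernel

end Kernel

/-! ### Pairs and their energy -/

section Pair

lemma abs_le_add_half_of_sq_le {a g : ℝ} (hg : 0 ≤ g) (h : a ^ 2 ≤ g * (1 + g)) :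
    |a| ≤ g + 1 / 2 :=
  abs_le_of_sq_le_sq (by nlinarith) (by linarith)

lemma abs_mul_le_of_sq_le {a b g h : ℝ} (hg : 0 ≤ g) (hh : 0 ≤ h) (ha : a ^ 2 ≤ g * (1 + g))
    (hb : b ^ 2 ≤ h * (1 + h)) : |a * b| ≤ 3 * (g * h) + 2 * g + 2 * h := by
  have hgh := mul_nonneg hg hh
  refine abs_le_of_sq_le_sq ?_ (by positivity)
  calc (a * b) ^ 2 = a ^ 2 * b ^ 2 := by ring
    _ ≤ (g * (1 + g)) * (h * (1 + h)) := mul_le_mul ha hb (sq_nonneg _) (by positivity)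
    _ ≤ _ := by
      nlinarith [mul_nonneg hgh hg, mul_nonneg hgh hh, mul_nonneg hgh hgh, sq_nonneg g,
        sq_nonneg h]

lemma ae_prod_and_of_ae {X : Type*} [MeasurableSpace X] {μ : Measure X} {P : X → Prop}
    (h : ∀ᵐ p ∂μ, P p) : ∀ᵐ z ∂μ.prod μ, P z.1 ∧ P z.2 :=
  (Measure.quasiMeasurePreserving_fst.ae h).and (Measure.quasiMeasurePreserving_snd.ae h)

variable {E : Type*} [NormedAddCommGroup E] [InnerProductSpace ℝ E] [FiniteDimensional ℝ E]
  [MeasurableSpace E] [BorelSpace E]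

/-- The conditions on `(γ, α)` in the domain `𝒟` except for the finiteness of the kinetic energy:
this is what the potential energy needs in order to be finite. -/
structure IsAdmissible (γ α : E → ℝ) : Prop where
  integrable : Integrable γ
  aestronglyMeasurable : AEStronglyMeasurable α
  nonneg : ∀ᵐ p, 0 ≤ γ p
  sq_le : ∀ᵐ p, α p ^ 2 ≤ γ p * (1 + γ p)

/-- The pairs `(γ, α)` that occur in the domain `𝒟`, with `γ ∈ L¹((1 + p²) dp)` written as
integrability of `γ` and of `p² γ`. -/
structure IsPair (γ α : E → ℝ) : Prop extends IsAdmissible γ α where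
  integrable_kinetic : Integrable fun p => ‖p‖ ^ 2 * γ p

/-- The interaction energy `∬ k(p - q) (α(p) α(q) + γ(p) γ(q)) dp dq`. -/
def interaction (k γ α : E → ℝ) : ℝ := ∫ p, ∫ q, k (p - q) * (α p * α q + γ p * γ q)

/-- The energy `∫ k (γ + α)` of the interaction with the condensate, per unit of condensate. -/
def coupling (k γ α : E → ℝ) : ℝ := ∫ p, k p * (γ p + α p)

/-- The energy of a pair at total mass `r`, with the condensate density eliminated as
`r - ∫ γ`. -/
def pairEnergy (k : E → ℝ) (r : ℝ) (γ α : E → ℝ) : ℝ :=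
  (∫ p, ‖p‖ ^ 2 * γ p) + (r - ∫ p, γ p) * coupling k γ α
    + 1 / 2 * interaction k γ α

variable {k : E → ℝ} {M : ℝ} {L : ℝ≥0} {C : ℝ} {γ α h : E → ℝ}

lemma integrable_one_add_norm_sq_mul_iff {f : E → ℝ} :
    Integrable (fun p => (1 + ‖p‖ ^ 2) * f p) ↔
      Integrable f ∧ Integrable fun p => ‖p‖ ^ 2 * f p := by
  refine ⟨fun hw => ?_, fun ⟨hf, hp⟩ => (hf.add hp).congr (.of_forall fun p => ?_)⟩
  · have hf : Integrable f := by
      have hc : Continuous fun p : E => (1 + ‖p‖ ^ 2)⁻¹ :=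
        Continuous.inv₀ (by fun_prop) fun p => by positivity
      refine (hw.bdd_mul (c := 1) hc.aestronglyMeasurable
        (.of_forall fun p => ?_)).congr (.of_forall fun p => ?_)
      · rw [Real.norm_of_nonneg (by positivity)]
        exact inv_le_one_of_one_le₀ (by nlinarith [sq_nonneg ‖p‖])
      · exact inv_mul_cancel_left₀ (by positivity) _
    exact ⟨hf, (hw.sub hf).congr (.of_forall fun p => by simp only [Pi.sub_apply]; ring)⟩
  · simp only [Pi.add_apply]; ring

namespace IsPair

protected lemma zero : IsPair (fun _ : E => (0 : ℝ)) (fun _ => 0) :=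
  ⟨⟨by simp, by fun_prop, by simp, by simp⟩, by simp⟩

protected lemma indicator (hp : IsPair γ α) {S : Set E} (hS : MeasurableSet S) :
    IsPair (S.indicator γ) (S.indicator α) := by
  refine ⟨⟨hp.integrable.indicator hS, hp.aestronglyMeasurable.indicator hS, ?_, ?_⟩, ?_⟩
  · filter_upwards [hp.nonneg] with p hγ using Set.indicator_apply_nonneg fun _ => hγ
  · filter_upwards [hp.sq_le] with p hα
    by_cases hpS : p ∈ S <;> simp [hpS, hα]
  · refine (hp.integrable_kinetic.indicator hS).congr (.of_forall fun p => ?_)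
    by_cases hpS : p ∈ S <;> simp [hpS]

lemma const_mul_right (hp : IsPair γ α) {s : ℝ} (hs : s ^ 2 ≤ 1) :
    IsPair γ (fun p => s * α p) where
  __ := hp
  aestronglyMeasurable := hp.aestronglyMeasurable.const_mul s
  sq_le := by
    filter_upwards [hp.sq_le] with p hα
    nlinarith [sq_nonneg (α p)]

end IsPair

lemma interaction_const_mul_right {s : ℝ} (hs : s ^ 2 = 1) :
    interaction k γ (fun p => s * α p) = interaction k γ α := by
  unfold interaction
  congr! 4 with p q
  linear_combination k (p - q) * α p * α q * hs

lemma interaction_const_mul_kernel (c : ℝ) :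
    interaction (fun p => c * k p) γ α = c * interaction k γ α := by
  simp only [interaction, mul_assoc, integral_const_mul]

lemma coupling_const_mul_kernel (c : ℝ) :
    coupling (fun p => c * k p) γ α = c * coupling k γ α := by
  simp only [coupling, mul_assoc, integral_const_mul]

namespace IsAdmissible

lemma mass_nonneg (hp : IsAdmissible γ α) : 0 ≤ ∫ p, γ p := integral_nonneg_of_ae hp.nonneg

lemma integral_abs_left (hp : IsAdmissible γ α) : ∫ p, |γ p| = ∫ p, γ p :=
  integral_congr_ae (hp.nonneg.mono fun _ h => abs_of_nonneg h)

protected lemma of_tendsto {γn αn : ℕ → E → ℝ} (hp : ∀ n, IsAdmissible (γn n) (αn n))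
    (hint : Integrable γ) (hγ : ∀ᵐ p, Tendsto (fun n => γn n p) atTop (𝓝 (γ p)))
    (hα : ∀ᵐ p, Tendsto (fun n => αn n p) atTop (𝓝 (α p))) : IsAdmissible γ α where
  integrable := hint
  aestronglyMeasurable :=
    aestronglyMeasurable_of_tendsto_ae atTop (fun n => (hp n).aestronglyMeasurable) hα
  nonneg := by
    filter_upwards [ae_all_iff.mpr fun n => (hp n).nonneg, hγ] with p h0 hlim
      using ge_of_tendsto' hlim h0
  sq_le := by
    filter_upwards [ae_all_iff.mpr fun n => (hp n).sq_le, hγ, hα] with p hle hγp hαp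
    exact le_of_tendsto_of_tendsto' (hαp.pow 2) (hγp.mul (hγp.const_add 1)) hle

lemma abs_le (hp : IsAdmissible γ α) : ∀ᵐ p, |α p| ≤ γ p + 1 / 2 := by
  filter_upwards [hp.nonneg, hp.sq_le] with p hγ hα using abs_le_add_half_of_sq_le hγ hα

lemma abs_mul_le (hk : IsKernel k M L C) (hp : IsAdmissible γ α) (hle : ∀ᵐ p, γ p ≤ h p) :
    ∀ᵐ p, ‖k p * α p‖ ≤ k p * h p + 1 / 2 * k p := by
  filter_upwards [hp.abs_le, hle] with p hα hh
  rw [Real.norm_eq_abs, abs_mul, abs_of_nonneg (hk.nonneg p)]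
  nlinarith [mul_le_mul_of_nonneg_left (hα.trans (add_le_add_left hh _)) (hk.nonneg p)]

lemma abs_interaction_integrand_le (hk : IsKernel k M L C) (hp : IsAdmissible γ α)
    (hle : ∀ᵐ p, γ p ≤ h p) :
    ∀ᵐ z : E × E ∂volume.prod volume, ‖k (z.1 - z.2) * (α z.1 * α z.2 + γ z.1 * γ z.2)‖
      ≤ k (z.1 - z.2) * (4 * (h z.1 * h z.2) + 2 * h z.1 + 2 * h z.2) := by
  filter_upwards [ae_prod_and_of_ae hp.nonneg, ae_prod_and_of_ae hp.sq_le, ae_prod_and_of_ae hle]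
    with z hγ hα hh
  rw [Real.norm_eq_abs, abs_mul, abs_of_nonneg (hk.nonneg _)]
  refine mul_le_mul_of_nonneg_left ?_ (hk.nonneg _)
  have hαα := abs_mul_le_of_sq_le hγ.1 hγ.2 hα.1 hα.2
  have hγγ : γ z.1 * γ z.2 ≤ h z.1 * h z.2 := mul_le_mul hh.1 hh.2 hγ.2 (hγ.1.trans hh.1)
  have htri := abs_add_le (α z.1 * α z.2) (γ z.1 * γ z.2)
  rw [abs_of_nonneg (mul_nonneg hγ.1 hγ.2)] at htri
  linarith [hh.1, hh.2]

lemma aestronglyMeasurable_interaction (hk : IsKernel k M L C) (hp : IsAdmissible γ α) :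
    AEStronglyMeasurable (fun z : E × E => k (z.1 - z.2) * (α z.1 * α z.2 + γ z.1 * γ z.2))
      (volume.prod volume) :=
  (hk.continuous.comp (by fun_prop)).aestronglyMeasurable.mul
    ((hp.aestronglyMeasurable.comp_fst.mul hp.aestronglyMeasurable.comp_snd).add
      (hp.integrable.1.comp_fst.mul hp.integrable.1.comp_snd))

end IsAdmissible

namespace IsKernel

lemma integrable_sub_mul_fst (hk : IsKernel k M L C) (hh : Integrable h) :
    Integrable (fun z : E × E => k (z.1 - z.2) * h z.1) (volume.prod volume) := by
  refine (hh.convolution_integrand (.mul ℝ ℝ) hk.integrable).swap.congr (.of_forall fun z => ?_)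
  simp only [Function.comp, Prod.swap, ContinuousLinearMap.mul_apply']
  rw [hk.sub_comm, mul_comm]

lemma integrable_sub_mul_snd (hk : IsKernel k M L C) (hh : Integrable h) :
    Integrable (fun z : E × E => k (z.1 - z.2) * h z.2) (volume.prod volume) := by
  refine (hh.convolution_integrand (.mul ℝ ℝ) hk.integrable).congr (.of_forall fun z => ?_)
  simp only [ContinuousLinearMap.mul_apply', mul_comm]

lemma integrable_interaction_majorant (hk : IsKernel k M L C) (hh : Integrable h) :
    Integrable (fun z : E × E => k (z.1 - z.2) * (4 * (h z.1 * h z.2) + 2 * h z.1 + 2 * h z.2))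
      (volume.prod volume) := by
  refine ((((hk.integrable_sub_mul_mul hh hh).const_mul 4).add
    ((hk.integrable_sub_mul_fst hh).const_mul 2)).add
    ((hk.integrable_sub_mul_snd hh).const_mul 2)).congr (.of_forall fun z => ?_)
  simp only [Pi.add_apply]; ring

lemma integrable_mul_right (hk : IsKernel k M L C) (hp : IsAdmissible γ α) :
    Integrable fun p => k p * α p :=
  ((hk.integrable_mul hp.integrable).add (hk.integrable.const_mul (1 / 2))).mono'
    (hk.continuous.aestronglyMeasurable.mul hp.aestronglyMeasurable)
    (hp.abs_mul_le hk (.of_forall fun _ => le_rfl))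

lemma coupling_eq_add (hk : IsKernel k M L C) (hp : IsAdmissible γ α) :
    coupling k γ α = (∫ p, k p * γ p) + ∫ p, k p * α p := by
  simp only [coupling, mul_add]
  exact integral_add (hk.integrable_mul hp.integrable) (hk.integrable_mul_right hp)

lemma interaction_eq_integral_prod (hk : IsKernel k M L C) (hp : IsAdmissible γ α) :
    interaction k γ α = ∫ z : E × E, k (z.1 - z.2) * (α z.1 * α z.2 + γ z.1 * γ z.2)
      ∂volume.prod volume :=
  (integral_prod _ ((hk.integrable_interaction_majorant hp.integrable).mono'
    (hp.aestronglyMeasurable_interaction hk)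
    (hp.abs_interaction_integrand_le hk (.of_forall fun _ => le_rfl)))).symm

lemma interaction_eq_pairing (hk : IsKernel k M L C) (hγ : Integrable γ) (hα : Integrable α) :
    interaction k γ α = pairing k γ γ + pairing k α α := by
  rw [pairing, pairing, ← integral_add (hk.integrable_mul_conv hγ hγ)
    (hk.integrable_mul_conv hα hα)]
  refine integral_congr_ae (.of_forall fun p => ?_)
  simp only [conv, ← integral_const_mul]
  rw [← integral_add ((hk.integrable_sub_mul hγ p).const_mul _)
    ((hk.integrable_sub_mul hα p).const_mul _)]
  congr! 2 with q
  ring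

end IsKernel

/-- The hypotheses of dominated convergence for a sequence of admissible pairs `(γₙ, αₙ)`: it
converges almost everywhere to `(γ, α)`, and `γₙ` has the integrable majorant `h`. -/
structure DominatedConvergence (γn αn : ℕ → E → ℝ) (γ α h : E → ℝ) : Prop where
  integrable_bound : Integrable h
  isAdmissible : ∀ n, IsAdmissible (γn n) (αn n)
  le_bound : ∀ n, ∀ᵐ p, γn n p ≤ h p
  tendsto_left : ∀ᵐ p, Tendsto (fun n => γn n p) atTop (𝓝 (γ p))
  tendsto_right : ∀ᵐ p, Tendsto (fun n => αn n p) atTop (𝓝 (α p))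

namespace DominatedConvergence

variable {γn αn : ℕ → E → ℝ}

lemma norm_le_bound (hd : DominatedConvergence γn αn γ α h) (n : ℕ) :
    ∀ᵐ p, ‖γn n p‖ ≤ h p := by
  filter_upwards [(hd.isAdmissible n).nonneg, hd.le_bound n] with p h0 hle
  rwa [Real.norm_of_nonneg h0]

theorem isAdmissible_limit (hd : DominatedConvergence γn αn γ α h) : IsAdmissible γ α := by
  refine .of_tendsto hd.isAdmissible (hd.integrable_bound.mono'
    (aestronglyMeasurable_of_tendsto_ae atTop (fun n => (hd.isAdmissible n).integrable.1)
      hd.tendsto_left) ?_) hd.tendsto_left hd.tendsto_right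
  filter_upwards [ae_all_iff.mpr hd.norm_le_bound, hd.tendsto_left] with p hle hlim
  exact le_of_tendsto' hlim.norm hle

theorem tendsto_integral (hd : DominatedConvergence γn αn γ α h) :
    Tendsto (fun n => ∫ p, γn n p) atTop (𝓝 (∫ p, γ p)) :=
  tendsto_integral_of_dominated_convergence h (fun n => (hd.isAdmissible n).integrable.1)
    hd.integrable_bound hd.norm_le_bound hd.tendsto_left

theorem tendsto_integral_mul_left (hk : IsKernel k M L C)
    (hd : DominatedConvergence γn αn γ α h) :
    Tendsto (fun n => ∫ p, k p * γn n p) atTop (𝓝 (∫ p, k p * γ p)) := by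
  refine tendsto_integral_of_dominated_convergence _
    (fun n => hk.continuous.aestronglyMeasurable.mul (hd.isAdmissible n).integrable.1)
    (hk.integrable_mul hd.integrable_bound) (fun n => ?_)
    (hd.tendsto_left.mono fun _ hp => hp.const_mul _)
  filter_upwards [hd.norm_le_bound n] with p hle
  rw [norm_mul, Real.norm_of_nonneg (hk.nonneg p)]
  exact mul_le_mul_of_nonneg_left hle (hk.nonneg p)

theorem tendsto_integral_mul_right (hk : IsKernel k M L C)
    (hd : DominatedConvergence γn αn γ α h) :
    Tendsto (fun n => ∫ p, k p * αn n p) atTop (𝓝 (∫ p, k p * α p)) :=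
  tendsto_integral_of_dominated_convergence _
    (fun n => hk.continuous.aestronglyMeasurable.mul (hd.isAdmissible n).aestronglyMeasurable)
    ((hk.integrable_mul hd.integrable_bound).add (hk.integrable.const_mul (1 / 2)))
    (fun n => (hd.isAdmissible n).abs_mul_le hk (hd.le_bound n))
    (hd.tendsto_right.mono fun _ hp => hp.const_mul _)

theorem tendsto_interaction (hk : IsKernel k M L C) (hd : DominatedConvergence γn αn γ α h) :
    Tendsto (fun n => interaction k (γn n) (αn n)) atTop (𝓝 (interaction k γ α)) := by
  simp only [hk.interaction_eq_integral_prod hd.isAdmissible_limit,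
    hk.interaction_eq_integral_prod (hd.isAdmissible _)]
  refine tendsto_integral_of_dominated_convergence _
    (fun n => (hd.isAdmissible n).aestronglyMeasurable_interaction hk)
    (hk.integrable_interaction_majorant hd.integrable_bound)
    (fun n => (hd.isAdmissible n).abs_interaction_integrand_le hk (hd.le_bound n)) ?_
  filter_upwards [ae_prod_and_of_ae hd.tendsto_left, ae_prod_and_of_ae hd.tendsto_right]
    with z hγ hα
  exact ((hα.1.mul hα.2).add (hγ.1.mul hγ.2)).const_mul _

end DominatedConvergence

end Pair

/-! ### The weighted `L²`-space -/

section SquareIntegrable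

variable {X : Type*} [MeasurableSpace X] {μ : Measure X}

lemma norm_toLp_sq {f : X → ℝ} (hf : MemLp f 2 μ) : ‖hf.toLp f‖ ^ 2 = ∫ x, f x ^ 2 ∂μ := by
  rw [← real_inner_self_eq_norm_sq, L2.inner_def]
  refine integral_congr_ae ?_
  filter_upwards [hf.coeFn_toLp] with x hx
  rw [hx, real_inner_self_eq_norm_sq, Real.norm_eq_abs, sq_abs]

lemma integral_mul_sq_le {f g : X → ℝ} (hf : MemLp f 2 μ) (hg : MemLp g 2 μ) :
    (∫ x, f x * g x ∂μ) ^ 2 ≤ (∫ x, f x ^ 2 ∂μ) * ∫ x, g x ^ 2 ∂μ := by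
  have hinner : ∫ x, f x * g x ∂μ = inner ℝ (hf.toLp f) (hg.toLp g) := by
    rw [L2.inner_def]
    refine integral_congr_ae ?_
    filter_upwards [hf.coeFn_toLp, hg.coeFn_toLp] with x hfx hgx
    rw [hfx, hgx, real_inner_eq_re_inner]
    simp [mul_comm]
  rw [hinner, ← norm_toLp_sq hf, ← norm_toLp_sq hg, ← mul_pow, ← sq_abs]
  exact pow_le_pow_left₀ (abs_nonneg _) (abs_real_inner_le_norm _ _) 2

lemma cauchySeq_of_norm_sub_sq_le {F : Type*} [SeminormedAddCommGroup F] {u : ℕ → F} {c : ℕ → ℝ}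
    (hc : Tendsto c atTop (𝓝 0)) (hu : ∀ n m, ‖u n - u m‖ ^ 2 ≤ c n + c m) : CauchySeq u := by
  refine Metric.cauchySeq_iff.mpr fun ε hε => ?_
  have hsmall : ∀ᶠ n in atTop, c n < ε ^ 2 / 2 := hc.eventually_lt_const (by positivity)
  obtain ⟨N, hN⟩ := eventually_atTop.mp hsmall
  refine ⟨N, fun m hm n hn => ?_⟩
  rw [dist_eq_norm]
  refine lt_of_pow_lt_pow_left₀ 2 hε.le ?_
  linarith [hu m n, hN m hm, hN n hn]

lemma exists_memLp_two_limit {f : ℕ → X → ℝ} (hf : ∀ n, MemLp (f n) 2 μ) {c : ℕ → ℝ}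
    (hc : Tendsto c atTop (𝓝 0)) (hle : ∀ n m, ∫ x, (f n x - f m x) ^ 2 ∂μ ≤ c n + c m) :
    ∃ g, MemLp g 2 μ ∧ Tendsto (fun n => ∫ x, (f n x - g x) ^ 2 ∂μ) atTop (𝓝 0) ∧
      ∃ φ : ℕ → ℕ, StrictMono φ ∧ ∀ᵐ x ∂μ, Tendsto (fun n => f (φ n) x) atTop (𝓝 (g x)) := by
  have hcau : CauchySeq fun n => (hf n).toLp (f n) :=
    cauchySeq_of_norm_sub_sq_le hc fun n m => by
      rw [← MemLp.toLp_sub, norm_toLp_sq]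
      exact hle n m
  obtain ⟨G, hG⟩ := cauchySeq_tendsto_of_complete hcau
  refine ⟨G, Lp.memLp G, ?_, ?_⟩
  · have hsq : Tendsto (fun n => ‖(hf n).toLp (f n) - G‖ ^ 2) atTop (𝓝 (0 ^ 2)) :=
      (tendsto_iff_norm_sub_tendsto_zero.mp hG).pow 2
    rw [zero_pow two_ne_zero] at hsq
    refine hsq.congr fun n => ?_
    have hsub : (hf n).toLp (f n) - G = ((hf n).sub (Lp.memLp G)).toLp _ := by
      rw [MemLp.toLp_sub (hf n) (Lp.memLp G), Lp.toLp_coeFn]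
    rw [hsub, norm_toLp_sq]
    rfl
  · obtain ⟨φ, hφ, hlim⟩ := (tendstoInMeasure_of_tendsto_Lp hG).exists_seq_tendsto_ae
    refine ⟨φ, hφ, ?_⟩
    filter_upwards [hlim, ae_all_iff.mpr fun n => (hf n).coeFn_toLp] with x hx hfx
    exact hx.congr fun n => hfx _

end SquareIntegrable

section Weighted

/-- The weight of the regularization. Its inverse is in `L²(ℝ³)` even after multiplication by
`1 + p²`, so that the weighted `L²`-norm controls the norm of `L¹((1 + p²) dp)`. -/
def weight (p : E3) : ℝ := (1 + ‖p‖ ^ 2) ^ 2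

/-- Membership in the weighted `L²`-space of the regularization. -/
def IsRegular (f : E3 → ℝ) : Prop := MemLp (fun p => weight p * f p) 2 volume

/-- The inner product of the weighted `L²`-space. -/
def weightedInner (f g : E3 → ℝ) : ℝ := ∫ p, weight p ^ 2 * (f p * g p)

/-- The square of the norm of the weighted `L²`-space. -/
def weightedSq (f : E3 → ℝ) : ℝ := ∫ p, (weight p * f p) ^ 2

lemma continuous_weight : Continuous weight := by unfold weight; fun_prop

lemma weight_pos (p : E3) : 0 < weight p := by unfold weight; positivity

lemma memLp_inv_one_add_norm_sq : MemLp (fun p : E3 => (1 + ‖p‖ ^ 2)⁻¹) 2 volume := by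
  have hc : Continuous fun p : E3 => (1 + ‖p‖ ^ 2)⁻¹ :=
    Continuous.inv₀ (by fun_prop) fun p => by positivity
  rw [memLp_two_iff_integrable_sq hc.aestronglyMeasurable]
  have hint : Integrable fun p : E3 => (1 + ‖p‖ ^ 2) ^ (-4 / 2 : ℝ) :=
    integrable_rpow_neg_one_add_norm_sq (by simp; norm_num)
  refine hint.congr (.of_forall fun p => ?_)
  have hexp : (-4 / 2 : ℝ) = ((-2 : ℤ) : ℝ) := by norm_num
  simp only [hexp, Real.rpow_intCast]
  rw [inv_pow]; rfl

lemma weightedSq_eq (f : E3 → ℝ) : weightedSq f = weightedInner f f := by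
  unfold weightedSq weightedInner
  congr! 2 with p
  ring

lemma weightedSq_sub_eq (f g : E3 → ℝ) :
    weightedSq (fun p => f p - g p) = ∫ p, (weight p * f p - weight p * g p) ^ 2 := by
  simp only [weightedSq, mul_sub]

lemma weightedSq_nonneg (f : E3 → ℝ) : 0 ≤ weightedSq f := integral_nonneg fun _ => sq_nonneg _

namespace IsRegular

variable {f g : E3 → ℝ}

protected lemma zero : IsRegular fun _ => 0 := by simp [IsRegular]

protected lemma add (hf : IsRegular f) (hg : IsRegular g) : IsRegular fun p => f p + g p := by
  simpa only [IsRegular, mul_add] using! MemLp.add hf hg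

protected lemma sub (hf : IsRegular f) (hg : IsRegular g) : IsRegular fun p => f p - g p := by
  simpa only [IsRegular, mul_sub] using! MemLp.sub hf hg

lemma const_mul (hf : IsRegular f) (c : ℝ) : IsRegular fun p => c * f p := by
  simpa only [IsRegular, mul_left_comm] using! MemLp.const_mul hf c

protected lemma abs (hf : IsRegular f) : IsRegular fun p => |f p| := by
  simpa only [IsRegular, norm_mul, Real.norm_eq_abs, abs_of_pos (weight_pos _)]
    using! MemLp.norm hf

lemma integrable_one_add_norm_sq_mul (hf : IsRegular f) :
    Integrable fun p => (1 + ‖p‖ ^ 2) * f p := by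
  refine (MemLp.integrable_mul hf memLp_inv_one_add_norm_sq).congr (.of_forall fun p => ?_)
  have : 1 + ‖p‖ ^ 2 ≠ 0 := by positivity
  simp only [Pi.mul_apply, weight]
  field_simp

protected lemma integrable (hf : IsRegular f) : Integrable f :=
  (integrable_one_add_norm_sq_mul_iff.mp hf.integrable_one_add_norm_sq_mul).1

lemma integrable_kinetic (hf : IsRegular f) : Integrable fun p => ‖p‖ ^ 2 * f p :=
  (integrable_one_add_norm_sq_mul_iff.mp hf.integrable_one_add_norm_sq_mul).2

lemma integrable_weight_mul (hf : IsRegular f) (hg : IsRegular g) :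
    Integrable fun p => weight p ^ 2 * (f p * g p) :=
  (MemLp.integrable_mul hf hg).congr (.of_forall fun p => by simp only [Pi.mul_apply]; ring)

lemma weightedInner_sq_le (hf : IsRegular f) (hg : IsRegular g) :
    weightedInner f g ^ 2 ≤ weightedSq f * weightedSq g := by
  refine (congrArg (· ^ 2) ?_).trans_le (integral_mul_sq_le hf hg)
  unfold weightedInner
  congr! 2 with p
  ring

lemma integral_one_add_norm_sq_mul_abs_sq_le (hf : IsRegular f) :
    (∫ p, (1 + ‖p‖ ^ 2) * |f p|) ^ 2 ≤ weightedSq f * ∫ p : E3, ((1 + ‖p‖ ^ 2)⁻¹) ^ 2 := by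
  have hcs := integral_mul_sq_le hf.abs memLp_inv_one_add_norm_sq
  have heq (p : E3) : weight p * |f p| * (1 + ‖p‖ ^ 2)⁻¹ = (1 + ‖p‖ ^ 2) * |f p| := by
    have : 1 + ‖p‖ ^ 2 ≠ 0 := by positivity
    simp only [weight]; field_simp
  simpa only [heq, weightedSq, mul_pow, sq_abs] using hcs

lemma integral_abs_le (hf : IsRegular f) : ∫ p, |f p| ≤ ∫ p, (1 + ‖p‖ ^ 2) * |f p| := by
  refine integral_mono hf.integrable.abs hf.abs.integrable_one_add_norm_sq_mul fun p => ?_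
  nlinarith [mul_nonneg (sq_nonneg ‖p‖) (abs_nonneg (f p))]

lemma abs_integral_kinetic_le (hf : IsRegular f) :
    |∫ p, ‖p‖ ^ 2 * f p| ≤ ∫ p, (1 + ‖p‖ ^ 2) * |f p| := by
  refine abs_integral_le_integral_of_abs_le hf.abs.integrable_one_add_norm_sq_mul fun p => ?_
  rw [abs_mul, abs_of_nonneg (by positivity)]
  nlinarith [abs_nonneg (f p)]

lemma weightedSq_add_mul (hf : IsRegular f) (hg : IsRegular g) (t : ℝ) :
    weightedSq (fun p => f p + t * g p)
      = weightedSq f + t * (2 * weightedInner f g) + t ^ 2 * weightedSq g := by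
  simp only [weightedSq_eq, weightedInner]
  have hff := hf.integrable_weight_mul hf
  have hfg := (hf.integrable_weight_mul hg).const_mul (t * 2)
  have hgg := (hg.integrable_weight_mul hg).const_mul (t ^ 2)
  rw [← mul_assoc, ← integral_const_mul, ← integral_const_mul, ← integral_add hff hfg,
    ← integral_add (by exact hff.add hfg) hgg]
  congr! 2 with p
  ring

lemma tendsto_integral_one_add_norm_sq_mul_abs {gn : ℕ → E3 → ℝ} (hgn : ∀ n, IsRegular (gn n))
    (hlim : Tendsto (fun n => weightedSq (gn n)) atTop (𝓝 0)) :
    Tendsto (fun n => ∫ p, (1 + ‖p‖ ^ 2) * |gn n p|) atTop (𝓝 0) := by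
  have hsqrt : Tendsto (fun n => √(weightedSq (gn n) * ∫ p : E3, ((1 + ‖p‖ ^ 2)⁻¹) ^ 2)) atTop
      (𝓝 0) := by
    simpa only [zero_mul, Real.sqrt_zero] using (hlim.mul_const _).sqrt
  refine squeeze_zero (fun n => integral_nonneg fun p => by positivity) (fun n => ?_) hsqrt
  exact Real.le_sqrt_of_sq_le (hgn n).integral_one_add_norm_sq_mul_abs_sq_le

lemma tendsto_integral_abs {gn : ℕ → E3 → ℝ} (hgn : ∀ n, IsRegular (gn n))
    (hlim : Tendsto (fun n => weightedSq (gn n)) atTop (𝓝 0)) :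
    Tendsto (fun n => ∫ p, |gn n p|) atTop (𝓝 0) :=
  squeeze_zero (fun _ => integral_nonneg fun _ => abs_nonneg _)
    (fun n => (hgn n).integral_abs_le) (tendsto_integral_one_add_norm_sq_mul_abs hgn hlim)

lemma tendsto_integral {gn : ℕ → E3 → ℝ} (hgn : ∀ n, IsRegular (gn n))
    (hlim : Tendsto (fun n => weightedSq (gn n)) atTop (𝓝 0)) :
    Tendsto (fun n => ∫ p, gn n p) atTop (𝓝 0) :=
  squeeze_zero_norm (fun _ => abs_integral_le_integral_abs) (tendsto_integral_abs hgn hlim)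

lemma tendsto_integral_kinetic {gn : ℕ → E3 → ℝ} (hgn : ∀ n, IsRegular (gn n))
    (hlim : Tendsto (fun n => weightedSq (gn n)) atTop (𝓝 0)) :
    Tendsto (fun n => ∫ p, ‖p‖ ^ 2 * gn n p) atTop (𝓝 0) :=
  squeeze_zero_norm (fun n => (hgn n).abs_integral_kinetic_le)
    (tendsto_integral_one_add_norm_sq_mul_abs hgn hlim)

lemma tendsto_weightedInner (hf : IsRegular f) {gn : ℕ → E3 → ℝ} (hgn : ∀ n, IsRegular (gn n))
    (hlim : Tendsto (fun n => weightedSq (gn n)) atTop (𝓝 0)) :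
    Tendsto (fun n => weightedInner f (gn n)) atTop (𝓝 0) := by
  have hsqrt := (hlim.const_mul (weightedSq f)).sqrt
  rw [mul_zero, Real.sqrt_zero] at hsqrt
  exact squeeze_zero_norm (fun n => Real.abs_le_sqrt (hf.weightedInner_sq_le (hgn n))) hsqrt

theorem exists_limit {f : ℕ → E3 → ℝ} (hf : ∀ n, IsRegular (f n)) {c : ℕ → ℝ}
    (hc : Tendsto c atTop (𝓝 0)) (hle : ∀ n m, weightedSq (fun p => f n p - f m p) ≤ c n + c m) :
    ∃ g, IsRegular g ∧ Tendsto (fun n => weightedSq fun p => f n p - g p) atTop (𝓝 0) ∧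
      ∃ φ : ℕ → ℕ, StrictMono φ ∧ ∀ᵐ p, Tendsto (fun n => f (φ n) p) atTop (𝓝 (g p)) := by
  simp_rw [weightedSq_sub_eq] at hle
  obtain ⟨g, hg, hlim, φ, hφ, hae⟩ := exists_memLp_two_limit hf hc hle
  have hcancel : ∀ p, weight p * ((weight p)⁻¹ * g p) = g p := fun p =>
    mul_inv_cancel_left₀ (weight_pos p).ne' _
  refine ⟨fun p => (weight p)⁻¹ * g p, ?_, ?_, φ, hφ, ?_⟩
  · simpa only [IsRegular, hcancel] using hg
  · simpa only [weightedSq_sub_eq, hcancel] using hlim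
  · filter_upwards [hae] with p hp
    refine (hp.const_mul (weight p)⁻¹).congr fun n => ?_
    exact inv_mul_cancel_left₀ (weight_pos p).ne' _

end IsRegular

end Weighted

section Coupling

variable {E : Type*} [NormedAddCommGroup E] [InnerProductSpace ℝ E] [FiniteDimensional ℝ E]
  [MeasurableSpace E] [BorelSpace E] {k : E → ℝ} {M : ℝ} {L : ℝ≥0} {C r : ℝ} {γ α g a : E → ℝ}

namespace IsKernel

lemma integrable_mul_add (hk : IsKernel k M L C) (hp : IsAdmissible γ α) :
    Integrable fun p => k p * (γ p + α p) := by
  simpa only [mul_add] using! (hk.integrable_mul hp.integrable).add (hk.integrable_mul_right hp)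

lemma coupling_add_mul (hk : IsKernel k M L C) (hγ : Integrable γ) (hα : Integrable α)
    (hg : Integrable g) (ha : Integrable a) (t : ℝ) :
    coupling k (fun p => γ p + t * g p) (fun p => α p + t * a p)
      = coupling k γ α + t * coupling k g a := by
  unfold coupling
  have hγα : Integrable fun p => k p * (γ p + α p) := hk.integrable_mul (hγ.add hα)
  have hga : Integrable fun p => k p * (g p + a p) := hk.integrable_mul (hg.add ha)
  rw [← integral_const_mul, ← integral_add hγα (hga.const_mul t)]
  congr! 2 with p
  ring

lemma coupling_sub (hk : IsKernel k M L C) (hγ : Integrable γ) (hα : Integrable α)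
    (hg : Integrable g) (ha : Integrable a) :
    coupling k (fun p => g p - γ p) (fun p => a p - α p) = coupling k g a - coupling k γ α := by
  unfold coupling
  have hγα : Integrable fun p => k p * (γ p + α p) := hk.integrable_mul (hγ.add hα)
  have hga : Integrable fun p => k p * (g p + a p) := hk.integrable_mul (hg.add ha)
  rw [← integral_sub hga hγα]
  congr! 2 with p
  ring

lemma neg_le_coupling (hk : IsKernel k M L C) (hp : IsAdmissible γ α) :
    -(1 / 2 * ∫ p, k p) ≤ coupling k γ α := by
  rw [← integral_const_mul, ← integral_neg]
  refine integral_mono_ae (hk.integrable.const_mul _).neg (hk.integrable_mul_add hp) ?_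
  filter_upwards [hp.abs_le] with p hα
  linarith [mul_le_mul_of_nonneg_left (neg_le_of_abs_le hα) (hk.nonneg p)]

lemma abs_coupling_le (hk : IsKernel k M L C) (hp : IsAdmissible γ α) (hr : ∫ p, γ p ≤ r) :
    |coupling k γ α| ≤ 2 * M * r + 1 / 2 * ∫ p, k p := by
  have hM := hk.bound_nonneg
  refine _root_.abs_le.mpr ⟨?_, ?_⟩
  · have hmass : 0 ≤ ∫ p, γ p := integral_nonneg_of_ae hp.nonneg
    linarith [hk.neg_le_coupling hp, mul_nonneg hM (hmass.trans hr)]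
  · calc coupling k γ α ≤ ∫ p, (2 * M * γ p + 1 / 2 * k p) := by
          refine integral_mono_ae (hk.integrable_mul_add hp)
            ((hp.integrable.const_mul _).add (hk.integrable.const_mul _)) ?_
          filter_upwards [hp.abs_le, hp.nonneg] with p hα hγ
          linarith [mul_le_mul_of_nonneg_left ((le_abs_self _).trans hα) (hk.nonneg p),
            mul_le_mul_of_nonneg_right (hk.le p) hγ]
      _ = 2 * M * (∫ p, γ p) + 1 / 2 * ∫ p, k p := by
          rw [integral_add (hp.integrable.const_mul _) (hk.integrable.const_mul _),
            integral_const_mul, integral_const_mul]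
      _ ≤ 2 * M * r + 1 / 2 * ∫ p, k p := by gcongr

lemma mul_coupling_le_pairEnergy (hk : IsKernel k M L C) (hp : IsAdmissible γ α)
    (hα : Integrable α) : (r - ∫ p, γ p) * coupling k γ α ≤ pairEnergy k r γ α := by
  unfold pairEnergy
  rw [hk.interaction_eq_pairing hp.integrable hα]
  have hkin : 0 ≤ ∫ p, ‖p‖ ^ 2 * γ p :=
    integral_nonneg_of_ae (hp.nonneg.mono fun p hγ => mul_nonneg (sq_nonneg _) hγ)
  linarith [hk.pairing_self_nonneg γ hp.integrable, hk.pairing_self_nonneg α hα]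

lemma abs_coupling_le_of_integrable (hk : IsKernel k M L C) (hg : Integrable g)
    (ha : Integrable a) : |coupling k g a| ≤ M * ((∫ p, |g p|) + ∫ p, |a p|) := by
  rw [← integral_add hg.abs ha.abs, ← integral_const_mul]
  refine abs_integral_le_integral_of_abs_le ((hg.abs.add ha.abs).const_mul M) fun p => ?_
  rw [abs_mul]
  exact mul_le_mul (hk.abs_le p) (abs_add_le _ _) (abs_nonneg _) hk.bound_nonneg

lemma tendsto_coupling_zero (hk : IsKernel k M L C) {gn an : ℕ → E → ℝ}
    (hgn : ∀ n, Integrable (gn n)) (han : ∀ n, Integrable (an n))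
    (hg : Tendsto (fun n => ∫ p, |gn n p|) atTop (𝓝 0))
    (ha : Tendsto (fun n => ∫ p, |an n p|) atTop (𝓝 0)) :
    Tendsto (fun n => coupling k (gn n) (an n)) atTop (𝓝 0) :=
  squeeze_zero_norm (fun n => hk.abs_coupling_le_of_integrable (hgn n) (han n))
    (by simpa using (hg.add ha).const_mul M)

lemma tendsto_pairing_left_zero (hk : IsKernel k M L C) (hα : Integrable α) {gn : ℕ → E → ℝ}
    (hgn : ∀ n, Integrable (gn n)) (hg : Tendsto (fun n => ∫ p, |gn n p|) atTop (𝓝 0)) :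
    Tendsto (fun n => pairing k (gn n) α) atTop (𝓝 0) :=
  squeeze_zero_norm (fun n => hk.abs_pairing_le (hgn n) hα)
    (by simpa using (hg.const_mul M).mul_const (∫ p, |α p|))

lemma tendsto_pairing_self_zero (hk : IsKernel k M L C) {gn : ℕ → E → ℝ}
    (hgn : ∀ n, Integrable (gn n)) (hg : Tendsto (fun n => ∫ p, |gn n p|) atTop (𝓝 0)) :
    Tendsto (fun n => pairing k (gn n) (gn n)) atTop (𝓝 0) :=
  squeeze_zero_norm (fun n => hk.abs_pairing_le (hgn n) (hgn n))
    (by simpa using (hg.const_mul M).mul hg)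

end IsKernel

end Coupling

/-! ### The regularized problem -/

section Regularized

/-- The energy with a weighted `L²` penalty, which turns the domain into a closed subset of a
Hilbert space. -/
def regEnergy (k : E3 → ℝ) (r ε : ℝ) (γ α : E3 → ℝ) : ℝ :=
  pairEnergy k r γ α + ε * (weightedSq γ + weightedSq α)

/-- The first-order coefficient of the regularized energy along the line through `(γ, α)` in the
direction `(g, a)`. -/
def slope (k : E3 → ℝ) (r ε : ℝ) (γ α g a : E3 → ℝ) : ℝ :=
  (∫ p, ‖p‖ ^ 2 * g p) - (∫ p, g p) * coupling k γ α + (r - ∫ p, γ p) * coupling k g a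
    + pairing k g γ + pairing k a α + 2 * ε * (weightedInner γ g + weightedInner α a)

/-- The second-order coefficient of the regularized energy along a line in the direction
`(g, a)`. -/
def curvature (k : E3 → ℝ) (ε : ℝ) (g a : E3 → ℝ) : ℝ :=
  -(∫ p, g p) * coupling k g a + 1 / 2 * (pairing k g g + pairing k a a)
    + ε * (weightedSq g + weightedSq a)

/-- The domain of the regularized minimization problem. -/
structure IsRegularPair (r : ℝ) (γ α : E3 → ℝ) : Prop where
  left : IsRegular γ
  right : IsRegular α
  nonneg : ∀ᵐ p, 0 ≤ γ p
  sq_le : ∀ᵐ p, α p ^ 2 ≤ γ p * (1 + γ p)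
  mass_le : ∫ p, γ p ≤ r

/-- The minimizers of the regularized minimization problem. -/
structure IsMinimizer (k : E3 → ℝ) (r ε : ℝ) (γ α : E3 → ℝ) : Prop
    extends IsRegularPair r γ α where
  regEnergy_le : ∀ g a, IsRegularPair r g a → regEnergy k r ε γ α ≤ regEnergy k r ε g a

variable {k : E3 → ℝ} {M : ℝ} {L : ℝ≥0} {C r ε : ℝ} {γ α γ' α' g a : E3 → ℝ}

lemma sq_le_of_segment {a b g h t : ℝ} (ht0 : 0 ≤ t) (ht1 : t ≤ 1) (hg : 0 ≤ g) (hh : 0 ≤ h)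
    (ha : a ^ 2 ≤ g * (1 + g)) (hb : b ^ 2 ≤ h * (1 + h)) :
    (a + t * (b - a)) ^ 2 ≤ (g + t * (h - g)) * (1 + (g + t * (h - g))) := by
  have hs : 0 ≤ 1 - t := by linarith
  have hab : |a * b| ≤ g * h + (g + h) / 2 := by
    refine abs_le_of_sq_le_sq ?_ (by positivity)
    calc (a * b) ^ 2 = a ^ 2 * b ^ 2 := by ring
      _ ≤ (g * (1 + g)) * (h * (1 + h)) := mul_le_mul ha hb (sq_nonneg _) (by positivity)
      _ ≤ _ := by nlinarith [sq_nonneg (g - h)]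
  have hcross : 2 * (a * b) ≤ 2 * (g * h) + g + h := by linarith [le_abs_self (a * b)]
  nlinarith [mul_le_mul_of_nonneg_left ha (mul_nonneg hs hs),
    mul_le_mul_of_nonneg_left hb (mul_nonneg ht0 ht0),
    mul_le_mul_of_nonneg_left hcross (mul_nonneg ht0 hs)]

namespace IsRegularPair

lemma isPair (hp : IsRegularPair r γ α) : IsPair γ α :=
  ⟨⟨hp.left.integrable, hp.right.integrable.1, hp.nonneg, hp.sq_le⟩, hp.left.integrable_kinetic⟩

protected lemma zero (hr : 0 ≤ r) : IsRegularPair r (fun _ => 0) (fun _ => 0) :=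
  ⟨.zero, .zero, by simp, by simp, by simpa⟩

protected lemma segment (hp : IsRegularPair r γ α) (hγ : IsRegular γ') (hα : IsRegular α')
    (hnonneg : ∀ᵐ p, 0 ≤ γ' p) (hsq : ∀ᵐ p, α' p ^ 2 ≤ γ' p * (1 + γ' p)) {t : ℝ} (ht0 : 0 ≤ t)
    (ht1 : t ≤ 1) (hmass : (∫ p, γ p) + t * ((∫ p, γ' p) - ∫ p, γ p) ≤ r) :
    IsRegularPair r (fun p => γ p + t * (γ' p - γ p)) (fun p => α p + t * (α' p - α p)) where
  left := hp.left.add ((hγ.sub hp.left).const_mul t)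
  right := hp.right.add ((hα.sub hp.right).const_mul t)
  nonneg := by
    filter_upwards [hp.nonneg, hnonneg] with p h0 h0'
    nlinarith [mul_nonneg ht0 h0', mul_nonneg (sub_nonneg.mpr ht1) h0]
  sq_le := by
    filter_upwards [hp.nonneg, hnonneg, hp.sq_le, hsq] with p h0 h0' hle hle'
    exact sq_le_of_segment ht0 ht1 h0 h0' hle hle'
  mass_le := by
    have hdiff : Integrable fun p => t * (γ' p - γ p) := (hγ.sub hp.left).integrable.const_mul t
    rwa [integral_add hp.left.integrable hdiff, integral_const_mul,
      integral_sub hγ.integrable hp.left.integrable]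

end IsRegularPair

namespace IsKernel

lemma regEnergy_add_mul (hk : IsKernel k M L C) (hγ : IsRegular γ) (hα : IsRegular α)
    (hg : IsRegular g) (ha : IsRegular a) (t : ℝ) :
    regEnergy k r ε (fun p => γ p + t * g p) (fun p => α p + t * a p)
      = regEnergy k r ε γ α + t * slope k r ε γ α g a + t ^ 2 * curvature k ε g a := by
  have hkin : ∫ p, ‖p‖ ^ 2 * (γ p + t * g p) = (∫ p, ‖p‖ ^ 2 * γ p) + t * ∫ p, ‖p‖ ^ 2 * g p := by
    rw [← integral_const_mul,
      ← integral_add hγ.integrable_kinetic (hg.integrable_kinetic.const_mul t)]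
    congr! 2 with p
    ring
  have hmass : ∫ p, (γ p + t * g p) = (∫ p, γ p) + t * ∫ p, g p := by
    rw [← integral_const_mul, ← integral_add hγ.integrable (hg.integrable.const_mul t)]
  unfold regEnergy pairEnergy slope curvature
  rw [hkin, hmass, hk.coupling_add_mul hγ.integrable hα.integrable hg.integrable ha.integrable,
    hk.interaction_eq_pairing hγ.integrable hα.integrable,
    hk.interaction_eq_pairing (hγ.add (hg.const_mul t)).integrable
      (hα.add (ha.const_mul t)).integrable,
    hk.pairing_add_mul_self hγ.integrable hg.integrable,
    hk.pairing_add_mul_self hα.integrable ha.integrable,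
    hγ.weightedSq_add_mul hg, hα.weightedSq_add_mul ha]
  ring

lemma regEnergy_eq_add (hk : IsKernel k M L C) (hγ : IsRegular γ) (hα : IsRegular α)
    (hγ' : IsRegular γ') (hα' : IsRegular α') :
    regEnergy k r ε γ' α' = regEnergy k r ε γ α
      + slope k r ε γ α (fun p => γ' p - γ p) (fun p => α' p - α p)
      + curvature k ε (fun p => γ' p - γ p) (fun p => α' p - α p) := by
  simpa only [one_mul, one_pow, add_sub_cancel] using
    hk.regEnergy_add_mul (r := r) (ε := ε) hγ hα (hγ'.sub hγ) (hα'.sub hα) 1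

lemma regEnergy_midpoint (hk : IsKernel k M L C) (hγ : IsRegular γ) (hα : IsRegular α)
    (hγ' : IsRegular γ') (hα' : IsRegular α') :
    regEnergy k r ε (fun p => γ p + 1 / 2 * (γ' p - γ p)) (fun p => α p + 1 / 2 * (α' p - α p))
      = 1 / 2 * regEnergy k r ε γ α + 1 / 2 * regEnergy k r ε γ' α'
        - 1 / 4 * curvature k ε (fun p => γ' p - γ p) (fun p => α' p - α p) := by
  rw [hk.regEnergy_add_mul hγ hα (hγ'.sub hγ) (hα'.sub hα), hk.regEnergy_eq_add hγ hα hγ' hα']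
  ring

lemma mul_coupling_le_regEnergy (hk : IsKernel k M L C) (hε : 0 ≤ ε)
    (hp : IsRegularPair r γ α) : (r - ∫ p, γ p) * coupling k γ α ≤ regEnergy k r ε γ α := by
  have henergy := hk.mul_coupling_le_pairEnergy (r := r) hp.isPair.toIsAdmissible
    hp.right.integrable
  have hpenalty := mul_nonneg hε (add_nonneg (weightedSq_nonneg γ) (weightedSq_nonneg α))
  unfold regEnergy
  linarith

lemma neg_le_regEnergy (hk : IsKernel k M L C) (hε : 0 ≤ ε) (hp : IsRegularPair r γ α) :
    -(r * (1 / 2 * ∫ p, k p)) ≤ regEnergy k r ε γ α := by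
  have hcoupling := mul_le_mul_of_nonneg_left (hk.neg_le_coupling hp.isPair.toIsAdmissible)
    (sub_nonneg.mpr hp.mass_le)
  have hmass : 0 ≤ (∫ p, γ p) * ∫ p, k p :=
    mul_nonneg hp.isPair.mass_nonneg (integral_nonneg hk.nonneg)
  linarith [hk.mul_coupling_le_regEnergy hε hp]

/-- The energy is not convex, but it is so up to the difference in mass of the two pairs. -/
lemma weightedSq_sub_le (hk : IsKernel k M L C) (hp : IsRegularPair r γ α)
    (hp' : IsRegularPair r γ' α') {I : ℝ}
    (hI : ∀ g a, IsRegularPair r g a → I ≤ regEnergy k r ε g a) :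
    ε * (weightedSq (fun p => γ' p - γ p) + weightedSq (fun p => α' p - α p))
      ≤ 2 * (regEnergy k r ε γ α - I) + 2 * (regEnergy k r ε γ' α' - I)
        + |(∫ p, γ' p) - ∫ p, γ p| * (2 * (2 * M * r + 1 / 2 * ∫ p, k p)) := by
  have hmid := hI _ _ (hp.segment hp'.left hp'.right hp'.nonneg hp'.sq_le (t := 1 / 2)
    (by norm_num) (by norm_num) (by linarith [hp.mass_le, hp'.mass_le]))
  rw [hk.regEnergy_midpoint hp.left hp.right hp'.left hp'.right, curvature,
    integral_sub hp'.left.integrable hp.left.integrable, hk.coupling_sub hp.left.integrable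
      hp.right.integrable hp'.left.integrable hp'.right.integrable] at hmid
  have hγγ := hk.pairing_self_nonneg _ (hp'.left.sub hp.left).integrable
  have hαα := hk.pairing_self_nonneg _ (hp'.right.sub hp.right).integrable
  have hcross : ((∫ p, γ' p) - ∫ p, γ p) * (coupling k γ' α' - coupling k γ α)
      ≤ |(∫ p, γ' p) - ∫ p, γ p| * (2 * (2 * M * r + 1 / 2 * ∫ p, k p)) := by
    refine (le_abs_self _).trans ?_
    rw [abs_mul]
    refine mul_le_mul_of_nonneg_left ?_ (abs_nonneg _)
    linarith [abs_sub (coupling k γ' α') (coupling k γ α),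
      hk.abs_coupling_le hp.isPair.toIsAdmissible hp.mass_le,
      hk.abs_coupling_le hp'.isPair.toIsAdmissible hp'.mass_le]
  linarith

section Continuity

variable {gn an : ℕ → E3 → ℝ}

lemma tendsto_slope_zero (hk : IsKernel k M L C) (hγ : IsRegular γ) (hα : IsRegular α)
    (hgn : ∀ n, IsRegular (gn n)) (han : ∀ n, IsRegular (an n))
    (hg : Tendsto (fun n => weightedSq (gn n)) atTop (𝓝 0))
    (ha : Tendsto (fun n => weightedSq (an n)) atTop (𝓝 0)) :
    Tendsto (fun n => slope k r ε γ α (gn n) (an n)) atTop (𝓝 0) := by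
  have hg1 := IsRegular.tendsto_integral_abs hgn hg
  have ha1 := IsRegular.tendsto_integral_abs han ha
  have hcoupling := hk.tendsto_coupling_zero (fun n => (hgn n).integrable)
    (fun n => (han n).integrable) hg1 ha1
  have hpairγ := hk.tendsto_pairing_left_zero hγ.integrable (fun n => (hgn n).integrable) hg1
  have hpairα := hk.tendsto_pairing_left_zero hα.integrable (fun n => (han n).integrable) ha1
  simpa only [slope, zero_mul, mul_zero, sub_zero, add_zero] using
    (((((IsRegular.tendsto_integral_kinetic hgn hg).sub
      ((IsRegular.tendsto_integral hgn hg).mul_const (coupling k γ α))).add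
      (hcoupling.const_mul (r - ∫ p, γ p))).add hpairγ).add hpairα).add
      (((hγ.tendsto_weightedInner hgn hg).add (hα.tendsto_weightedInner han ha)).const_mul (2 * ε))

lemma tendsto_curvature_zero (hk : IsKernel k M L C)
    (hgn : ∀ n, IsRegular (gn n)) (han : ∀ n, IsRegular (an n))
    (hg : Tendsto (fun n => weightedSq (gn n)) atTop (𝓝 0))
    (ha : Tendsto (fun n => weightedSq (an n)) atTop (𝓝 0)) :
    Tendsto (fun n => curvature k ε (gn n) (an n)) atTop (𝓝 0) := by
  have hg1 := IsRegular.tendsto_integral_abs hgn hg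
  have ha1 := IsRegular.tendsto_integral_abs han ha
  have hcoupling := hk.tendsto_coupling_zero (fun n => (hgn n).integrable)
    (fun n => (han n).integrable) hg1 ha1
  have hpairg := hk.tendsto_pairing_self_zero (fun n => (hgn n).integrable) hg1
  have hpaira := hk.tendsto_pairing_self_zero (fun n => (han n).integrable) ha1
  simpa only [curvature, neg_zero, mul_zero, add_zero] using
    (((IsRegular.tendsto_integral hgn hg).neg.mul hcoupling).add
      ((hpairg.add hpaira).const_mul (1 / 2))).add ((hg.add ha).const_mul ε)

theorem tendsto_regEnergy (hk : IsKernel k M L C) (hγ : IsRegular γ) (hα : IsRegular α)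
    {γn αn : ℕ → E3 → ℝ} (hγn : ∀ n, IsRegular (γn n)) (hαn : ∀ n, IsRegular (αn n))
    (hγlim : Tendsto (fun n => weightedSq fun p => γn n p - γ p) atTop (𝓝 0))
    (hαlim : Tendsto (fun n => weightedSq fun p => αn n p - α p) atTop (𝓝 0)) :
    Tendsto (fun n => regEnergy k r ε (γn n) (αn n)) atTop (𝓝 (regEnergy k r ε γ α)) := by
  have hslope := hk.tendsto_slope_zero (r := r) (ε := ε) hγ hα (fun n => (hγn n).sub hγ)
    (fun n => (hαn n).sub hα) hγlim hαlim
  have hcurv := hk.tendsto_curvature_zero (ε := ε) (fun n => (hγn n).sub hγ)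
    (fun n => (hαn n).sub hα) hγlim hαlim
  have hsum := (hslope.const_add (regEnergy k r ε γ α)).add hcurv
  rw [add_zero, add_zero] at hsum
  exact hsum.congr fun n => (hk.regEnergy_eq_add hγ hα (hγn n) (hαn n)).symm

end Continuity

end IsKernel

namespace IsRegularPair

variable {γn αn : ℕ → E3 → ℝ}

lemma of_tendsto (hn : ∀ n, IsRegularPair r (γn n) (αn n)) (hγ : IsRegular γ) (hα : IsRegular α)
    (hlim : Tendsto (fun n => weightedSq fun p => γn n p - γ p) atTop (𝓝 0))
    (hγae : ∀ᵐ p, Tendsto (fun n => γn n p) atTop (𝓝 (γ p)))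
    (hαae : ∀ᵐ p, Tendsto (fun n => αn n p) atTop (𝓝 (α p))) : IsRegularPair r γ α where
  left := hγ
  right := hα
  nonneg := by
    filter_upwards [hγae, ae_all_iff.mpr fun n => (hn n).nonneg] with p hlim h0
    exact ge_of_tendsto' hlim h0
  sq_le := by
    filter_upwards [hγae, hαae, ae_all_iff.mpr fun n => (hn n).sq_le] with p hγp hαp hle
    exact le_of_tendsto_of_tendsto' (hαp.pow 2) (hγp.mul (hγp.const_add 1)) hle
  mass_le := by
    have hmass := IsRegular.tendsto_integral (fun n => (hn n).left.sub hγ) hlim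
    simp only [integral_sub (hn _).left.integrable hγ.integrable] at hmass
    exact le_of_tendsto' (tendsto_sub_nhds_zero_iff.mp hmass) fun n => (hn n).mass_le

theorem exists_limit (hn : ∀ n, IsRegularPair r (γn n) (αn n)) {c : ℕ → ℝ}
    (hc : Tendsto c atTop (𝓝 0))
    (hle : ∀ n m, weightedSq (fun p => γn n p - γn m p) + weightedSq (fun p => αn n p - αn m p)
      ≤ c n + c m) :
    ∃ γ α, IsRegularPair r γ α ∧ ∃ φ : ℕ → ℕ, StrictMono φ ∧
      Tendsto (fun n => weightedSq fun p => γn (φ n) p - γ p) atTop (𝓝 0) ∧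
      Tendsto (fun n => weightedSq fun p => αn (φ n) p - α p) atTop (𝓝 0) := by
  obtain ⟨γ, hγ, hγlim, φ, hφ, hγae⟩ := IsRegular.exists_limit (fun n => (hn n).left) hc
    fun n m => by linarith [hle n m, weightedSq_nonneg fun p => αn n p - αn m p]
  obtain ⟨α, hα, hαlim, ψ, hψ, hαae⟩ := IsRegular.exists_limit (fun n => (hn (φ n)).right)
    (hc.comp hφ.tendsto_atTop) fun n m => by
      simp only [Function.comp]
      linarith [hle (φ n) (φ m), weightedSq_nonneg fun p => γn (φ n) p - γn (φ m) p]
  have hγlim' := hγlim.comp (hφ.comp hψ).tendsto_atTop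
  refine ⟨γ, α, of_tendsto (fun n => hn (φ (ψ n))) hγ hα hγlim' ?_ hαae, φ ∘ ψ, hφ.comp hψ,
    hγlim', hαlim.comp hψ.tendsto_atTop⟩
  exact hγae.mono fun p hp => hp.comp hψ.tendsto_atTop

end IsRegularPair

namespace IsKernel

lemma exists_minimizing_sequence (hk : IsKernel k M L C) (hε : 0 ≤ ε) (hr : 0 ≤ r) :
    ∃ (I m : ℝ) (γn αn : ℕ → E3 → ℝ), (∀ n, IsRegularPair r (γn n) (αn n)) ∧
      (∀ g a, IsRegularPair r g a → I ≤ regEnergy k r ε g a) ∧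
      Tendsto (fun n => regEnergy k r ε (γn n) (αn n)) atTop (𝓝 I) ∧
      Tendsto (fun n => ∫ p, γn n p) atTop (𝓝 m) := by
  set S : Set ℝ := {x | ∃ g a, IsRegularPair r g a ∧ regEnergy k r ε g a = x}
  have hne : S.Nonempty := ⟨_, _, _, .zero hr, rfl⟩
  have hbdd : BddBelow S := ⟨-(r * (1 / 2 * ∫ p, k p)), by
    rintro x ⟨g, a, hga, rfl⟩
    exact hk.neg_le_regEnergy hε hga⟩
  obtain ⟨u, -, hu, huS⟩ := exists_seq_tendsto_sInf hne hbdd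
  choose γn αn hn henergy using huS
  obtain ⟨m, -, φ, hφ, hm⟩ := (isCompact_Icc (a := (0 : ℝ)) (b := r)).tendsto_subseq
    (x := fun n => ∫ p, γn n p) fun n => ⟨(hn n).isPair.mass_nonneg, (hn n).mass_le⟩
  refine ⟨sInf S, m, fun n => γn (φ n), fun n => αn (φ n), fun n => hn _,
    fun g a hga => csInf_le hbdd ⟨g, a, hga, rfl⟩, ?_, hm⟩
  exact (hu.comp hφ.tendsto_atTop).congr fun n => (henergy _).symm

theorem exists_isMinimizer (hk : IsKernel k M L C) (hε : 0 < ε) (hr : 0 ≤ r) :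
    ∃ γ α, IsMinimizer k r ε γ α := by
  obtain ⟨I, m, γn, αn, hn, hI, hE, hm⟩ := hk.exists_minimizing_sequence hε.le hr
  set Λ := 2 * (2 * M * r + 1 / 2 * ∫ p, k p)
  have hΛ : 0 ≤ Λ := by
    have hk0 : 0 ≤ ∫ p, k p := integral_nonneg hk.nonneg
    have hMr := mul_nonneg hk.bound_nonneg hr
    simp only [Λ]
    linarith
  set c : ℕ → ℝ := fun n =>
    ε⁻¹ * (2 * (regEnergy k r ε (γn n) (αn n) - I) + |(∫ p, γn n p) - m| * Λ) with hc
  have hc0 : Tendsto c atTop (𝓝 0) := by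
    simpa using (((hE.sub_const I).const_mul 2).add
      ((hm.sub_const m).abs.mul_const Λ)).const_mul ε⁻¹
  have hcauchy (n l : ℕ) : weightedSq (fun p => γn n p - γn l p)
      + weightedSq (fun p => αn n p - αn l p) ≤ c n + c l := by
    have hsub := hk.weightedSq_sub_le (hn l) (hn n) hI
    have hmass := mul_le_mul_of_nonneg_right (_root_.abs_sub_le (∫ p, γn n p) m (∫ p, γn l p)) hΛ
    rw [abs_sub_comm m] at hmass
    simp only [hc, ← mul_add, le_inv_mul_iff₀ hε, Λ] at hmass ⊢
    linarith
  obtain ⟨γ, α, hp, φ, hφ, hγ, hα⟩ := IsRegularPair.exists_limit hn hc0 hcauchy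
  have hlim := hk.tendsto_regEnergy (r := r) (ε := ε) hp.left hp.right (fun n => (hn (φ n)).left)
    (fun n => (hn (φ n)).right) hγ hα
  have hmin := tendsto_nhds_unique hlim (hE.comp hφ.tendsto_atTop)
  exact ⟨γ, α, hp, fun g a hga => hmin ▸ hI g a hga⟩

end IsKernel

end Regularized

/-! ### Euler equations -/

section Field

variable {E : Type*} [NormedAddCommGroup E] [InnerProductSpace ℝ E] [FiniteDimensional ℝ E]
  [MeasurableSpace E] [BorelSpace E]
variable {k : E → ℝ} {M : ℝ} {L : ℝ≥0} {C r : ℝ} {γ α : E → ℝ}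

/-- The derivative of the energy with respect to `γ`. -/
def fieldA (k : E → ℝ) (r : ℝ) (γ α : E → ℝ) (p : E) : ℝ :=
  ‖p‖ ^ 2 - coupling k γ α + (r - ∫ q, γ q) * k p + conv k γ p

/-- The derivative of the energy with respect to `α`. -/
def fieldB (k : E → ℝ) (r : ℝ) (γ α : E → ℝ) (p : E) : ℝ :=
  (r - ∫ q, γ q) * k p + conv k α p

lemma IsKernel.le_fieldA (hk : IsKernel k M L C) (hγ : ∀ᵐ p, 0 ≤ γ p)
    (hmass : ∫ p, γ p ≤ r) {δ : ℝ} (hδ : coupling k γ α ≤ -δ) (p : E) :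
    ‖p‖ ^ 2 + δ ≤ fieldA k r γ α p := by
  have hconv := hk.conv_nonneg hγ p
  have hcond := mul_nonneg (sub_nonneg.mpr hmass) (hk.nonneg p)
  unfold fieldA
  linarith

end Field

section Pointwise

/-- The curve `y ↦ ((√(1 + y²) - 1) / 2, y / 2)` parametrizes the extremal pairs
`a² = g (1 + g)`. -/
lemma hasDerivAt_extremal_curve (A B g a y : ℝ) :
    HasDerivAt (fun y : ℝ => A * ((√(1 + y ^ 2) - 1) / 2 - g) + B * (y / 2 - a))
      (A * (y / √(1 + y ^ 2) / 2) + B * (1 / 2)) y := by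
  have hsq : HasDerivAt (fun y : ℝ => 1 + y ^ 2) (2 * y) y := by
    simpa using (hasDerivAt_pow 2 y).const_add 1
  have hsqrt := hsq.sqrt (by positivity)
  rw [mul_div_mul_left _ _ two_ne_zero] at hsqrt
  exact ((((hsqrt.sub_const 1).div_const 2).sub_const g).const_mul A).add
    ((((hasDerivAt_id y).div_const 2).sub_const a).const_mul B)

theorem euler_of_forall_le {A B g a : ℝ} (hA : 0 < A) (hg : 0 ≤ g) (ha : a ^ 2 ≤ g * (1 + g))
    (hmin : ∀ y : ℝ, 0 ≤ A * ((√(1 + y ^ 2) - 1) / 2 - g) + B * (y / 2 - a)) :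
    a ^ 2 = g * (1 + g) ∧ 2 * a * A = -(B * (2 * g + 1)) := by
  have hle : 2 * g + 1 ≤ √(1 + (2 * a) ^ 2) := by
    have hmin_a := hmin (2 * a)
    rw [mul_div_cancel_left₀ a two_ne_zero, sub_self, mul_zero, add_zero] at hmin_a
    linarith [nonneg_of_mul_nonneg_right hmin_a hA]
  have hge : √(1 + (2 * a) ^ 2) ≤ 2 * g + 1 :=
    Real.sqrt_le_iff.mpr ⟨by linarith, by linarith⟩
  have hsqrt : √(1 + (2 * a) ^ 2) = 2 * g + 1 := le_antisymm hge hle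
  have hsq : 1 + (2 * a) ^ 2 = (2 * g + 1) ^ 2 := by
    rw [← hsqrt, Real.sq_sqrt (by positivity)]
  refine ⟨by linarith, ?_⟩
  have hlocal : IsLocalMin (fun y : ℝ => A * ((√(1 + y ^ 2) - 1) / 2 - g) + B * (y / 2 - a))
      (2 * a) := by
    refine Eventually.of_forall fun y => le_of_eq_of_le ?_ (hmin y)
    simp only [hsqrt]
    ring
  have hderiv := hlocal.hasDerivAt_eq_zero (hasDerivAt_extremal_curve A B g a (2 * a))
  rw [hsqrt] at hderiv
  have hne : 2 * g + 1 ≠ 0 := by positivity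
  field_simp at hderiv
  linarith

end Pointwise

section Isometry

variable {E : Type*} [NormedAddCommGroup E] [InnerProductSpace ℝ E] [FiniteDimensional ℝ E]
  [MeasurableSpace E] [BorelSpace E] {k : E → ℝ} {M : ℝ} {L : ℝ≥0} {C : ℝ}

lemma integral_comp_isometry (R : E ≃ₗᵢ[ℝ] E) (f : E → ℝ) : ∫ p, f (R p) = ∫ p, f p :=
  R.measurePreserving.integral_comp R.toHomeomorph.measurableEmbedding f

lemma IsKernel.coupling_comp_isometry (hk : IsKernel k M L C) (R : E ≃ₗᵢ[ℝ] E) (γ α : E → ℝ) :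
    coupling k (fun p => γ (R p)) (fun p => α (R p)) = coupling k γ α := by
  unfold coupling
  rw [← integral_comp_isometry R fun p => k p * (γ p + α p)]
  simp only [hk.radial _ _ (R.norm_map _)]

lemma IsKernel.interaction_comp_isometry (hk : IsKernel k M L C) (R : E ≃ₗᵢ[ℝ] E) (γ α : E → ℝ) :
    interaction k (fun p => γ (R p)) (fun p => α (R p)) = interaction k γ α := by
  have hinner (p : E) : ∫ q, k (p - q) * (α (R p) * α (R q) + γ (R p) * γ (R q))
      = ∫ q, k (R p - q) * (α (R p) * α q + γ (R p) * γ q) := by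
    rw [← integral_comp_isometry R fun q => k (R p - q) * (α (R p) * α q + γ (R p) * γ q)]
    simp only [← map_sub, hk.radial _ _ (R.norm_map _)]
  unfold interaction
  simp only [hinner]
  exact integral_comp_isometry R fun p => ∫ q, k (p - q) * (α p * α q + γ p * γ q)

end Isometry

section Stationary

variable {k : E3 → ℝ} {M : ℝ} {L : ℝ≥0} {C r ε : ℝ} {γ α g a : E3 → ℝ}

section Invariance

lemma weight_comp_isometry (R : E3 ≃ₗᵢ[ℝ] E3) (p : E3) : weight (R p) = weight p := by
  simp only [weight, R.norm_map]

lemma IsRegular.comp_isometry (hg : IsRegular g) (R : E3 ≃ₗᵢ[ℝ] E3) :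
    IsRegular fun p => g (R p) := by
  simpa only [IsRegular, Function.comp_def, weight_comp_isometry] using
    hg.comp_measurePreserving R.measurePreserving

lemma weightedSq_comp_isometry (R : E3 ≃ₗᵢ[ℝ] E3) (g : E3 → ℝ) :
    weightedSq (fun p => g (R p)) = weightedSq g := by
  simpa only [weightedSq, weight_comp_isometry] using
    integral_comp_isometry R fun p => (weight p * g p) ^ 2

lemma IsRegularPair.comp_isometry (hp : IsRegularPair r γ α) (R : E3 ≃ₗᵢ[ℝ] E3) :
    IsRegularPair r (fun p => γ (R p)) (fun p => α (R p)) where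
  left := hp.left.comp_isometry R
  right := hp.right.comp_isometry R
  nonneg := R.measurePreserving.quasiMeasurePreserving.ae hp.nonneg
  sq_le := R.measurePreserving.quasiMeasurePreserving.ae hp.sq_le
  mass_le := (integral_comp_isometry R γ).trans_le hp.mass_le

lemma IsKernel.regEnergy_comp_isometry (hk : IsKernel k M L C) (R : E3 ≃ₗᵢ[ℝ] E3) :
    regEnergy k r ε (fun p => γ (R p)) (fun p => α (R p)) = regEnergy k r ε γ α := by
  have hkin := integral_comp_isometry R fun p => ‖p‖ ^ 2 * γ p
  simp only [R.norm_map] at hkin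
  simp only [regEnergy, pairEnergy, hkin, integral_comp_isometry, hk.coupling_comp_isometry,
    hk.interaction_comp_isometry, weightedSq_comp_isometry]

lemma IsRegular.ae_eq_of_weightedSq_sub_eq_zero (hf : IsRegular γ) (hg : IsRegular g)
    (hzero : weightedSq (fun p => γ p - g p) = 0) : γ =ᵐ[volume] g := by
  have hint : Integrable fun p => (weight p * (γ p - g p)) ^ 2 := MemLp.integrable_sq (hf.sub hg)
  filter_upwards [(integral_eq_zero_iff_of_nonneg (fun p => sq_nonneg _) hint).mp hzero] with p hp
  have hmul : weight p * (γ p - g p) = 0 := (pow_eq_zero_iff two_ne_zero).mp hp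
  exact sub_eq_zero.mp ((mul_eq_zero.mp hmul).resolve_left (weight_pos p).ne')

/-- The rotated minimizer has the same mass, and on pairs of equal mass the energy is strictly
convex. -/
theorem IsMinimizer.comp_isometry_ae_eq (hmin : IsMinimizer k r ε γ α) (hk : IsKernel k M L C)
    (hε : 0 < ε) (R : E3 ≃ₗᵢ[ℝ] E3) :
    (fun p => γ (R p)) =ᵐ[volume] γ ∧ (fun p => α (R p)) =ᵐ[volume] α := by
  have hp := hmin.toIsRegularPair
  have hpR := hp.comp_isometry R
  have hsub := hk.weightedSq_sub_le hp hpR hmin.regEnergy_le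
  rw [hk.regEnergy_comp_isometry R, integral_comp_isometry R γ] at hsub
  simp only [sub_self, mul_zero, abs_zero, zero_mul, add_zero] at hsub
  have hsum := nonpos_of_mul_nonpos_right hsub hε
  have hγ := weightedSq_nonneg fun p => γ (R p) - γ p
  have hα := weightedSq_nonneg fun p => α (R p) - α p
  exact ⟨hpR.left.ae_eq_of_weightedSq_sub_eq_zero hp.left (by linarith),
    hpR.right.ae_eq_of_weightedSq_sub_eq_zero hp.right (by linarith)⟩

end Invariance

/-- The derivative of the regularized energy with respect to `γ`. -/
def regFieldA (k : E3 → ℝ) (r ε : ℝ) (γ α : E3 → ℝ) (p : E3) : ℝ :=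
  fieldA k r γ α p + 2 * ε * weight p ^ 2 * γ p

/-- The derivative of the regularized energy with respect to `α`. -/
def regFieldB (k : E3 → ℝ) (r ε : ℝ) (γ α : E3 → ℝ) (p : E3) : ℝ :=
  fieldB k r γ α p + 2 * ε * weight p ^ 2 * α p

namespace IsKernel

lemma integrable_regFieldA_mul (hk : IsKernel k M L C) (hγ : IsRegular γ) (hg : IsRegular g) :
    Integrable fun p => regFieldA k r ε γ α p * g p := by
  refine ((((hg.integrable_kinetic.sub (hg.integrable.const_mul (coupling k γ α))).add
    ((hk.integrable_mul hg.integrable).const_mul (r - ∫ q, γ q))).add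
    (hk.integrable_mul_conv hg.integrable hγ.integrable)).add
    ((hγ.integrable_weight_mul hg).const_mul (2 * ε))).congr (Eventually.of_forall fun p => ?_)
  simp only [Pi.add_apply, Pi.sub_apply, regFieldA, fieldA]
  ring

lemma integrable_regFieldB_mul (hk : IsKernel k M L C) (hα : IsRegular α) (ha : IsRegular a) :
    Integrable fun p => regFieldB k r ε γ α p * a p := by
  refine ((((hk.integrable_mul ha.integrable).const_mul (r - ∫ q, γ q)).add
    (hk.integrable_mul_conv ha.integrable hα.integrable)).add
    ((hα.integrable_weight_mul ha).const_mul (2 * ε))).congr (Eventually.of_forall fun p => ?_)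
  simp only [Pi.add_apply, regFieldB, fieldB]
  ring

lemma integral_regFieldA_mul (hk : IsKernel k M L C) (hγ : IsRegular γ) (hg : IsRegular g) :
    ∫ p, regFieldA k r ε γ α p * g p
      = (∫ p, ‖p‖ ^ 2 * g p) - coupling k γ α * (∫ p, g p)
        + (r - ∫ q, γ q) * (∫ p, k p * g p) + pairing k g γ + 2 * ε * weightedInner γ g := by
  have hmass := hg.integrable.const_mul (coupling k γ α)
  have hcond := (hk.integrable_mul hg.integrable).const_mul (r - ∫ q, γ q)
  have hpair := hk.integrable_mul_conv hg.integrable hγ.integrable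
  have hweight := (hγ.integrable_weight_mul hg).const_mul (2 * ε)
  have hkin := hg.integrable_kinetic
  unfold pairing weightedInner
  rw [← integral_const_mul, ← integral_const_mul, ← integral_const_mul,
    ← integral_sub hkin hmass, ← integral_add (by exact hkin.sub hmass) hcond,
    ← integral_add (by exact (hkin.sub hmass).add hcond) hpair,
    ← integral_add (by exact ((hkin.sub hmass).add hcond).add hpair) hweight]
  congr! 2 with p
  simp only [regFieldA, fieldA]
  ring

lemma integral_regFieldB_mul (hk : IsKernel k M L C) (hα : IsRegular α) (ha : IsRegular a) :
    ∫ p, regFieldB k r ε γ α p * a p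
      = (r - ∫ q, γ q) * (∫ p, k p * a p) + pairing k a α + 2 * ε * weightedInner α a := by
  have hcond := (hk.integrable_mul ha.integrable).const_mul (r - ∫ q, γ q)
  have hpair := hk.integrable_mul_conv ha.integrable hα.integrable
  have hweight := (hα.integrable_weight_mul ha).const_mul (2 * ε)
  unfold pairing weightedInner
  rw [← integral_const_mul, ← integral_const_mul, ← integral_add hcond hpair,
    ← integral_add (by exact hcond.add hpair) hweight]
  congr! 2 with p
  simp only [regFieldB, fieldB]
  ring

lemma slope_eq (hk : IsKernel k M L C) (hγ : IsRegular γ) (hα : IsRegular α)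
    (hg : IsRegular g) (ha : IsRegular a) :
    slope k r ε γ α g a
      = ∫ p, (regFieldA k r ε γ α p * g p + regFieldB k r ε γ α p * a p) := by
  have hsplit : coupling k g a = (∫ p, k p * g p) + ∫ p, k p * a p := by
    unfold coupling
    rw [← integral_add (hk.integrable_mul hg.integrable) (hk.integrable_mul ha.integrable)]
    simp only [mul_add]
  rw [integral_add (hk.integrable_regFieldA_mul hγ hg) (hk.integrable_regFieldB_mul hα ha),
    hk.integral_regFieldA_mul hγ hg, hk.integral_regFieldB_mul hα ha, slope, hsplit]
  ring

end IsKernel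

lemma isRegular_indicator_of_bound {f : E3 → ℝ} (hf : AEStronglyMeasurable f) {S : Set E3}
    (hS : MeasurableSet S) {R c : ℝ} (hSR : S ⊆ Metric.closedBall 0 R)
    (hc : ∀ᵐ p, p ∈ S → |f p| ≤ c) : IsRegular (S.indicator f) := by
  have hind : (fun p => weight p * S.indicator f p) = S.indicator fun p => weight p * f p := by
    funext p
    by_cases hp : p ∈ S <;> simp [hp]
  have hfinite : IsFiniteMeasure (volume.restrict S) := ⟨by
    rw [Measure.restrict_apply_univ]
    exact (measure_mono hSR).trans_lt measure_closedBall_lt_top⟩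
  unfold IsRegular
  rw [hind, memLp_indicator_iff_restrict hS]
  refine MemLp.of_bound (continuous_weight.aestronglyMeasurable.mul hf.restrict)
    ((1 + R ^ 2) ^ 2 * c) ?_
  filter_upwards [ae_restrict_mem hS, ae_restrict_of_ae hc] with p hp hfc
  have hpR : ‖p‖ ≤ R := mem_closedBall_zero_iff.mp (hSR hp)
  rw [norm_mul, Real.norm_eq_abs, Real.norm_eq_abs, abs_of_pos (weight_pos p), weight]
  exact mul_le_mul (by gcongr) (hfc hp) (abs_nonneg _) (by positivity)

lemma IsRegular.indicator (hg : IsRegular g) {S : Set E3} (hS : MeasurableSet S) :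
    IsRegular (S.indicator g) := by
  refine (MemLp.indicator hS hg).ae_eq (Eventually.of_forall fun p => ?_)
  by_cases hp : p ∈ S <;> simp [hp]

namespace IsMinimizer

theorem slope_nonneg (hmin : IsMinimizer k r ε γ α) (hk : IsKernel k M L C)
    (hmass : ∫ p, γ p < r) (hg : IsRegular g) (ha : IsRegular a) (hnonneg : ∀ᵐ p, 0 ≤ g p)
    (hsq : ∀ᵐ p, a p ^ 2 ≤ g p * (1 + g p)) :
    0 ≤ slope k r ε γ α (fun p => g p - γ p) (fun p => a p - α p) := by
  have hp := hmin.toIsRegularPair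
  set s := slope k r ε γ α (fun p => g p - γ p) (fun p => a p - α p)
  set c := curvature k ε (fun p => g p - γ p) (fun p => a p - α p)
  have hright {f : ℝ → ℝ} (hf : Continuous f) : Tendsto f (𝓝[>] 0) (𝓝 (f 0)) :=
    (hf.tendsto 0).mono_left nhdsWithin_le_nhds
  have hquot := hright (f := fun t => s + t * c) (by fun_prop)
  have hsegment := hright (f := fun t => (∫ p, γ p) + t * ((∫ p, g p) - ∫ p, γ p)) (by fun_prop)
  simp only [zero_mul, add_zero] at hquot hsegment
  refine ge_of_tendsto hquot ?_
  filter_upwards [self_mem_nhdsWithin, hsegment.eventually_lt_const hmass,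
    nhdsWithin_le_nhds (eventually_lt_nhds one_pos)] with t ht hmass_t ht1
  rw [Set.mem_Ioi] at ht
  have hle := hmin.regEnergy_le _ _ (hp.segment hg ha hnonneg hsq ht.le ht1.le hmass_t.le)
  rw [hk.regEnergy_add_mul hp.left hp.right (hg.sub hp.left) (ha.sub hp.right)] at hle
  exact nonneg_of_mul_nonneg_right (by linarith : 0 ≤ t * (s + t * c)) ht

/-- The first-order condition against the competitor equal to `(x, y)` on `S` and to `(γ, α)` off
`S`. -/
lemma indicator_linear_nonneg (hmin : IsMinimizer k r ε γ α) (hk : IsKernel k M L C)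
    (hmass : ∫ p, γ p < r) {x y : ℝ} (hx : 0 ≤ x) (hxy : y ^ 2 ≤ x * (1 + x)) {S : Set E3}
    (hS : MeasurableSet S) {R : ℝ} (hSR : S ⊆ Metric.closedBall 0 R) :
    let φ := fun p => regFieldA k r ε γ α p * (x - γ p) + regFieldB k r ε γ α p * (y - α p)
    IntegrableOn φ S ∧ 0 ≤ ∫ p in S, φ p := by
  intro φ
  have hp := hmin.toIsRegularPair
  have hconst (c : ℝ) : IsRegular (S.indicator fun _ => c) :=
    isRegular_indicator_of_bound aestronglyMeasurable_const hS hSR (.of_forall fun _ _ => le_rfl)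
  have hg := (hconst x).add (hp.left.indicator hS.compl)
  have ha := (hconst y).add (hp.right.indicator hS.compl)
  have hφ : S.indicator φ = fun p =>
      regFieldA k r ε γ α p * (S.indicator (fun _ => x) p + Sᶜ.indicator γ p - γ p)
        + regFieldB k r ε γ α p * (S.indicator (fun _ => y) p + Sᶜ.indicator α p - α p) := by
    funext p
    by_cases hpS : p ∈ S <;> simp [hpS, φ]
  rw [← integrable_indicator_iff hS, ← integral_indicator hS, hφ]
  refine ⟨(hk.integrable_regFieldA_mul hp.left (hg.sub hp.left)).add
    (hk.integrable_regFieldB_mul hp.right (ha.sub hp.right)), ?_⟩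
  rw [← hk.slope_eq hp.left hp.right (hg.sub hp.left) (ha.sub hp.right)]
  refine hmin.slope_nonneg hk hmass hg ha ?_ ?_
  · filter_upwards [hp.nonneg] with p hγ
    by_cases hpS : p ∈ S <;> simp [hpS, hx, hγ]
  · filter_upwards [hp.sq_le] with p hsq
    by_cases hpS : p ∈ S <;> simp [hpS, hxy, hsq]

theorem ae_linear_nonneg (hmin : IsMinimizer k r ε γ α) (hk : IsKernel k M L C)
    (hmass : ∫ p, γ p < r) {x y : ℝ} (hx : 0 ≤ x) (hxy : y ^ 2 ≤ x * (1 + x)) :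
    ∀ᵐ p, 0 ≤ regFieldA k r ε γ α p * (x - γ p) + regFieldB k r ε γ α p * (y - α p) := by
  have hball (n : ℕ) : ∀ᵐ p ∂volume.restrict (Metric.closedBall (0 : E3) n),
      0 ≤ regFieldA k r ε γ α p * (x - γ p) + regFieldB k r ε γ α p * (y - α p) := by
    refine ae_nonneg_of_forall_setIntegral_nonneg
      (hmin.indicator_linear_nonneg hk hmass hx hxy measurableSet_closedBall subset_rfl).1
      fun S hS _ => ?_
    rw [Measure.restrict_restrict hS]
    exact (hmin.indicator_linear_nonneg hk hmass hx hxy (hS.inter measurableSet_closedBall)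
      Set.inter_subset_right).2
  filter_upwards [ae_all_iff.mpr fun n =>
    (ae_restrict_iff' measurableSet_closedBall).mp (hball n)] with p hp
  obtain ⟨n, hn⟩ := exists_nat_ge ‖p‖
  exact hp n (mem_closedBall_zero_iff.mpr hn)

theorem ae_euler (hmin : IsMinimizer k r ε γ α) (hk : IsKernel k M L C)
    (hmass : ∫ p, γ p < r) (hpos : ∀ᵐ p, 0 < regFieldA k r ε γ α p) :
    ∀ᵐ p, α p ^ 2 = γ p * (1 + γ p) ∧
      2 * α p * regFieldA k r ε γ α p = -(regFieldB k r ε γ α p * (2 * γ p + 1)) := by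
  have hlinear := ae_all_iff.mpr fun y : ℚ =>
    hmin.ae_linear_nonneg hk hmass (x := (√(1 + (y : ℝ) ^ 2) - 1) / 2) (y := (y : ℝ) / 2)
      (by linarith [Real.one_le_sqrt.mpr (le_add_of_nonneg_right (sq_nonneg (y : ℝ)))])
      (by linarith [Real.sq_sqrt (show 0 ≤ 1 + (y : ℝ) ^ 2 by positivity)])
  filter_upwards [hlinear, hmin.nonneg, hmin.sq_le, hpos] with p hlin hγ hsq hA
  refine euler_of_forall_le hA hγ hsq fun y => ?_
  have hclosed : IsClosed {y : ℝ | 0 ≤ regFieldA k r ε γ α p * ((√(1 + y ^ 2) - 1) / 2 - γ p)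
      + regFieldB k r ε γ α p * (y / 2 - α p)} := isClosed_le continuous_const (by fun_prop)
  exact isClosed_property Rat.isDenseEmbedding_coe_real.dense hclosed hlin y

end IsMinimizer

/-- The properties of the minimizers of the regularized problem that persist in the limit
`ε → 0`. -/
structure IsStationary (k : E3 → ℝ) (r ε δ : ℝ) (γ α : E3 → ℝ) : Prop where
  pair : IsRegularPair r γ α
  inv_left : ∀ R : E3 ≃ₗᵢ[ℝ] E3, (fun p => γ (R p)) =ᵐ[volume] γ
  inv_right : ∀ R : E3 ≃ₗᵢ[ℝ] E3, (fun p => α (R p)) =ᵐ[volume] α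
  coupling_le : coupling k γ α ≤ -δ
  sq_eq : ∀ᵐ p, α p ^ 2 = γ p * (1 + γ p)
  euler : ∀ᵐ p, 2 * α p * regFieldA k r ε γ α p = -(regFieldB k r ε γ α p * (2 * γ p + 1))

theorem IsMinimizer.isStationary (hmin : IsMinimizer k r ε γ α) (hk : IsKernel k M L C)
    (hε : 0 < ε) (hr : 0 < r) {η : ℝ} (hη : 0 < η) (hneg : regEnergy k r ε γ α ≤ -η) :
    IsStationary k r ε (η / r) γ α := by
  have hp := hmin.toIsRegularPair
  have hprod := (hk.mul_coupling_le_regEnergy hε.le hp).trans hneg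
  have hmass : ∫ p, γ p < r := hp.mass_le.lt_of_ne fun heq => by
    rw [heq, sub_self, zero_mul] at hprod
    linarith
  have hcoupling : coupling k γ α ≤ -(η / r) := by
    have hnonpos : coupling k γ α ≤ 0 := by
      by_contra! hpos
      linarith [mul_pos (sub_pos.mpr hmass) hpos]
    have hmul := mul_nonneg_of_nonpos_of_nonpos hnonpos (neg_nonpos.mpr hp.isPair.mass_nonneg)
    rw [← neg_div, le_div_iff₀ hr]
    linarith
  have hA : ∀ᵐ p, 0 < regFieldA k r ε γ α p := by
    filter_upwards [hp.nonneg] with p hγ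
    have hfield := hk.le_fieldA hp.nonneg hp.mass_le hcoupling p
    have hδ := div_pos hη hr
    have hpenalty : 0 ≤ 2 * ε * weight p ^ 2 * γ p := by positivity
    unfold regFieldA
    linarith [sq_nonneg ‖p‖]
  have heuler := hmin.ae_euler hk hmass hA
  exact ⟨hp, fun R => (hmin.comp_isometry_ae_eq hk hε R).1,
    fun R => (hmin.comp_isometry_ae_eq hk hε R).2, hcoupling,
    heuler.mono fun p h => h.1, heuler.mono fun p h => h.2⟩

end Stationary

section Truncation

section Generic

variable {E : Type*} [NormedAddCommGroup E] [InnerProductSpace ℝ E] [FiniteDimensional ℝ E]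
  [MeasurableSpace E] [BorelSpace E]
variable {k : E → ℝ} {M : ℝ} {L : ℝ≥0} {C r : ℝ} {γ α h : E → ℝ} {γn αn : ℕ → E → ℝ}

lemma tendsto_indicator_of_eventually_mem {X : Type*} {S : ℕ → Set X} {p : X}
    (h : ∀ᶠ n in atTop, p ∈ S n) (f : X → ℝ) :
    Tendsto (fun n => (S n).indicator f p) atTop (𝓝 (f p)) :=
  tendsto_const_nhds.congr' (h.mono fun _ hn => (Set.indicator_of_mem hn f).symm)

lemma exists_exhausting_measurableSet {X : Type*} [PseudoMetricSpace X] [MeasurableSpace X]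
    [OpensMeasurableSpace X] {μ : Measure X} {f : X → ℝ} (hf : AEStronglyMeasurable f μ) (x : X) :
    ∃ S : ℕ → Set X, (∀ n, MeasurableSet (S n)) ∧ (∀ n, S n ⊆ Metric.closedBall x n) ∧
      (∀ p, ∀ᶠ n in atTop, p ∈ S n) ∧ ∀ n, ∀ᵐ p ∂μ, p ∈ S n → f p ≤ n := by
  obtain ⟨g, hg, hfg⟩ := hf
  refine ⟨fun n => Metric.closedBall x n ∩ {p | g p ≤ n}, fun n =>
    measurableSet_closedBall.inter (measurableSet_le hg.measurable measurable_const),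
    fun n => Set.inter_subset_left, fun p => ?_, fun n => ?_⟩
  · filter_upwards [tendsto_natCast_atTop_atTop.eventually_ge_atTop (dist p x),
      tendsto_natCast_atTop_atTop.eventually_ge_atTop (g p)] with n hdist hgn
    exact ⟨hdist, hgn⟩
  · filter_upwards [hfg] with p hp hpS
    exact hp ▸ hpS.2

lemma IsPair.indicator_le (hp : IsPair γ α) (S : Set E) : ∀ᵐ p, S.indicator γ p ≤ γ p := by
  filter_upwards [hp.nonneg] with p hγ using Set.indicator_le_self' (fun _ _ => hγ) p

lemma IsPair.dominatedConvergence_indicator (hp : IsPair γ α) {S : ℕ → Set E}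
    (hS : ∀ n, MeasurableSet (S n)) (hlim : ∀ᵐ p, ∀ᶠ n in atTop, p ∈ S n) :
    DominatedConvergence (fun n => (S n).indicator γ) (fun n => (S n).indicator α) γ α γ where
  integrable_bound := hp.integrable
  isAdmissible n := (hp.indicator (hS n)).toIsAdmissible
  le_bound n := hp.indicator_le (S n)
  tendsto_left := hlim.mono fun _ h => tendsto_indicator_of_eventually_mem h γ
  tendsto_right := hlim.mono fun _ h => tendsto_indicator_of_eventually_mem h α

namespace DominatedConvergence

theorem tendsto_coupling (hd : DominatedConvergence γn αn γ α h) (hk : IsKernel k M L C) :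
    Tendsto (fun n => coupling k (γn n) (αn n)) atTop (𝓝 (coupling k γ α)) := by
  simp only [hk.coupling_eq_add hd.isAdmissible_limit, hk.coupling_eq_add (hd.isAdmissible _)]
  exact (tendsto_integral_mul_left hk hd).add (tendsto_integral_mul_right hk hd)

theorem tendsto_integral_kinetic (hd : DominatedConvergence γn αn γ α h)
    (hh : Integrable fun p => ‖p‖ ^ 2 * h p) :
    Tendsto (fun n => ∫ p, ‖p‖ ^ 2 * γn n p) atTop (𝓝 (∫ p, ‖p‖ ^ 2 * γ p)) := by
  refine tendsto_integral_of_dominated_convergence _ (fun n => (by fun_prop :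
    AEStronglyMeasurable fun p : E => ‖p‖ ^ 2).mul (hd.isAdmissible n).integrable.1) hh
    (fun n => ?_) (hd.tendsto_left.mono fun _ hp => hp.const_mul _)
  filter_upwards [hd.norm_le_bound n] with p hle
  rw [norm_mul, Real.norm_of_nonneg (sq_nonneg _)]
  gcongr

theorem tendsto_pairEnergy (hd : DominatedConvergence γn αn γ α h) (hk : IsKernel k M L C)
    (hh : Integrable fun p => ‖p‖ ^ 2 * h p) :
    Tendsto (fun n => pairEnergy k r (γn n) (αn n)) atTop (𝓝 (pairEnergy k r γ α)) :=
  ((hd.tendsto_integral_kinetic hh).add ((hd.tendsto_integral.const_sub r).mul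
    (hd.tendsto_coupling hk))).add ((tendsto_interaction hk hd).const_mul _)

end DominatedConvergence

end Generic

variable {k : E3 → ℝ} {M : ℝ} {L : ℝ≥0} {C r I : ℝ} {γ α : E3 → ℝ}

theorem IsKernel.exists_isRegularPair (hk : IsKernel k M L C) (hp : IsPair γ α)
    (hmass : ∫ p, γ p ≤ r) {η : ℝ} (hη : 0 < η) :
    ∃ g a, IsRegularPair r g a ∧ pairEnergy k r g a < pairEnergy k r γ α + η := by
  obtain ⟨S, hS, hball, hexhaust, hle⟩ := exists_exhausting_measurableSet hp.integrable.1 0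
  have hleft (n : ℕ) : ∀ᵐ p, p ∈ S n → |γ p| ≤ n := by
    filter_upwards [hle n, hp.nonneg] with p hγn hγ hpS
    exact (abs_of_nonneg hγ).le.trans (hγn hpS)
  have hright (n : ℕ) : ∀ᵐ p, p ∈ S n → |α p| ≤ n + 1 / 2 := by
    filter_upwards [hle n, hp.abs_le] with p hγn hα hpS using by linarith [hγn hpS]
  have hreg (n : ℕ) : IsRegularPair r ((S n).indicator γ) ((S n).indicator α) :=
    ⟨isRegular_indicator_of_bound hp.integrable.1 (hS n) (hball n) (hleft n),
      isRegular_indicator_of_bound hp.aestronglyMeasurable (hS n) (hball n) (hright n),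
      (hp.indicator (hS n)).nonneg, (hp.indicator (hS n)).sq_le,
      (integral_mono_ae (hp.indicator (hS n)).integrable hp.integrable
        (hp.indicator_le (S n))).trans hmass⟩
  have hlim := (hp.dominatedConvergence_indicator hS (.of_forall hexhaust)).tendsto_pairEnergy
    (r := r) hk hp.integrable_kinetic
  obtain ⟨n, hn⟩ := (hlim.eventually_lt_const (lt_add_of_pos_right _ hη)).exists
  exact ⟨_, _, hreg n, hn⟩

theorem IsKernel.exists_isStationary (hk : IsKernel k M L C) (hr : 0 < r)
    (hinf : ∀ η > 0, ∃ γ α, IsPair γ α ∧ ∫ p, γ p ≤ r ∧ pairEnergy k r γ α < I + η)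
    {η ε₀ : ℝ} (hη : 0 < η) (hηI : η ≤ -I / 2) (hε₀ : 0 < ε₀) :
    ∃ ε γ α, 0 < ε ∧ ε ≤ ε₀ ∧ IsStationary k r ε (-I / 2 / r) γ α ∧
      pairEnergy k r γ α ≤ I + η := by
  obtain ⟨γ₁, α₁, hpair, hmass, henergy⟩ := hinf (η / 3) (by positivity)
  obtain ⟨g, a, hga, hclose⟩ := hk.exists_isRegularPair hpair hmass (η := η / 3) (by positivity)
  have hpenalty : 0 ≤ weightedSq g + weightedSq a :=
    add_nonneg (weightedSq_nonneg g) (weightedSq_nonneg a)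
  set ε := min ε₀ (η / 3 / (weightedSq g + weightedSq a + 1))
  have hε : 0 < ε := lt_min hε₀ (by positivity)
  obtain ⟨γ, α, hmin⟩ := hk.exists_isMinimizer hε hr.le
  have hsmall : ε * (weightedSq g + weightedSq a) ≤ η / 3 :=
    calc ε * (weightedSq g + weightedSq a) ≤ ε * (weightedSq g + weightedSq a + 1) := by
          exact mul_le_mul_of_nonneg_left (by linarith) hε.le
      _ ≤ _ := (le_div_iff₀ (by positivity)).mp (min_le_right _ _)
  have hreg : regEnergy k r ε γ α ≤ I + η := by
    refine (hmin.regEnergy_le g a hga).trans ?_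
    unfold regEnergy
    linarith
  refine ⟨ε, γ, α, hε, min_le_left _ _,
    hmin.isStationary hk hε hr (by linarith) (by linarith), hreg.trans' ?_⟩
  exact le_add_of_nonneg_right
    (mul_nonneg hε.le (add_nonneg (weightedSq_nonneg γ) (weightedSq_nonneg α)))

theorem IsKernel.exists_stationary_sequence (hk : IsKernel k M L C) (hr : 0 < r) (hI : I < 0)
    (hinf : ∀ η > 0, ∃ γ α, IsPair γ α ∧ ∫ p, γ p ≤ r ∧ pairEnergy k r γ α < I + η) :
    ∃ (ε : ℕ → ℝ) (γ α : ℕ → E3 → ℝ), (∀ n, 0 < ε n) ∧ Tendsto ε atTop (𝓝 0) ∧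
      (∀ n, IsStationary k r (ε n) (-I / 2 / r) (γ n) (α n)) ∧
      ∀ η > 0, ∀ᶠ n in atTop, pairEnergy k r (γ n) (α n) < I + η := by
  have hpos (n : ℕ) : (0 : ℝ) < 1 / (n + 1) := by positivity
  choose ε γ α hε hεle hstat henergy using fun n : ℕ =>
    hk.exists_isStationary hr hinf (lt_min (hpos n) (by linarith : 0 < -I / 2))
      (min_le_right _ _) (hpos n)
  have hzero : Tendsto (fun n : ℕ => 1 / ((n : ℝ) + 1)) atTop (𝓝 0) :=
    tendsto_one_div_add_atTop_nhds_zero_nat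
  refine ⟨ε, γ, α, hε, squeeze_zero (fun n => (hε n).le) hεle hzero, hstat, fun η hη => ?_⟩
  filter_upwards [hzero.eventually_lt_const hη] with n hn
  linarith [henergy n, min_le_left (1 / ((n : ℝ) + 1)) (-I / 2)]

end Truncation

section Scalar

/-- The pointwise relations between the values `g = γ(p)`, `a = α(p)` of a stationary point and the
values `A`, `B` of its fields; `w` is the weight of the regularization. -/
structure IsEulerPoint (A B w g a : ℝ) : Prop where
  pos : 0 < A
  weight_nonneg : 0 ≤ w
  nonneg : 0 ≤ g
  sq_eq : a ^ 2 = g * (1 + g)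
  euler : 2 * a * (A + w * g) = -((B + w * a) * (2 * g + 1))

namespace IsEulerPoint

variable {A B w g a : ℝ}

lemma abs_identity (h : IsEulerPoint A B w g a) :
    |a| * (2 * A + w * (4 * g + 1)) = |B| * (2 * g + 1) := by
  have hw := h.weight_nonneg
  have hg := h.nonneg
  have hidentity : a * (2 * A + w * (4 * g + 1)) = -(B * (2 * g + 1)) := by
    linear_combination h.euler
  have habs := congrArg abs hidentity
  have hA := h.pos
  rwa [abs_mul, abs_neg, abs_mul, abs_of_pos (a := 2 * g + 1) (by positivity),
    abs_of_pos (a := 2 * A + w * (4 * g + 1)) (by positivity)] at habs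

lemma abs_right_le (h : IsEulerPoint A B w g a) : |a| ≤ g + 1 / 2 :=
  abs_le_add_half_of_sq_le h.nonneg h.sq_eq.le

lemma two_mul_abs_mul_le (h : IsEulerPoint A B w g a) : 2 * |a| * A ≤ |B| * (2 * g + 1) := by
  have hw := h.weight_nonneg
  have hg := h.nonneg
  have : 0 ≤ |a| * (w * (4 * g + 1)) := by positivity
  linarith [h.abs_identity]

lemma upper_bound (h : IsEulerPoint A B w g a) :
    4 * (g * (1 + g)) * (A ^ 2 - B ^ 2) ≤ B ^ 2 := by
  have hA := h.pos
  have hsq := pow_le_pow_left₀ (by positivity) h.two_mul_abs_mul_le 2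
  rw [mul_pow, mul_pow, mul_pow, sq_abs, sq_abs, h.sq_eq] at hsq
  linarith

lemma abs_field_le (h : IsEulerPoint A B w g a) : |B| ≤ A + w * (2 * g + 1) := by
  have hA := h.pos
  have hw := h.weight_nonneg
  have hg := h.nonneg
  have hbound : |a| * (2 * A + w * (4 * g + 1)) ≤ (g + 1 / 2) * (2 * A + w * (4 * g + 1)) :=
    mul_le_mul_of_nonneg_right h.abs_right_le (by positivity)
  rw [h.abs_identity] at hbound
  refine le_of_mul_le_mul_right ?_ (by positivity : 0 < 2 * g + 1)
  nlinarith [show 0 ≤ w * (2 * g + 1) by positivity]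

lemma lower_bound (h : IsEulerPoint A B w g a) :
    A / 2 ≤ (A - |B|) * (2 * g + 1) ^ 2 + w * (2 * g + 1) ^ 3 := by
  have hw := h.weight_nonneg
  have hg := h.nonneg
  have ha := h.abs_right_le
  have hfactor : (2 * g + 1 - 2 * |a|) * (2 * g + 1 + 2 * |a|) = 1 := by
    nlinarith [sq_abs a, h.sq_eq]
  have hgap : 1 ≤ (2 * g + 1 - 2 * |a|) * (2 * (2 * g + 1)) := by
    nlinarith [show 0 ≤ 2 * g + 1 - 2 * |a| by linarith]
  have hweight : |a| * (w * (4 * g + 1)) ≤ w * (2 * g + 1) ^ 2 := by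
    have := mul_le_mul_of_nonneg_right ha (show 0 ≤ w * (4 * g + 1) by positivity)
    nlinarith [mul_nonneg hw hg]
  have hlin : A * (2 * g + 1 - 2 * |a|) ≤ (A - |B|) * (2 * g + 1) + w * (2 * g + 1) ^ 2 := by
    linarith [h.abs_identity]
  nlinarith [mul_le_mul_of_nonneg_right hlin (show 0 ≤ 2 * g + 1 by positivity),
    mul_le_mul_of_nonneg_left hgap h.pos.le]

lemma half_le_of_left_le (h : IsEulerPoint A B w g a) {δ t : ℝ} (hδ : δ ≤ A) (hgt : g ≤ t) :
    δ / 2 ≤ abs (A - |B|) * (2 * t + 1) ^ 2 + w * (2 * t + 1) ^ 3 := by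
  have hg := h.nonneg
  have hw := h.weight_nonneg
  calc δ / 2 ≤ A / 2 := by linarith
    _ ≤ (A - |B|) * (2 * g + 1) ^ 2 + w * (2 * g + 1) ^ 3 := h.lower_bound
    _ ≤ abs (A - |B|) * (2 * t + 1) ^ 2 + w * (2 * t + 1) ^ 3 := by
        gcongr
        exact le_abs_self _

lemma left_le_of_gap_le (h : IsEulerPoint A B w g a) {δ η K : ℝ} (hδ : 0 < δ) (hη : 0 < η)
    (hA : δ ≤ A) (hB : |B| ≤ K) (hgap : η ≤ A - |B|) : g ≤ K ^ 2 / (4 * (η * δ)) := by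
  have hg := h.nonneg
  have hprod : η * δ ≤ A ^ 2 - B ^ 2 := by
    have := abs_nonneg B
    rw [← sq_abs B, sq_sub_sq, mul_comm η]
    exact mul_le_mul (by linarith) hgap hη.le (by linarith)
  have hsq : B ^ 2 ≤ K ^ 2 := sq_abs B ▸ pow_le_pow_left₀ (abs_nonneg _) hB 2
  have hle : 4 * (g * (1 + g)) * (η * δ) ≤ 4 * (g * (1 + g)) * (A ^ 2 - B ^ 2) := by gcongr
  rw [le_div_iff₀ (by positivity)]
  nlinarith [h.upper_bound, show 0 ≤ g * g * (η * δ) by positivity]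

lemma left_le_of_two_mul_abs_le (h : IsEulerPoint A B w g a) (hB : 2 * |B| ≤ A) :
    g ≤ B ^ 2 / A ^ 2 := by
  have hA := h.pos
  have hg := h.nonneg
  have hsq : 4 * B ^ 2 ≤ A ^ 2 := by
    have := pow_le_pow_left₀ (by positivity) hB 2
    rw [mul_pow, sq_abs] at this
    linarith
  have hupper : g * (1 + g) * (3 * A ^ 2) ≤ B ^ 2 := by
    nlinarith [h.upper_bound, mul_nonneg hg (by linarith : 0 ≤ 1 + g)]
  rw [le_div_iff₀ (by positivity)]
  nlinarith [show 0 ≤ g * g * A ^ 2 by positivity, show 0 ≤ g * A ^ 2 by positivity]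

lemma abs_right_le_of_two_mul_abs_le (h : IsEulerPoint A B w g a) (hB : 2 * |B| ≤ A) :
    |a| ≤ |B| / A := by
  have hA := h.pos
  have hg : g ≤ 1 / 4 := by
    refine (h.left_le_of_two_mul_abs_le hB).trans ?_
    rw [div_le_iff₀ (by positivity), ← sq_abs B]
    nlinarith [abs_nonneg B]
  rw [le_div_iff₀ hA]
  nlinarith [abs_nonneg B, h.two_mul_abs_mul_le]

end IsEulerPoint

end Scalar

/-! ### Uniform bounds on the fields -/

section FieldBounds

variable {E : Type*} [NormedAddCommGroup E] [InnerProductSpace ℝ E] [FiniteDimensional ℝ E]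
  [MeasurableSpace E] [BorelSpace E]
variable {k : E → ℝ} {M : ℝ} {L : ℝ≥0} {C r c : ℝ} {γ α f : E → ℝ}

namespace IsKernel

lemma integral_sub_left (hk : IsKernel k M L C) (p : E) : ∫ q, k (p - q) = ∫ q, k q := by
  simp only [hk.sub_comm p, integral_sub_right_eq_self k p]

lemma integrable_conv (hk : IsKernel k M L C) (hf : Integrable f) : Integrable (conv k f) :=
  (hk.integrable_sub_mul_snd hf).integral_prod_left

lemma integral_abs_conv_le (hk : IsKernel k M L C) (hf : Integrable f) :
    ∫ p, |conv k f p| ≤ (∫ p, k p) * ∫ p, |f p| :=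
  calc ∫ p, |conv k f p| ≤ ∫ p, conv k (fun q => |f q|) p := by
        refine integral_mono (hk.integrable_conv hf).abs (hk.integrable_conv hf.abs) fun p => ?_
        refine abs_integral_le_integral_of_abs_le (hk.integrable_sub_mul hf.abs p) fun q => ?_
        rw [abs_mul, abs_of_nonneg (hk.nonneg _)]
    _ = ∫ q, ∫ p, k (p - q) * |f q| := integral_integral_swap (hk.integrable_sub_mul_snd hf.abs)
    _ = (∫ p, k p) * ∫ p, |f p| := by
        simp only [integral_mul_const, integral_sub_right_eq_self k, integral_const_mul]

lemma abs_conv_right_le (hk : IsKernel k M L C) (hp : IsAdmissible γ α) (p : E) :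
    |conv k α p| ≤ M * (∫ q, γ q) + 1 / 2 * ∫ q, k q := by
  have hkp : Integrable fun q => k (p - q) := hk.integrable.comp_sub_left p
  rw [← hk.integral_sub_left p, ← integral_const_mul, ← integral_const_mul,
    ← integral_add (hp.integrable.const_mul M) (hkp.const_mul _), conv, ← Real.norm_eq_abs]
  refine norm_integral_le_of_norm_le ((hp.integrable.const_mul M).add (hkp.const_mul _)) ?_
  filter_upwards [hp.abs_le, hp.nonneg] with q hα hγ
  rw [Real.norm_eq_abs, abs_mul, abs_of_nonneg (hk.nonneg _)]
  linarith [mul_le_mul_of_nonneg_left hα (hk.nonneg (p - q)),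
    mul_le_mul_of_nonneg_right (hk.le (p - q)) hγ]

lemma abs_const_mul_add_conv_sub_le (hk : IsKernel k M L C) (hc : 0 ≤ c) (hf : Integrable f)
    (x y : E) : |(c * k x + conv k f x) - (c * k y + conv k f y)|
      ≤ L * (c + ∫ q, |f q|) * ‖x - y‖ := by
  have hkernel : |c * (k x - k y)| ≤ c * (L * ‖x - y‖) := by
    rw [abs_mul, abs_of_nonneg hc]
    exact mul_le_mul_of_nonneg_left (hk.abs_sub_le x y) hc
  have htri := abs_add_le (c * (k x - k y)) (conv k f x - conv k f y)
  rw [show (c * k x + conv k f x) - (c * k y + conv k f y)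
    = c * (k x - k y) + (conv k f x - conv k f y) by ring]
  linarith [hk.abs_conv_sub_le hf x y]

lemma abs_const_mul_add_conv_second_diff_le (hk : IsKernel k M L C) (hc : 0 ≤ c)
    (hf : Integrable f) (x h : E) :
    |(c * k (x + h) + conv k f (x + h)) + (c * k (x - h) + conv k f (x - h))
      - 2 * (c * k x + conv k f x)| ≤ C * (c + ∫ q, |f q|) * ‖h‖ ^ 2 := by
  set D := k (x + h) + k (x - h) - 2 * k x
  set D' := conv k f (x + h) + conv k f (x - h) - 2 * conv k f x
  have hkernel : |c * D| ≤ c * (C * ‖h‖ ^ 2) := by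
    rw [abs_mul, abs_of_nonneg hc]
    exact mul_le_mul_of_nonneg_left (hk.abs_second_diff_le x h) hc
  have hconv : |D'| ≤ C * ‖h‖ ^ 2 * ∫ q, |f q| := hk.abs_conv_second_diff_le hf x h
  rw [show (c * k (x + h) + conv k f (x + h)) + (c * k (x - h) + conv k f (x - h))
    - 2 * (c * k x + conv k f x) = c * D + D' by ring]
  linarith [abs_add_le (c * D) D']

end IsKernel

namespace IsAdmissible

lemma abs_fieldA_sub_norm_sq_le (hp : IsAdmissible γ α) (hk : IsKernel k M L C)
    (hmass : ∫ p, γ p ≤ r) (p : E) :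
    |fieldA k r γ α p - ‖p‖ ^ 2| ≤ 3 * M * r + 1 / 2 * ∫ q, k q := by
  have hcoupling := hk.abs_coupling_le hp hmass
  have hcond := mul_le_mul_of_nonneg_left (hk.le p) (sub_nonneg.mpr hmass)
  have hconv := (le_abs_self _).trans (hk.abs_conv_le hp.integrable p)
  rw [hp.integral_abs_left] at hconv
  have hcond0 := mul_nonneg (sub_nonneg.mpr hmass) (hk.nonneg p)
  have hconv0 := hk.conv_nonneg hp.nonneg p
  have hMr := mul_nonneg hk.bound_nonneg (hp.mass_nonneg.trans hmass)
  rw [_root_.abs_le] at hcoupling ⊢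
  unfold fieldA
  constructor <;> linarith

lemma abs_fieldA_sub_norm_sq_sub_le (hp : IsAdmissible γ α) (hk : IsKernel k M L C)
    (hmass : ∫ p, γ p ≤ r) (x y : E) :
    |(fieldA k r γ α x - ‖x‖ ^ 2) - (fieldA k r γ α y - ‖y‖ ^ 2)| ≤ L * r * ‖x - y‖ := by
  have hlip := hk.abs_const_mul_add_conv_sub_le (sub_nonneg.mpr hmass) hp.integrable x y
  rw [hp.integral_abs_left, sub_add_cancel] at hlip
  refine hlip.trans_eq' (congrArg _ ?_)
  unfold fieldA
  ring

lemma abs_fieldA_second_diff_le (hp : IsAdmissible γ α) (hk : IsKernel k M L C)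
    (hmass : ∫ p, γ p ≤ r) (x h : E) :
    |fieldA k r γ α (x + h) + fieldA k r γ α (x - h) - 2 * fieldA k r γ α x|
      ≤ (C * r + 2) * ‖h‖ ^ 2 := by
  have hsecond :=
    hk.abs_const_mul_add_conv_second_diff_le (sub_nonneg.mpr hmass) hp.integrable x h
  rw [hp.integral_abs_left, sub_add_cancel] at hsecond
  have hkin : ‖x + h‖ ^ 2 + ‖x - h‖ ^ 2 - 2 * ‖x‖ ^ 2 = 2 * ‖h‖ ^ 2 := by
    linear_combination parallelogram_law_with_norm ℝ x h
  rw [_root_.abs_le] at hsecond ⊢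
  unfold fieldA
  constructor <;> linarith [sq_nonneg ‖h‖]

lemma abs_fieldB_le (hp : IsAdmissible γ α) (hk : IsKernel k M L C) (hmass : ∫ p, γ p ≤ r)
    (p : E) : |fieldB k r γ α p| ≤ M * r + 1 / 2 * ∫ q, k q := by
  have hcond := mul_le_mul_of_nonneg_left (hk.le p) (sub_nonneg.mpr hmass)
  have htri := abs_add_le ((r - ∫ q, γ q) * k p) (conv k α p)
  rw [abs_of_nonneg (mul_nonneg (sub_nonneg.mpr hmass) (hk.nonneg p))] at htri
  unfold fieldB
  linarith [hk.abs_conv_right_le hp p]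

end IsAdmissible

lemma IsKernel.integrable_fieldB (hk : IsKernel k M L C) (hα : Integrable α) :
    Integrable (fieldB k r γ α) :=
  (hk.integrable.const_mul _).add (hk.integrable_conv hα)

lemma IsKernel.integral_abs_fieldB_le (hk : IsKernel k M L C) (hα : Integrable α)
    (hmass : ∫ p, γ p ≤ r) :
    ∫ p, |fieldB k r γ α p| ≤ (∫ p, k p) * ((r - ∫ p, γ p) + ∫ p, |α p|) := by
  have hcond : Integrable fun p => (r - ∫ q, γ q) * k p := hk.integrable.const_mul _
  have hle : ∫ p, |fieldB k r γ α p| ≤ ∫ p, ((r - ∫ q, γ q) * k p + |conv k α p|) := by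
    refine integral_mono (hk.integrable_fieldB hα).abs (hcond.add (hk.integrable_conv hα).abs)
      fun p => (abs_add_le _ _).trans_eq ?_
    rw [abs_of_nonneg (mul_nonneg (sub_nonneg.mpr hmass) (hk.nonneg p))]
  rw [integral_add hcond (hk.integrable_conv hα).abs, integral_const_mul] at hle
  linarith [hk.integral_abs_conv_le hα]

/-- Bounds on the fields which are uniform in the regularization. -/
structure IsUniformBound (k : E → ℝ) (r K : ℝ) (γ α : E → ℝ) : Prop where
  integral_abs_right_le : ∫ p, |α p| ≤ K
  abs_fieldA_le : ∀ p, |fieldA k r γ α p - ‖p‖ ^ 2| ≤ K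
  abs_fieldB_le : ∀ p, |fieldB k r γ α p| ≤ K
  fieldA_lipschitz : ∀ x y,
    |(fieldA k r γ α x - ‖x‖ ^ 2) - (fieldA k r γ α y - ‖y‖ ^ 2)| ≤ K * ‖x - y‖
  fieldB_lipschitz : ∀ x y, |fieldB k r γ α x - fieldB k r γ α y| ≤ K * ‖x - y‖
  fieldA_second_diff_le : ∀ x h,
    |fieldA k r γ α (x + h) + fieldA k r γ α (x - h) - 2 * fieldA k r γ α x| ≤ K * ‖h‖ ^ 2
  fieldB_second_diff_le : ∀ x h,
    |fieldB k r γ α (x + h) + fieldB k r γ α (x - h) - 2 * fieldB k r γ α x| ≤ K * ‖h‖ ^ 2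

theorem IsAdmissible.isUniformBound (hp : IsAdmissible γ α) (hk : IsKernel k M L C)
    (hmass : ∫ p, γ p ≤ r) (hα : Integrable α) {Q : ℝ} (hQ : ∫ p, |α p| ≤ Q) :
    IsUniformBound k r (Q + (3 * M * r + ∫ p, k p) + L * (r + Q) + |C| * (r + Q) + 2) γ α := by
  have hr : 0 ≤ r := hp.mass_nonneg.trans hmass
  have hQ0 : 0 ≤ Q := (integral_nonneg fun _ => abs_nonneg _).trans hQ
  have hMr : 0 ≤ M * r := mul_nonneg hk.bound_nonneg hr
  have hk0 : 0 ≤ ∫ p, k p := integral_nonneg hk.nonneg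
  have hLr : 0 ≤ L * r := by positivity
  have hLQ : 0 ≤ L * Q := by positivity
  have hCr : 0 ≤ |C| * r := by positivity
  have hCQ : 0 ≤ |C| * Q := by positivity
  have hCr' : C * r ≤ |C| * r := mul_le_mul_of_nonneg_right (le_abs_self C) hr
  have htotal : (r - ∫ p, γ p) + ∫ p, |α p| ≤ r + Q := by linarith [hp.mass_nonneg]
  have htotal0 : 0 ≤ (r - ∫ p, γ p) + ∫ p, |α p| :=
    add_nonneg (sub_nonneg.mpr hmass) (integral_nonneg fun _ => abs_nonneg _)
  refine ⟨by linarith, fun p => ?_, fun p => ?_, fun x y => ?_, fun x y => ?_, fun x h => ?_,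
    fun x h => ?_⟩
  · linarith [hp.abs_fieldA_sub_norm_sq_le hk hmass p]
  · linarith [hp.abs_fieldB_le hk hmass p]
  · refine (hp.abs_fieldA_sub_norm_sq_sub_le hk hmass x y).trans ?_
    gcongr
    linarith
  · refine (hk.abs_const_mul_add_conv_sub_le (sub_nonneg.mpr hmass) hα x y).trans ?_
    gcongr
    linarith [mul_le_mul_of_nonneg_left htotal L.coe_nonneg]
  · refine (hp.abs_fieldA_second_diff_le hk hmass x h).trans ?_
    gcongr
    linarith
  · refine (hk.abs_const_mul_add_conv_second_diff_le (sub_nonneg.mpr hmass) hα x h).trans ?_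
    gcongr
    linarith [mul_le_mul_of_nonneg_left htotal (abs_nonneg C),
      mul_le_mul_of_nonneg_right (le_abs_self C) htotal0]

end FieldBounds

section UniformBound

variable {k : E3 → ℝ} {M : ℝ} {L : ℝ≥0} {C r ε δ T : ℝ} {γ α : E3 → ℝ}

namespace IsStationary

lemma le_fieldA (hs : IsStationary k r ε δ γ α) (hk : IsKernel k M L C) (p : E3) :
    ‖p‖ ^ 2 + δ ≤ fieldA k r γ α p :=
  hk.le_fieldA hs.pair.nonneg hs.pair.mass_le hs.coupling_le p

lemma ae_isEulerPoint (hs : IsStationary k r ε δ γ α) (hk : IsKernel k M L C) (hε : 0 ≤ ε)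
    (hδ : 0 < δ) : ∀ᵐ p, IsEulerPoint (fieldA k r γ α p) (fieldB k r γ α p)
      (2 * ε * weight p ^ 2) (γ p) (α p) := by
  filter_upwards [hs.pair.nonneg, hs.sq_eq, hs.euler] with p hγ hsq heuler
  exact ⟨by linarith [hs.le_fieldA hk p, sq_nonneg ‖p‖], by positivity, hγ, hsq, heuler⟩

lemma ae_abs_right_le (hs : IsStationary k r ε δ γ α) (hk : IsKernel k M L C) (hε : 0 ≤ ε)
    (hδ : 0 < δ) (hT : 0 < T) (hBT : 2 * (M * r + 1 / 2 * ∫ q, k q) ≤ T) :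
    ∀ᵐ p, |α p| ≤ γ p + (Metric.closedBall (0 : E3) √T).indicator (fun _ => 1 / 2) p
      + T⁻¹ * |fieldB k r γ α p| := by
  filter_upwards [hs.ae_isEulerPoint hk hε hδ] with p hp
  have hB0 : 0 ≤ T⁻¹ * |fieldB k r γ α p| := by positivity
  by_cases hpT : p ∈ Metric.closedBall (0 : E3) √T
  · rw [Set.indicator_of_mem hpT]
    linarith [hp.abs_right_le]
  · rw [Set.indicator_of_notMem hpT]
    rw [mem_closedBall_zero_iff, not_le] at hpT
    have hA : T ≤ fieldA k r γ α p := by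
      linarith [hs.le_fieldA hk p, Real.lt_sq_of_sqrt_lt hpT]
    have htail := hp.abs_right_le_of_two_mul_abs_le
      (by linarith [hs.pair.isPair.abs_fieldB_le hk hs.pair.mass_le p])
    have hdiv : |fieldB k r γ α p| / fieldA k r γ α p ≤ T⁻¹ * |fieldB k r γ α p| := by
      rw [div_eq_inv_mul]
      gcongr
    linarith [hp.nonneg]

lemma integral_abs_right_le (hs : IsStationary k r ε δ γ α) (hk : IsKernel k M L C)
    (hε : 0 ≤ ε) (hδ : 0 < δ) (hT : 0 < T) (hBT : 2 * (M * r + 1 / 2 * ∫ q, k q) ≤ T)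
    (hkT : 2 * ∫ q, k q ≤ T) :
    ∫ p, |α p| ≤ 2 * r + volume.real (Metric.closedBall (0 : E3) √T) := by
  have hγ := hs.pair.left.integrable
  have hα := hs.pair.right.integrable
  have hB : Integrable fun p => T⁻¹ * |fieldB k r γ α p| :=
    (hk.integrable_fieldB hα).abs.const_mul _
  have hball : Integrable ((Metric.closedBall (0 : E3) √T).indicator fun _ => (1 / 2 : ℝ)) :=
    (integrableOn_const measure_closedBall_lt_top.ne).integrable_indicator measurableSet_closedBall
  have hle := integral_mono_ae hα.abs (by exact (hγ.add hball).add hB)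
    (hs.ae_abs_right_le hk hε hδ hT hBT)
  rw [integral_add (by exact hγ.add hball) hB, integral_add hγ hball, integral_const_mul,
    integral_indicator measurableSet_closedBall, setIntegral_const, smul_eq_mul] at hle
  have hBle : T⁻¹ * ∫ p, |fieldB k r γ α p| ≤ 1 / 2 * ((r - ∫ p, γ p) + ∫ p, |α p|) := by
    have htotal : 0 ≤ (r - ∫ p, γ p) + ∫ p, |α p| :=
      add_nonneg (sub_nonneg.mpr hs.pair.mass_le) (integral_nonneg fun _ => abs_nonneg _)
    rw [inv_mul_le_iff₀ hT]
    nlinarith [hk.integral_abs_fieldB_le hα hs.pair.mass_le]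
  linarith [hs.pair.mass_le]

end IsStationary

theorem IsKernel.exists_isUniformBound (hk : IsKernel k M L C) (hr : 0 ≤ r) (hδ : 0 < δ) :
    ∃ K, 0 < K ∧ ∀ ε γ α, 0 < ε → IsStationary k r ε δ γ α → IsUniformBound k r K γ α := by
  have hMr : 0 ≤ M * r := mul_nonneg hk.bound_nonneg hr
  have hk0 : 0 ≤ ∫ q, k q := integral_nonneg hk.nonneg
  set T := 2 * (M * r + ∫ q, k q) + 1
  set Q := 2 * r + volume.real (Metric.closedBall (0 : E3) √T)
  refine ⟨Q + (3 * M * r + ∫ p, k p) + L * (r + Q) + |C| * (r + Q) + 2, ?_, fun ε γ α hε hs => ?_⟩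
  · have hQ : 0 ≤ Q := by positivity
    have hLQ : 0 ≤ L * (r + Q) := by positivity
    have hCQ : 0 ≤ |C| * (r + Q) := by positivity
    linarith
  · refine hs.pair.isPair.isUniformBound hk hs.pair.mass_le hs.pair.right.integrable
      (hs.integral_abs_right_le hk hε.le hδ ?_ ?_ ?_) <;> linarith

end UniformBound

/-! ### Convergence of minimizers -/

section Compactness

variable {X Y : Type*}

lemma uniformEquicontinuous_of_abs_sub_le [SeminormedAddCommGroup X] {ι : Type*} {K : ℝ}
    {f : ι → X → ℝ} (hf : ∀ i x y, |f i x - f i y| ≤ K * ‖x - y‖) : UniformEquicontinuous f :=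
  Metric.uniformEquicontinuous_of_continuity_modulus (fun t => K * t)
    ((continuous_const_mul K).tendsto' 0 0 (mul_zero K)) f fun x y i => by
      rw [Real.dist_eq, dist_eq_norm]
      exact hf i x y

variable [TopologicalSpace X] [PseudoMetricSpace Y] {f : ℕ → X → Y}

lemma cauchySeq_apply_of_equicontinuous (hf : Equicontinuous f) {D : Set X} (hD : Dense D)
    (hconv : ∀ x ∈ D, CauchySeq fun n => f n x) (x : X) : CauchySeq fun n => f n x := by
  refine Metric.cauchySeq_iff.mpr fun η hη => ?_
  obtain ⟨y, hclose, hy⟩ := hD.inter_nhds_nonempty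
    ((Metric.equicontinuousAt_iff_right.mp (hf x)) (η / 3) (by positivity))
  obtain ⟨N, hN⟩ := Metric.cauchySeq_iff.mp (hconv y hclose) (η / 3) (by positivity)
  refine ⟨N, fun m hm n hn => ?_⟩
  calc dist (f m x) (f n x)
      ≤ dist (f m x) (f m y) + dist (f m y) (f n y) + dist (f n y) (f n x) := dist_triangle4 ..
    _ < η / 3 + η / 3 + η / 3 := by
        rw [dist_comm (f n y)]
        exact add_lt_add (add_lt_add (hy m) (hN m hm n hn)) (hy n)
    _ = η := by ring

theorem exists_subseq_tendsto_of_equicontinuous [TopologicalSpace.SeparableSpace X] [Nonempty X]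
    (hf : Equicontinuous f) {S : Set Y} (hS : IsCompact S) (hmem : ∀ n x, f n x ∈ S) :
    ∃ φ : ℕ → ℕ, StrictMono φ ∧
      ∃ g : X → Y, ∀ x, Tendsto (fun n => f (φ n) x) atTop (𝓝 (g x)) := by
  set d := TopologicalSpace.denseSeq X
  obtain ⟨_, -, φ, hφ, hconv⟩ := (isCompact_univ_pi fun _ : ℕ => hS).tendsto_subseq
    (x := fun n j => f n (d j)) fun n j _ => hmem n (d j)
  rw [tendsto_pi_nhds] at hconv
  have hcauchy := cauchySeq_apply_of_equicontinuous (f := f ∘ φ) (hf.comp φ)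
    (TopologicalSpace.denseRange_denseSeq X) (Set.forall_mem_range.mpr fun j => (hconv j).cauchySeq)
  choose g _ hg using fun x =>
    cauchySeq_tendsto_of_isComplete hS.isComplete (fun n => hmem (φ n) x) (hcauchy x)
  exact ⟨φ, hφ, g, hg⟩

lemma tendstoUniformlyOn_of_equicontinuous (hf : Equicontinuous f) {g : X → Y}
    (hg : ∀ x, Tendsto (fun n => f n x) atTop (𝓝 (g x))) {S : Set X} (hS : IsCompact S) :
    TendstoUniformlyOn f g atTop S := by
  have hiff := EquicontinuousOn.tendsto_uniformOnFun_iff_pi' (𝔖 := {S}) (by simpa using hS)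
    (fun _ _ => hf.equicontinuousOn _) atTop g
  exact UniformOnFun.tendsto_iff_tendstoUniformlyOn.mp
    (hiff.mpr (tendsto_pi_nhds.mpr fun x => hg x)) S rfl

end Compactness

section Fatou

variable {X : Type*} [MeasurableSpace X] {μ : Measure X} {f : ℕ → X → ℝ} {g : X → ℝ} {c : ℝ}

lemma lintegral_liminf_ofReal_le (hf : ∀ n, Integrable (f n) μ) (hnonneg : ∀ n, 0 ≤ᵐ[μ] f n)
    (hle : ∃ᶠ n in atTop, ∫ x, f n x ∂μ ≤ c) :
    ∫⁻ x, liminf (fun n => ENNReal.ofReal (f n x)) atTop ∂μ ≤ ENNReal.ofReal c := by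
  refine (lintegral_liminf_le' fun n => (hf n).1.aemeasurable.ennreal_ofReal).trans ?_
  refine liminf_le_of_frequently_le' (hle.mono fun n hn => ?_)
  rw [← ofReal_integral_eq_lintegral_ofReal (hf n) (hnonneg n)]
  exact ENNReal.ofReal_le_ofReal hn

theorem integrable_and_integral_le_of_tendsto (hf : ∀ n, Integrable (f n) μ)
    (hnonneg : ∀ n, 0 ≤ᵐ[μ] f n) (hlim : ∀ᵐ x ∂μ, Tendsto (fun n => f n x) atTop (𝓝 (g x)))
    (hle : ∃ᶠ n in atTop, ∫ x, f n x ∂μ ≤ c) : Integrable g μ ∧ ∫ x, g x ∂μ ≤ c := by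
  have hg : 0 ≤ᵐ[μ] g := by
    filter_upwards [hlim, ae_all_iff.mpr hnonneg] with x hx h0 using ge_of_tendsto' hx h0
  have hlintegral : ∫⁻ x, ENNReal.ofReal (g x) ∂μ ≤ ENNReal.ofReal c := by
    refine (lintegral_congr_ae ?_).trans_le (lintegral_liminf_ofReal_le hf hnonneg hle)
    filter_upwards [hlim] with x hx
    exact ((ENNReal.continuous_ofReal.tendsto _).comp hx).liminf_eq.symm
  have hint : Integrable g μ :=
    ⟨aestronglyMeasurable_of_tendsto_ae atTop (fun n => (hf n).1) hlim,
      (hasFiniteIntegral_iff_ofReal hg).mpr (hlintegral.trans_lt ENNReal.ofReal_lt_top)⟩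
  refine ⟨hint, ?_⟩
  obtain ⟨n, hn⟩ := hle.exists
  rw [← ofReal_integral_eq_lintegral_ofReal hint hg] at hlintegral
  exact (ENNReal.ofReal_le_ofReal_iff ((integral_nonneg_of_ae (hnonneg n)).trans hn)).mp hlintegral

end Fatou

section Shell

variable {s : ℝ}

lemma not_intervalIntegrable_inv_sub (hs : 0 < s) :
    ¬ IntervalIntegrable (fun y : ℝ => (y - s)⁻¹) volume s (3 / 2 * s) := fun h =>
  (intervalIntegrable_sub_inv_iff.mp h).elim (fun heq => by linarith)
    fun hs => hs Set.left_mem_uIcc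

/-- The function `| |p| - s |⁻¹`, cut off at `|p| = 2 s`. -/
def inverseShell (s : ℝ) (p : E3) : ℝ :=
  (Set.Iio (2 * s)).indicator (fun y => |y - s|⁻¹) ‖p‖

lemma inverseShell_nonneg (p : E3) : 0 ≤ inverseShell s p :=
  Set.indicator_nonneg (fun _ _ => by positivity) _

lemma measurable_inverseShell : Measurable (inverseShell s) :=
  ((by fun_prop : Measurable fun y : ℝ => |y - s|⁻¹).indicator measurableSet_Iio).comp
    measurable_norm

theorem not_integrable_inverseShell (hs : 0 < s) : ¬ Integrable (inverseShell s) := by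
  intro hint
  have hradial := (integrable_fun_norm_addHaar (E := E3) volume).mp hint
  refine not_intervalIntegrable_inv_sub hs
    ((intervalIntegrable_iff_integrableOn_Ioc_of_le (by linarith)).mpr ?_)
  have hmeas : AEStronglyMeasurable (fun y : ℝ => (y ^ 2)⁻¹)
      (volume.restrict (Set.Ioc s (3 / 2 * s))) := by fun_prop
  refine (Integrable.bdd_mul (hradial.mono_set fun y hy => hs.trans hy.1) (c := (s ^ 2)⁻¹)
    hmeas ?_).congr ?_
  · filter_upwards [ae_restrict_mem measurableSet_Ioc] with y hy
    rw [Real.norm_of_nonneg (by positivity)]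
    exact inv_anti₀ (by positivity) (pow_le_pow_left₀ hs.le hy.1.le 2)
  · filter_upwards [ae_restrict_mem measurableSet_Ioc] with y hy
    have hy0 : y ≠ 0 := (hs.trans hy.1).ne'
    have hmem : y ∈ Set.Iio (2 * s) := hy.2.trans_lt (by linarith)
    rw [Set.indicator_of_mem hmem, abs_of_pos (sub_pos.mpr hy.1), smul_eq_mul]
    simp only [finrank_euclideanSpace, Fintype.card_fin]
    field_simp

variable {γ : ℕ → E3 → ℝ} {r c : ℝ}

lemma ofReal_inverseShell_le_liminf (hc : 0 < c) {p : E3}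
    (hlow : ∀ t, 0 ≤ t → (2 * t + 1) * |‖p‖ - s| < c → ∀ᶠ n in atTop, t ≤ γ n p) :
    ENNReal.ofReal (c / 4 * inverseShell s p) ≤
      liminf (fun n => ENNReal.ofReal (γ n p)) atTop
        + (Metric.ball (0 : E3) (2 * s)).indicator (fun _ => 1) p := by
  by_cases hp : p ∈ Metric.ball (0 : E3) (2 * s)
  · have hshell : inverseShell s p = |‖p‖ - s|⁻¹ :=
      Set.indicator_of_mem (s := Set.Iio (2 * s)) (mem_ball_zero_iff.mp hp) _
    rw [Set.indicator_of_mem hp, hshell]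
    set x := c / 4 * |‖p‖ - s|⁻¹ with hx
    rcases le_or_gt x 1 with hx1 | hx1
    · exact le_add_left (ENNReal.ofReal_le_one.mpr hx1)
    · have hdist : |‖p‖ - s| ≠ 0 := by
        rintro h0
        rw [hx, h0, inv_zero, mul_zero] at hx1
        linarith
      have hthreshold : (2 * (x - 1) + 1) * |‖p‖ - s| < c := by
        have hxdist : x * |‖p‖ - s| = c / 4 := by rw [hx]; field_simp
        nlinarith [abs_nonneg (‖p‖ - s)]
      calc ENNReal.ofReal x = ENNReal.ofReal (x - 1) + 1 := by
            rw [← ENNReal.ofReal_one, ← ENNReal.ofReal_add (by linarith) zero_le_one,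
              sub_add_cancel]
        _ ≤ liminf (fun n => ENNReal.ofReal (γ n p)) atTop + 1 := by
            gcongr
            exact le_liminf_of_le (by isBoundedDefault)
              ((hlow _ (by linarith) hthreshold).mono fun n => ENNReal.ofReal_le_ofReal)
  · have hshell : inverseShell s p = 0 :=
      Set.indicator_of_notMem (s := Set.Iio (2 * s)) (fun h => hp (mem_ball_zero_iff.mpr h)) _
    rw [hshell, mul_zero, ENNReal.ofReal_zero]
    exact zero_le

theorem false_of_inverseShell_bound (hc : 0 < c) (hs : 0 < s) (hint : ∀ n, Integrable (γ n))
    (hnonneg : ∀ n, 0 ≤ᵐ[volume] γ n) (hmass : ∀ n, ∫ p, γ n p ≤ r)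
    (hlow : ∀ᵐ p : E3, ∀ t, 0 ≤ t → (2 * t + 1) * |‖p‖ - s| < c → ∀ᶠ n in atTop, t ≤ γ n p) :
    False := by
  refine not_integrable_inverseShell hs
    ((integrable_const_mul_iff (IsUnit.mk0 (c / 4) (by positivity)) _).mp
      ⟨(measurable_inverseShell.const_mul _).aestronglyMeasurable, ?_⟩)
  rw [hasFiniteIntegral_iff_ofReal (Eventually.of_forall fun p =>
    mul_nonneg (by positivity) (inverseShell_nonneg p))]
  refine (lintegral_mono_ae (hlow.mono fun p => ofReal_inverseShell_le_liminf hc)).trans_lt ?_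
  rw [lintegral_add_right _ (measurable_const.indicator measurableSet_ball),
    lintegral_indicator measurableSet_ball, setLIntegral_one]
  exact ENNReal.add_lt_top.mpr ⟨(lintegral_liminf_ofReal_le hint hnonneg
    (.of_forall hmass)).trans_lt ENNReal.ofReal_lt_top, measure_ball_lt_top⟩

end Shell

section EulerLimit

variable {A B w g a : ℕ → ℝ} {A₀ B₀ : ℝ}

lemma sq_sub_sq_pos_of_abs_lt (hlt : |B₀| < A₀) : 0 < A₀ ^ 2 - B₀ ^ 2 :=
  sub_pos.mpr (sq_lt_sq.mpr (hlt.trans_le (le_abs_self A₀)))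

lemma eventually_left_le_of_tendsto (hE : ∀ n, IsEulerPoint (A n) (B n) (w n) (g n) (a n))
    (hA : Tendsto A atTop (𝓝 A₀)) (hB : Tendsto B atTop (𝓝 B₀)) (hlt : |B₀| < A₀) :
    ∀ᶠ n in atTop, g n ≤ B₀ ^ 2 / (A₀ ^ 2 - B₀ ^ 2) + 1 := by
  have hD := sq_sub_sq_pos_of_abs_lt hlt
  have hgap : Tendsto (fun n => A n ^ 2 - B n ^ 2) atTop (𝓝 (A₀ ^ 2 - B₀ ^ 2)) :=
    (hA.pow 2).sub (hB.pow 2)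
  filter_upwards [((hB.pow 2).div hgap hD.ne').eventually_lt_const (lt_add_one _),
    hgap.eventually_const_lt hD] with n hn hpos
  have hupper := (hE n).upper_bound
  have hg := (hE n).nonneg
  have hle : g n ≤ B n ^ 2 / (A n ^ 2 - B n ^ 2) := by
    rw [le_div_iff₀ hpos]
    nlinarith [mul_nonneg hg hpos.le, mul_nonneg (mul_nonneg hg hg) hpos.le]
  exact hle.trans hn.le

lemma tendsto_euler_denominator (hE : ∀ n, IsEulerPoint (A n) (B n) (w n) (g n) (a n))
    (hA : Tendsto A atTop (𝓝 A₀)) (hB : Tendsto B atTop (𝓝 B₀)) (hw : Tendsto w atTop (𝓝 0))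
    (hlt : |B₀| < A₀) :
    Tendsto (fun n => 2 * A n + w n * (4 * g n + 1)) atTop (𝓝 (2 * A₀)) := by
  set G := B₀ ^ 2 / (A₀ ^ 2 - B₀ ^ 2) + 1
  have hweight : Tendsto (fun n => w n * (4 * g n + 1)) atTop (𝓝 0) := by
    refine squeeze_zero' (g := fun n => w n * (4 * G + 1)) (Eventually.of_forall fun n => ?_) ?_
      (by simpa using hw.mul_const (4 * G + 1))
    · have := (hE n).weight_nonneg
      have := (hE n).nonneg
      positivity
    · filter_upwards [eventually_left_le_of_tendsto hE hA hB hlt] with n hn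
      exact mul_le_mul_of_nonneg_left (by linarith) (hE n).weight_nonneg
  simpa using (hA.const_mul 2).add hweight

theorem exists_tendsto_of_isEulerPoint (hE : ∀ n, IsEulerPoint (A n) (B n) (w n) (g n) (a n))
    (hA : Tendsto A atTop (𝓝 A₀)) (hB : Tendsto B atTop (𝓝 B₀)) (hw : Tendsto w atTop (𝓝 0))
    (hlt : |B₀| < A₀) :
    ∃ g₀ a₀, Tendsto g atTop (𝓝 g₀) ∧ Tendsto a atTop (𝓝 a₀) := by
  have hA₀ : 0 < A₀ := (abs_nonneg _).trans_lt hlt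
  have hden := tendsto_euler_denominator hE hA hB hw hlt
  have hq : Tendsto (fun n => (2 * A n + w n * (4 * g n + 1)) ^ 2 - 4 * B n ^ 2) atTop
      (𝓝 ((2 * A₀) ^ 2 - 4 * B₀ ^ 2)) := (hden.pow 2).sub ((hB.pow 2).const_mul 4)
  have hq0 : 0 < (2 * A₀) ^ 2 - 4 * B₀ ^ 2 := by linarith [sq_sub_sq_pos_of_abs_lt hlt]
  have hprod := ((hB.pow 2).div hq hq0.ne').congr' <| by
    filter_upwards [hq.eventually_const_lt hq0] with n hn
    change B n ^ 2 / _ = g n * (1 + g n)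
    rw [div_eq_iff hn.ne']
    have hsq := congrArg (· ^ 2) (hE n).abs_identity
    simp only [mul_pow, sq_abs, (hE n).sq_eq] at hsq
    linarith
  have hg := ((hprod.add_const (1 / 4)).sqrt.sub_const (1 / 2)).congr fun n => by
    rw [show g n * (1 + g n) + 1 / 4 = (g n + 1 / 2) ^ 2 by ring,
      Real.sqrt_sq (by linarith [(hE n).nonneg]), add_sub_cancel_right]
  refine ⟨_, _, hg, ((hB.mul ((hg.const_mul 2).add_const 1)).neg.div hden
    (by positivity)).congr fun n => ?_⟩
  have hpos : 0 < 2 * A n + w n * (4 * g n + 1) := by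
    have := (hE n).pos
    have := (hE n).weight_nonneg
    have := (hE n).nonneg
    positivity
  change -(B n * (2 * g n + 1)) / _ = a n
  rw [div_eq_iff hpos.ne']
  linear_combination (-1 : ℝ) * (hE n).euler

end EulerLimit

theorem exists_subseq_ae_tendsto_zero {X : Type*} [MeasurableSpace X] {μ : Measure X}
    {f : ℕ → X → ℝ} (hf : ∀ n, Integrable (f n) μ)
    (hlim : Tendsto (fun n => ∫ x, |f n x| ∂μ) atTop (𝓝 0)) :
    ∃ φ : ℕ → ℕ, StrictMono φ ∧ ∀ᵐ x ∂μ, Tendsto (fun n => f (φ n) x) atTop (𝓝 0) := by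
  have hnorm : Tendsto (fun n => eLpNorm (f n - 0) 1 μ) atTop (𝓝 0) := by
    simp_rw [sub_zero, eLpNorm_one_eq_lintegral_enorm,
      ← ofReal_integral_norm_eq_lintegral_enorm (hf _), Real.norm_eq_abs]
    exact (ENNReal.continuous_ofReal.tendsto' 0 0 ENNReal.ofReal_zero).comp hlim
  exact (tendstoInMeasure_of_tendsto_eLpNorm one_ne_zero (fun n => (hf n).1)
    aestronglyMeasurable_zero hnorm).exists_seq_tendsto_ae

theorem le_mul_sq_of_radial_of_second_diff_le {E : Type*} [NormedAddCommGroup E]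
    [NormedSpace ℝ E] {F : E → ℝ} {K : ℝ} (hnonneg : ∀ x, 0 ≤ F x)
    (hradial : ∀ x y, ‖x‖ = ‖y‖ → F x = F y) {q : E} (hq : q ≠ 0) (hFq : F q = 0)
    (hsecond : ∀ z, F (q + z) + F (q - z) - 2 * F q ≤ K * ‖z‖ ^ 2) (p : E) :
    F p ≤ K * (‖p‖ - ‖q‖) ^ 2 := by
  have : 0 < ‖q‖ := norm_pos_iff.mpr hq
  set z : E := (‖p‖ / ‖q‖ - 1) • q with hz
  have hnorm_add : ‖q + z‖ = ‖p‖ := by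
    rw [hz, sub_smul, one_smul, add_sub_cancel, norm_smul, Real.norm_of_nonneg (by positivity)]
    field_simp
  have hnorm : ‖z‖ ^ 2 = (‖p‖ - ‖q‖) ^ 2 := by
    rw [hz, norm_smul, mul_pow, Real.norm_eq_abs, sq_abs]
    field_simp
  rw [hradial p (q + z) hnorm_add.symm, ← hnorm]
  linarith [hsecond z, hnonneg (q - z)]

section Limit

variable {k : E3 → ℝ} {M : ℝ} {L : ℝ≥0} {C r δ K s : ℝ}

namespace IsStationary

variable {ε : ℝ} {γ α : E3 → ℝ}

lemma radial_fieldA (hs : IsStationary k r ε δ γ α) (hk : IsKernel k M L C) {x y : E3}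
    (hxy : ‖x‖ = ‖y‖) : fieldA k r γ α x = fieldA k r γ α y := by
  unfold fieldA
  rw [hxy, hk.radial x y hxy, hk.radial_conv hs.inv_left hxy]

lemma radial_fieldB (hs : IsStationary k r ε δ γ α) (hk : IsKernel k M L C) {x y : E3}
    (hxy : ‖x‖ = ‖y‖) : fieldB k r γ α x = fieldB k r γ α y := by
  unfold fieldB
  rw [hk.radial x y hxy, hk.radial_conv hs.inv_right hxy]

lemma left_le_tail (hs : IsStationary k r ε δ γ α) (hk : IsKernel k M L C) (hε : 0 ≤ ε)
    (hδ : 0 < δ) (hb : IsUniformBound k r K γ α) :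
    ∀ᵐ p, √(2 * K) + 1 < ‖p‖ → γ p ≤ 4 * K ^ 2 * ((1 + ‖p‖ ^ 2)⁻¹) ^ 2 := by
  filter_upwards [hs.ae_isEulerPoint hk hε hδ] with p hE hp
  have hB := hb.abs_fieldB_le p
  have hA := hs.le_fieldA hk p
  have hp1 : 1 ≤ ‖p‖ := by linarith [Real.sqrt_nonneg (2 * K)]
  have hpK : 2 * K ≤ ‖p‖ ^ 2 := by
    rw [← Real.sqrt_le_left (norm_nonneg p)]
    linarith
  calc γ p ≤ fieldB k r γ α p ^ 2 / fieldA k r γ α p ^ 2 :=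
        hE.left_le_of_two_mul_abs_le (by linarith)
    _ ≤ K ^ 2 / ((1 + ‖p‖ ^ 2) / 2) ^ 2 := by
        have hBsq : fieldB k r γ α p ^ 2 ≤ K ^ 2 := by
          rw [← sq_abs]
          gcongr
        gcongr
        nlinarith
    _ = 4 * K ^ 2 * ((1 + ‖p‖ ^ 2)⁻¹) ^ 2 := by field_simp; norm_num

end IsStationary

/-- A sequence of stationary points with vanishing regularization, along which the fields converge
pointwise to `A` and `B`. -/
structure FieldsConverge (k : E3 → ℝ) (r δ K : ℝ) (ε : ℕ → ℝ) (γ α : ℕ → E3 → ℝ)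
    (A B : E3 → ℝ) : Prop where
  eps_pos : ∀ n, 0 < ε n
  tendsto_eps : Tendsto ε atTop (𝓝 0)
  stationary : ∀ n, IsStationary k r (ε n) δ (γ n) (α n)
  bound : ∀ n, IsUniformBound k r K (γ n) (α n)
  tendsto_fieldA : ∀ p, Tendsto (fun n => fieldA k r (γ n) (α n) p) atTop (𝓝 (A p))
  tendsto_fieldB : ∀ p, Tendsto (fun n => fieldB k r (γ n) (α n) p) atTop (𝓝 (B p))
  tendsto_eps_mul : ∀ᵐ p, Tendsto (fun n => ε n * γ n p) atTop (𝓝 0)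

variable {ε : ℕ → ℝ} {γ α : ℕ → E3 → ℝ} {A B : E3 → ℝ}

theorem IsKernel.exists_fieldsConverge (hk : IsKernel k M L C) (hr : 0 ≤ r) (hδ : 0 < δ)
    (hε : ∀ n, 0 < ε n) (hε0 : Tendsto ε atTop (𝓝 0))
    (hs : ∀ n, IsStationary k r (ε n) δ (γ n) (α n)) :
    ∃ K, 0 < K ∧ ∃ φ : ℕ → ℕ, StrictMono φ ∧ ∃ A B : E3 → ℝ,
      FieldsConverge k r δ K (fun n => ε (φ n)) (fun n => γ (φ n)) (fun n => α (φ n)) A B := by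
  obtain ⟨K, hK, hbound⟩ := hk.exists_isUniformBound hr hδ
  have hb : ∀ n, IsUniformBound k r K (γ n) (α n) := fun n => hbound _ _ _ (hε n) (hs n)
  obtain ⟨φ, hφ, A, hA⟩ := exists_subseq_tendsto_of_equicontinuous
    (uniformEquicontinuous_of_abs_sub_le fun n => (hb n).fieldA_lipschitz).equicontinuous
    (isCompact_Icc (a := -K) (b := K)) fun n p => _root_.abs_le.mp ((hb n).abs_fieldA_le p)
  obtain ⟨ψ, hψ, B, hB⟩ := exists_subseq_tendsto_of_equicontinuous
    (uniformEquicontinuous_of_abs_sub_le fun n => (hb (φ n)).fieldB_lipschitz).equicontinuous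
    (isCompact_Icc (a := -K) (b := K)) fun n p => _root_.abs_le.mp ((hb (φ n)).abs_fieldB_le p)
  have hmass : Tendsto (fun n => ∫ p, |ε (φ (ψ n)) * γ (φ (ψ n)) p|) atTop (𝓝 0) := by
    refine squeeze_zero (g := fun n => ε (φ (ψ n)) * r)
      (fun n => integral_nonneg fun p => abs_nonneg _) (fun n => ?_)
      (by simpa using (hε0.comp (hφ.comp hψ).tendsto_atTop).mul_const r)
    simp_rw [abs_mul, abs_of_pos (hε _)]
    rw [integral_const_mul, (hs _).pair.isPair.integral_abs_left]
    exact mul_le_mul_of_nonneg_left (hs _).pair.mass_le (hε _).le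
  obtain ⟨χ, hχ, hzero⟩ := exists_subseq_ae_tendsto_zero
    (fun n => (hs (φ (ψ n))).pair.left.integrable.const_mul (ε (φ (ψ n)))) hmass
  have hψχ := (hψ.comp hχ).tendsto_atTop
  refine ⟨K, hK, fun n => φ (ψ (χ n)), hφ.comp (hψ.comp hχ), fun p => A p + ‖p‖ ^ 2, B,
    fun n => hε _, hε0.comp (hφ.tendsto_atTop.comp hψχ), fun n => hs _, fun n => hb _,
    fun p => ?_, fun p => (hB p).comp hχ.tendsto_atTop, hzero⟩
  exact (((hA p).comp hψχ).add_const (‖p‖ ^ 2)).congr fun n => sub_add_cancel _ _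

namespace FieldsConverge

lemma ae_isEulerPoint (h : FieldsConverge k r δ K ε γ α A B) (hk : IsKernel k M L C)
    (hδ : 0 < δ) : ∀ᵐ p, ∀ n, IsEulerPoint (fieldA k r (γ n) (α n) p)
      (fieldB k r (γ n) (α n) p) (2 * ε n * weight p ^ 2) (γ n p) (α n p) :=
  ae_all_iff.mpr fun n => (h.stationary n).ae_isEulerPoint hk (h.eps_pos n).le hδ

lemma tendsto_weight (h : FieldsConverge k r δ K ε γ α A B) (p : E3) :
    Tendsto (fun n => 2 * ε n * weight p ^ 2) atTop (𝓝 0) := by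
  simpa using (h.tendsto_eps.const_mul 2).mul_const (weight p ^ 2)

lemma tendsto_fieldA_sub (h : FieldsConverge k r δ K ε γ α A B) (p : E3) :
    Tendsto (fun n => fieldA k r (γ n) (α n) p - ‖p‖ ^ 2) atTop (𝓝 (A p - ‖p‖ ^ 2)) :=
  (h.tendsto_fieldA p).sub_const _

lemma equicontinuous_fieldA (h : FieldsConverge k r δ K ε γ α A B) :
    Equicontinuous fun n p => fieldA k r (γ n) (α n) p - ‖p‖ ^ 2 :=
  (uniformEquicontinuous_of_abs_sub_le fun n => (h.bound n).fieldA_lipschitz).equicontinuous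

lemma equicontinuous_fieldB (h : FieldsConverge k r δ K ε γ α A B) :
    Equicontinuous fun n => fieldB k r (γ n) (α n) :=
  (uniformEquicontinuous_of_abs_sub_le fun n => (h.bound n).fieldB_lipschitz).equicontinuous

lemma continuous_left (h : FieldsConverge k r δ K ε γ α A B) : Continuous A := by
  have hsub : Continuous fun p => A p - ‖p‖ ^ 2 :=
    (tendsto_pi_nhds.mpr h.tendsto_fieldA_sub).continuous_of_equicontinuous
      h.equicontinuous_fieldA
  exact (hsub.add (continuous_norm.pow 2)).congr fun p => sub_add_cancel _ _

lemma continuous_right (h : FieldsConverge k r δ K ε γ α A B) : Continuous B :=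
  (tendsto_pi_nhds.mpr h.tendsto_fieldB).continuous_of_equicontinuous h.equicontinuous_fieldB

lemma radial_left (h : FieldsConverge k r δ K ε γ α A B) (hk : IsKernel k M L C) {x y : E3}
    (hxy : ‖x‖ = ‖y‖) : A x = A y :=
  tendsto_nhds_unique (h.tendsto_fieldA x)
    ((h.tendsto_fieldA y).congr fun n => (h.stationary n).radial_fieldA hk hxy.symm)

lemma radial_right (h : FieldsConverge k r δ K ε γ α A B) (hk : IsKernel k M L C) {x y : E3}
    (hxy : ‖x‖ = ‖y‖) : B x = B y :=
  tendsto_nhds_unique (h.tendsto_fieldB x)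
    ((h.tendsto_fieldB y).congr fun n => (h.stationary n).radial_fieldB hk hxy.symm)

lemma abs_le (h : FieldsConverge k r δ K ε γ α A B) (hk : IsKernel k M L C) (hδ : 0 < δ)
    (p : E3) : |B p| ≤ A p := by
  have hae : ∀ᵐ p, |B p| ≤ A p := by
    filter_upwards [h.tendsto_eps_mul, h.ae_isEulerPoint hk hδ] with p hzero hE
    have hlim : Tendsto (fun n => fieldA k r (γ n) (α n) p
        + (4 * weight p ^ 2 * (ε n * γ n p) + 2 * ε n * weight p ^ 2)) atTop (𝓝 (A p)) := by
      simpa using (h.tendsto_fieldA p).add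
        ((hzero.const_mul (4 * weight p ^ 2)).add (h.tendsto_weight p))
    refine le_of_tendsto_of_tendsto' (h.tendsto_fieldB p).abs hlim fun n => ?_
    linarith [(hE n).abs_field_le]
  have hclosed : IsClosed {p | |B p| ≤ A p} := isClosed_le h.continuous_right.abs h.continuous_left
  have hp : p ∈ closure {p | |B p| ≤ A p} := Measure.dense_of_ae hae p
  rwa [hclosed.closure_eq] at hp

lemma gap_le (h : FieldsConverge k r δ K ε γ α A B) (hk : IsKernel k M L C) (hδ : 0 < δ)
    {q : E3} (hq : q ≠ 0) (hgap : A q = |B q|) (p : E3) :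
    A p - |B p| ≤ 2 * K * (‖p‖ - ‖q‖) ^ 2 := by
  obtain ⟨σ, hσ, hσB⟩ : ∃ σ : ℝ, |σ| = 1 ∧ σ * B q = |B q| := by
    rcases le_total 0 (B q) with hB | hB
    · exact ⟨1, by simp, by rw [abs_of_nonneg hB, one_mul]⟩
    · exact ⟨-1, by simp, by rw [abs_of_nonpos hB, neg_one_mul]⟩
  have hle : ∀ x, A x - |B x| ≤ A x - σ * B x := fun x => by
    have := le_abs_self (σ * B x)
    rw [abs_mul, hσ, one_mul] at this
    linarith
  refine (hle p).trans (le_mul_sq_of_radial_of_second_diff_le (F := fun x => A x - σ * B x)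
    (fun x => (sub_nonneg.mpr (h.abs_le hk hδ x)).trans (hle x))
    (fun x y hxy => by rw [h.radial_left hk hxy, h.radial_right hk hxy]) hq
    (by linarith) (fun z => ?_) p)
  have hA : |A (q + z) + A (q - z) - 2 * A q| ≤ K * ‖z‖ ^ 2 :=
    le_of_tendsto' (((h.tendsto_fieldA _).add (h.tendsto_fieldA _)).sub
      ((h.tendsto_fieldA _).const_mul 2)).abs fun n => (h.bound n).fieldA_second_diff_le q z
  have hB : |B (q + z) + B (q - z) - 2 * B q| ≤ K * ‖z‖ ^ 2 :=
    le_of_tendsto' (((h.tendsto_fieldB _).add (h.tendsto_fieldB _)).sub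
      ((h.tendsto_fieldB _).const_mul 2)).abs fun n => (h.bound n).fieldB_second_diff_le q z
  have hσsecond : |σ * (B (q + z) + B (q - z) - 2 * B q)| ≤ K * ‖z‖ ^ 2 := by
    rwa [abs_mul, hσ, one_mul]
  linarith [(le_abs_self _).trans hA, (neg_le_abs _).trans hσsecond]

lemma half_le_gap_mul_of_frequently (h : FieldsConverge k r δ K ε γ α A B)
    (hk : IsKernel k M L C) (hδ : 0 < δ) :
    ∀ᵐ p, ∀ t, (∃ᶠ n in atTop, γ n p < t) → δ / 2 ≤ (A p - |B p|) * (2 * t + 1) ^ 2 := by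
  filter_upwards [h.ae_isEulerPoint hk hδ] with p hE t hfreq
  have hlim := (((h.tendsto_fieldA p).sub (h.tendsto_fieldB p).abs).abs.mul_const
    ((2 * t + 1) ^ 2)).add ((h.tendsto_weight p).mul_const ((2 * t + 1) ^ 3))
  rw [abs_of_nonneg (sub_nonneg.mpr (h.abs_le hk hδ p)), zero_mul, add_zero] at hlim
  refine ge_of_tendsto_of_frequently hlim (hfreq.mono fun n hn => ?_)
  exact (hE n).half_le_of_left_le
    (by linarith [(h.stationary n).le_fieldA hk p, sq_nonneg ‖p‖]) hn.le

/- If the gap `A - |B|` vanishes at `q`, then by radial symmetry it is quadratically small around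
the whole sphere through `q`, so `γ n` grows at least like the inverse distance to that sphere. -/
theorem abs_lt (h : FieldsConverge k r δ K ε γ α A B) (hk : IsKernel k M L C) (hδ : 0 < δ)
    (hK : 0 < K) {q : E3} (hq : q ≠ 0) : |B q| < A q := by
  refine lt_of_le_of_ne (h.abs_le hk hδ q) fun hgap => ?_
  refine false_of_inverseShell_bound (c := √(δ / (4 * K))) (by positivity) (norm_pos_iff.mpr hq)
    (fun n => (h.stationary n).pair.left.integrable) (fun n => (h.stationary n).pair.nonneg)
    (fun n => (h.stationary n).pair.mass_le) ?_
  filter_upwards [h.half_le_gap_mul_of_frequently hk hδ] with p hp t ht htc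
  by_contra hcon
  have hhalf := hp t (by simpa only [not_eventually, not_le] using hcon)
  have hquad := mul_le_mul_of_nonneg_right (h.gap_le hk hδ hq hgap.symm p)
    (sq_nonneg (2 * t + 1))
  have hdist : δ / (4 * K) ≤ ((2 * t + 1) * |‖p‖ - ‖q‖|) ^ 2 := by
    rw [mul_pow, sq_abs, div_le_iff₀ (by positivity)]
    linarith
  exact htc.not_ge (Real.sqrt_le_iff.mpr ⟨by positivity, hdist⟩)

theorem exists_limit (h : FieldsConverge k r δ K ε γ α A B) (hk : IsKernel k M L C)
    (hδ : 0 < δ) (hK : 0 < K) :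
    ∃ g a : E3 → ℝ, (∀ᵐ p, Tendsto (fun n => γ n p) atTop (𝓝 (g p))) ∧
      ∀ᵐ p, Tendsto (fun n => α n p) atTop (𝓝 (a p)) := by
  have hne : ∀ᵐ p : E3, p ≠ 0 := by simp [ae_iff]
  have hex : ∀ᵐ p, ∃ g a : ℝ, Tendsto (fun n => γ n p) atTop (𝓝 g) ∧
      Tendsto (fun n => α n p) atTop (𝓝 a) := by
    filter_upwards [hne, h.ae_isEulerPoint hk hδ] with p hp hE
    exact exists_tendsto_of_isEulerPoint hE (h.tendsto_fieldA p) (h.tendsto_fieldB p)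
      (h.tendsto_weight p) (h.abs_lt hk hδ hK hp)
  refine ⟨fun p => limUnder atTop fun n => γ n p, fun p => limUnder atTop fun n => α n p, ?_, ?_⟩
  · filter_upwards [hex] with p ⟨g, _, hg, _⟩ using tendsto_nhds_limUnder ⟨g, hg⟩
  · filter_upwards [hex] with p ⟨_, a, _, ha⟩ using tendsto_nhds_limUnder ⟨a, ha⟩

lemma exists_pos_le_gap (h : FieldsConverge k r δ K ε γ α A B) (hk : IsKernel k M L C)
    (hδ : 0 < δ) (hK : 0 < K) {S : Set E3} (hS : IsCompact S) (hS0 : 0 ∉ S) :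
    ∃ η > 0, ∀ p ∈ S, η ≤ A p - |B p| := by
  rcases S.eq_empty_or_nonempty with rfl | hne
  · exact ⟨1, one_pos, by simp⟩
  · obtain ⟨q, hq, hmin⟩ := hS.exists_isMinOn hne
      (h.continuous_left.sub h.continuous_right.abs).continuousOn
    exact ⟨A q - |B q|, sub_pos.mpr (h.abs_lt hk hδ hK (ne_of_mem_of_not_mem hq hS0)),
      fun p hp => hmin hp⟩

lemma exists_pos_eventually_le_gap (h : FieldsConverge k r δ K ε γ α A B)
    (hk : IsKernel k M L C) (hδ : 0 < δ) (hK : 0 < K) {S : Set E3} (hS : IsCompact S)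
    (hS0 : 0 ∉ S) : ∃ η > 0, ∀ᶠ n in atTop, ∀ p ∈ S,
      η ≤ fieldA k r (γ n) (α n) p - |fieldB k r (γ n) (α n) p| := by
  obtain ⟨η, hη, hgap⟩ := h.exists_pos_le_gap hk hδ hK hS hS0
  have hA := Metric.tendstoUniformlyOn_iff.mp (tendstoUniformlyOn_of_equicontinuous
    h.equicontinuous_fieldA h.tendsto_fieldA_sub hS) (η / 4) (by positivity)
  have hB := Metric.tendstoUniformlyOn_iff.mp (tendstoUniformlyOn_of_equicontinuous
    h.equicontinuous_fieldB h.tendsto_fieldB hS) (η / 4) (by positivity)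
  refine ⟨η / 2, by positivity, ?_⟩
  filter_upwards [hA, hB] with n hAn hBn p hp
  have hAp := hAn p hp
  have hBp := (abs_abs_sub_abs_le_abs_sub _ _).trans_lt (hBn p hp)
  rw [Real.dist_eq] at hAp
  rw [_root_.abs_lt] at hAp hBp
  linarith [hgap p hp]

theorem exists_majorant (h : FieldsConverge k r δ K ε γ α A B) (hk : IsKernel k M L C)
    (hδ : 0 < δ) (hK : 0 < K) (hs : 0 < s) :
    ∃ f : E3 → ℝ, Integrable f ∧ ∀ᶠ n in atTop, ∀ᵐ p, s ≤ ‖p‖ → γ n p ≤ f p := by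
  set R := √(2 * K) + 1
  have hcompact : IsCompact (Metric.closedBall (0 : E3) R ∩ {p | s ≤ ‖p‖}) :=
    (isCompact_closedBall (0 : E3) R).inter_right (isClosed_le continuous_const continuous_norm)
  obtain ⟨η, hη, hgap⟩ := h.exists_pos_eventually_le_gap hk hδ hK hcompact
    fun hmem => hs.not_ge (by simpa using hmem.2)
  set f₁ : E3 → ℝ := (Metric.closedBall 0 R).indicator fun _ => K ^ 2 / (4 * (η * δ))
  set f₂ : E3 → ℝ := fun p => 4 * K ^ 2 * ((1 + ‖p‖ ^ 2)⁻¹) ^ 2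
  have hf₁ : Integrable f₁ := (integrableOn_const measure_closedBall_lt_top.ne).integrable_indicator
    measurableSet_closedBall
  have hf₂ : Integrable f₂ := memLp_inv_one_add_norm_sq.integrable_sq.const_mul _
  have hf₁0 : ∀ p, 0 ≤ f₁ p := Set.indicator_nonneg fun _ _ => by positivity
  have hf₂0 : ∀ p, 0 ≤ f₂ p := fun p => by positivity
  refine ⟨f₁ + f₂, hf₁.add hf₂, ?_⟩
  filter_upwards [hgap] with n hn
  filter_upwards [(h.stationary n).left_le_tail hk (h.eps_pos n).le hδ (h.bound n),
    h.ae_isEulerPoint hk hδ] with p htail hE hp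
  by_cases hpR : p ∈ Metric.closedBall (0 : E3) R
  · refine le_add_of_le_of_nonneg ?_ (hf₂0 p)
    have hf₁p : f₁ p = K ^ 2 / (4 * (η * δ)) := Set.indicator_of_mem hpR _
    rw [hf₁p]
    exact (hE n).left_le_of_gap_le hδ hη
      (by linarith [(h.stationary n).le_fieldA hk p, sq_nonneg ‖p‖])
      ((h.bound n).abs_fieldB_le p) (hn p ⟨hpR, hp⟩)
  · rw [mem_closedBall_zero_iff, not_le] at hpR
    exact le_add_of_nonneg_of_le (hf₁0 p) (htail hpR)

end FieldsConverge

end Limit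

/-! ### Condensation at zero momentum -/

section Condensation

variable {E : Type*} [NormedAddCommGroup E] [InnerProductSpace ℝ E] [FiniteDimensional ℝ E]
  [MeasurableSpace E] [BorelSpace E]
variable {k : E → ℝ} {M : ℝ} {L : ℝ≥0} {C r K s I : ℝ} {γ α f g a h : E → ℝ} {γn αn : ℕ → E → ℝ}

namespace IsKernel

lemma abs_pairing_sub_le (hk : IsKernel k M L C) (hf : Integrable f) (hg : Integrable g)
    (hs : ∀ p, s ≤ ‖p‖ → f p = 0) :
    |pairing k f g - (∫ p, f p) * ∫ p, k p * g p| ≤ L * s * (∫ p, |f p|) * ∫ p, |g p| := by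
  have hconst : L * s * (∫ p, |f p|) * ∫ p, |g p| = ∫ p, |f p| * (L * s * ∫ q, |g q|) := by
    rw [integral_mul_const]
    ring
  rw [pairing, ← hk.conv_zero, ← integral_mul_const, ← integral_sub (hk.integrable_mul_conv hf hg)
    (hf.mul_const _), hconst]
  refine abs_integral_le_integral_of_abs_le (hf.abs.mul_const _) fun p => ?_
  rw [← mul_sub, abs_mul]
  rcases le_or_gt s ‖p‖ with hp | hp
  · simp [hs p hp]
  · refine mul_le_mul_of_nonneg_left ((hk.abs_conv_sub_le hg p 0).trans ?_) (abs_nonneg _)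
    rw [sub_zero]
    gcongr

lemma abs_integral_mul_sub_le (hk : IsKernel k M L C) (hf : Integrable f)
    (hs : ∀ p, s ≤ ‖p‖ → f p = 0) :
    |(∫ p, k p * f p) - k 0 * ∫ p, f p| ≤ L * s * ∫ p, |f p| := by
  rw [← integral_const_mul, ← integral_sub (hk.integrable_mul hf) (hf.const_mul _),
    ← integral_const_mul]
  refine abs_integral_le_integral_of_abs_le (hf.abs.const_mul _) fun p => ?_
  rw [← sub_mul, abs_mul]
  rcases le_or_gt s ‖p‖ with hp | hp
  · simp [hs p hp]
  · refine mul_le_mul_of_nonneg_right ((hk.abs_sub_le p 0).trans ?_) (abs_nonneg _)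
    rw [sub_zero]
    gcongr

lemma le_pairing_self (hk : IsKernel k M L C) (hf : Integrable f)
    (hs : ∀ p, s ≤ ‖p‖ → f p = 0) :
    k 0 * (∫ p, f p) ^ 2 ≤ pairing k f f + 2 * (L * s) * (∫ p, |f p|) ^ 2 := by
  have hpairing := neg_le_of_abs_le (hk.abs_pairing_sub_le hf hf hs)
  have hconst : |(∫ p, f p) * ((∫ p, k p * f p) - k 0 * ∫ p, f p)|
      ≤ (∫ p, |f p|) * (L * s * ∫ p, |f p|) := by
    rw [abs_mul]
    exact mul_le_mul abs_integral_le_integral_abs (hk.abs_integral_mul_sub_le hf hs)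
      (abs_nonneg _) (integral_nonneg fun _ => abs_nonneg _)
  linarith [neg_le_of_abs_le hconst]

lemma le_pairing_add_self (hk : IsKernel k M L C) (hf : Integrable f) (hg : Integrable g)
    (hs : ∀ p, s ≤ ‖p‖ → f p = 0) :
    k 0 * (∫ p, f p) ^ 2 + 2 * ((∫ p, f p) * ∫ p, k p * g p) + pairing k g g
      ≤ pairing k (fun p => f p + g p) (fun p => f p + g p)
        + 2 * (L * s) * (∫ p, |f p|) * ((∫ p, |f p|) + ∫ p, |g p|) := by
  have hexpand := hk.pairing_add_mul_self hf hg 1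
  rw [hk.pairing_comm hg hf] at hexpand
  simp only [one_mul, one_pow] at hexpand
  linarith [hk.le_pairing_self hf hs, neg_le_of_abs_le (hk.abs_pairing_sub_le hf hg hs)]

lemma le_pairing_of_ball (hk : IsKernel k M L C) (hf : Integrable f) (hs : 0 ≤ s) :
    k 0 * (∫ p in Metric.ball 0 s, f p) ^ 2
        + 2 * ((∫ p in Metric.ball 0 s, f p) * ∫ p, k p * (Metric.ball 0 s)ᶜ.indicator f p)
        + pairing k ((Metric.ball 0 s)ᶜ.indicator f) ((Metric.ball 0 s)ᶜ.indicator f)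
      ≤ pairing k f f + 2 * (L * s) * (∫ p, |f p|) ^ 2 := by
  set B : Set E := Metric.ball 0 s
  have hB : MeasurableSet B := measurableSet_ball
  have hlow (p : E) (hp : s ≤ ‖p‖) : B.indicator f p = 0 :=
    Set.indicator_of_notMem (by simpa [B] using hp) f
  have hsplit : (fun p => B.indicator f p + Bᶜ.indicator f p) = f :=
    Set.indicator_self_add_compl B f
  have habs (S : Set E) : ∀ p, |S.indicator f p| = S.indicator (fun q => |f q|) p := fun p => by
    simpa only [Real.norm_eq_abs] using norm_indicator_eq_indicator_norm f p
  have hle := hk.le_pairing_add_self (hf.indicator hB) (hf.indicator hB.compl) hlow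
  simp only [hsplit, habs, integral_indicator hB, integral_indicator hB.compl,
    integral_add_compl hB hf.abs] at hle
  have hball : ∫ p in B, |f p| ≤ ∫ p, |f p| :=
    setIntegral_le_integral hf.abs (.of_forall fun _ => abs_nonneg _)
  have hprod : L * s * ((∫ p in B, |f p|) * ∫ p, |f p|) ≤ L * s * (∫ p, |f p|) ^ 2 := by
    rw [sq]
    exact mul_le_mul_of_nonneg_left (mul_le_mul_of_nonneg_right hball
      (integral_nonneg fun _ => abs_nonneg _)) (by positivity)
  linarith

lemma le_integral_mul_of_ball (hk : IsKernel k M L C) (hf : Integrable f) (hs : 0 ≤ s) :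
    k 0 * (∫ p in Metric.ball 0 s, f p) + ∫ p, k p * (Metric.ball 0 s)ᶜ.indicator f p
      ≤ (∫ p, k p * f p) + L * s * ∫ p, |f p| := by
  set B : Set E := Metric.ball 0 s
  have hB : MeasurableSet B := measurableSet_ball
  have hlow (p : E) (hp : s ≤ ‖p‖) : B.indicator f p = 0 :=
    Set.indicator_of_notMem (by simpa [B] using hp) f
  have hsplit : (∫ p, k p * B.indicator f p) + ∫ p, k p * Bᶜ.indicator f p = ∫ p, k p * f p := by
    rw [← integral_add (hk.integrable_mul (hf.indicator hB))
      (hk.integrable_mul (hf.indicator hB.compl))]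
    simp only [← mul_add, Set.indicator_self_add_compl_apply]
  have hmass : L * s * ∫ p, |B.indicator f p| ≤ L * s * ∫ p, |f p| := by
    refine mul_le_mul_of_nonneg_left ?_ (by positivity)
    exact integral_mono (hf.indicator hB).abs hf.abs fun p => norm_indicator_le_norm_self f p
  have hconst := neg_le_of_abs_le (hk.abs_integral_mul_sub_le (hf.indicator hB) hlow)
  rw [integral_indicator hB] at hconst
  linarith

lemma abs_integral_mul_indicator_le (hk : IsKernel k M L C) (hf : Integrable f) {S : Set E}
    (hS : MeasurableSet S) : |∫ p, k p * S.indicator f p| ≤ M * ∫ p, |f p| := by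
  rw [← hk.conv_zero]
  refine (hk.abs_conv_le (hf.indicator hS) 0).trans
    (mul_le_mul_of_nonneg_left ?_ hk.bound_nonneg)
  exact integral_mono (hf.indicator hS).abs hf.abs fun p => norm_indicator_le_norm_self f p

end IsKernel

lemma IsAdmissible.abs_setIntegral_le (hp : IsAdmissible γ α) {S : Set E}
    (hS : volume S ≠ ⊤) : |∫ p in S, α p| ≤ (∫ p in S, γ p) + volume.real S / 2 := by
  have hhalf : IntegrableOn (fun _ : E => (1 / 2 : ℝ)) S := integrableOn_const hS
  calc |∫ p in S, α p| ≤ ∫ p in S, (γ p + 1 / 2) :=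
        norm_integral_le_of_norm_le (f := α) (hp.integrable.integrableOn.add hhalf)
          (ae_restrict_of_ae hp.abs_le)
    _ = (∫ p in S, γ p) + volume.real S / 2 := by
        rw [integral_add hp.integrable.integrableOn hhalf, setIntegral_const, smul_eq_mul,
          mul_one_div]

/-- The energy of a pair after optimization over the sign of `α` in the coupling to the
condensate. -/
def flippedEnergy (k : E → ℝ) (r : ℝ) (γ α : E → ℝ) : ℝ :=
  (∫ p, ‖p‖ ^ 2 * γ p) + (r - ∫ p, γ p) * ((∫ p, k p * γ p) - |∫ p, k p * α p|)
    + 1 / 2 * interaction k γ α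

lemma IsPair.integral_kinetic_indicator_le (hp : IsPair γ α) {S : Set E} (hS : MeasurableSet S) :
    ∫ p, ‖p‖ ^ 2 * S.indicator γ p ≤ ∫ p, ‖p‖ ^ 2 * γ p := by
  refine integral_mono_ae (hp.indicator hS).integrable_kinetic hp.integrable_kinetic ?_
  filter_upwards [hp.indicator_le S] with p hle
  exact mul_le_mul_of_nonneg_left hle (sq_nonneg _)

lemma neg_le_add_of_abs_le {x k₀ a b c v : ℝ} (hx : 0 ≤ x) (hk₀ : 0 ≤ k₀) (ha : |a| ≤ c + v) :
    -(v * |b| + x * k₀ * v) ≤ (x + c) * |b| + (x + a) * b + x * k₀ * (c + a) := by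
  have hb : -((x + (c + v)) * |b|) ≤ (x + a) * b := by
    refine neg_le_of_abs_le ?_
    rw [abs_mul]
    gcongr
    exact (abs_add_le x a).trans (by rw [abs_of_nonneg hx]; gcongr)
  have hxk : x * k₀ * -v ≤ x * k₀ * (c + a) := by
    have := neg_le_of_abs_le ha
    gcongr
    linarith
  linarith

lemma sub_mul_add_add_sq_le {m q r K : ℝ} (hm : 0 ≤ m) (hmr : m ≤ r) (hq : 0 ≤ q) (hqK : q ≤ K) :
    (r - m) * (m + q) + m ^ 2 + q ^ 2 ≤ (r + K) ^ 2 := by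
  have hsq : (r + q) ^ 2 ≤ (r + K) ^ 2 := by gcongr; linarith
  nlinarith [mul_nonneg (sub_nonneg.mpr hmr) hm, mul_nonneg (sub_nonneg.mpr hmr) hq]

/-- The error made in moving all particles with momentum in `ball 0 s` to the condensate. -/
def condensationError (E : Type*) [NormedAddCommGroup E] [MeasureSpace E] (M L r K s : ℝ) : ℝ :=
  L * s * (r + K) ^ 2 + volume.real (Metric.ball (0 : E) s) / 2 * (M * (r + K))

theorem IsKernel.flippedEnergy_indicator_le (hk : IsKernel k M L C) (hp : IsPair γ α)
    (hα : Integrable α) (hmass : ∫ p, γ p ≤ r) (hK : ∫ p, |α p| ≤ K) (hs : 0 ≤ s) :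
    flippedEnergy k r ((Metric.ball 0 s)ᶜ.indicator γ) ((Metric.ball 0 s)ᶜ.indicator α)
      ≤ pairEnergy k r γ α + condensationError E M L r K s := by
  have hx : 0 ≤ r - ∫ p, γ p := sub_nonneg.mpr hmass
  have hγint := mul_le_mul_of_nonneg_left (hk.le_integral_mul_of_ball hp.integrable hs) hx
  have hαint := mul_le_mul_of_nonneg_left (hk.le_integral_mul_of_ball hα hs) hx
  have hγpair := hk.le_pairing_of_ball hp.integrable hs
  have hαpair := hk.le_pairing_of_ball hα hs
  rw [hp.integral_abs_left] at hγint hγpair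
  have hsign := neg_le_add_of_abs_le (b := ∫ p, k p * (Metric.ball 0 s)ᶜ.indicator α p) hx
    (hk.nonneg 0) (hp.abs_setIntegral_le (S := Metric.ball 0 s) measure_ball_lt_top.ne)
  set B : Set E := Metric.ball 0 s
  have hB : MeasurableSet B := measurableSet_ball
  have hout := hp.indicator hB.compl
  have hαout := hα.indicator hB.compl
  have hkin := hp.integral_kinetic_indicator_le hB.compl
  have hsum : r - ∫ p, Bᶜ.indicator γ p = (r - ∫ p, γ p) + ∫ p in B, γ p := by
    rw [integral_indicator hB.compl, ← integral_add_compl hB hp.integrable]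
    ring
  have hαk : |∫ p, k p * Bᶜ.indicator α p| ≤ M * K :=
    (hk.abs_integral_mul_indicator_le hα hB.compl).trans
      (mul_le_mul_of_nonneg_left hK hk.bound_nonneg)
  have hlow : 0 ≤ k 0 * (∫ p in B, γ p) ^ 2 + k 0 * (∫ p in B, α p) ^ 2 :=
    add_nonneg (mul_nonneg (hk.nonneg 0) (sq_nonneg _)) (mul_nonneg (hk.nonneg 0) (sq_nonneg _))
  have hlip : L * s * ((r - ∫ p, γ p) * ((∫ p, γ p) + ∫ p, |α p|) + (∫ p, γ p) ^ 2
      + (∫ p, |α p|) ^ 2) ≤ L * s * (r + K) ^ 2 :=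
    mul_le_mul_of_nonneg_left (sub_mul_add_add_sq_le hp.mass_nonneg hmass
      (integral_nonneg fun _ => abs_nonneg _) hK) (mul_nonneg L.2 hs)
  have hball : volume.real B / 2 * (|∫ p, k p * Bᶜ.indicator α p| + (r - ∫ p, γ p) * k 0)
      ≤ volume.real B / 2 * (M * (r + K)) := by
    have hmul : (r - ∫ p, γ p) * k 0 ≤ r * M :=
      mul_le_mul (by linarith [hp.mass_nonneg]) (hk.le 0) (hk.nonneg 0)
        (hp.mass_nonneg.trans hmass)
    gcongr
    linarith
  unfold flippedEnergy pairEnergy condensationError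
  rw [hk.interaction_eq_pairing hout.integrable hαout,
    hk.interaction_eq_pairing hp.integrable hα, hk.coupling_eq_add hp.toIsAdmissible, hsum]
  linarith

theorem DominatedConvergence.tendsto_flippedEnergy_sub (hd : DominatedConvergence γn αn g a h)
    (hk : IsKernel k M L C) :
    Tendsto (fun n => flippedEnergy k r (γn n) (αn n) - ∫ p, ‖p‖ ^ 2 * γn n p) atTop
      (𝓝 (flippedEnergy k r g a - ∫ p, ‖p‖ ^ 2 * g p)) := by
  have hlim := (((hd.tendsto_integral.const_sub r).mul ((hd.tendsto_integral_mul_left hk).sub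
    (hd.tendsto_integral_mul_right hk).abs)).add ((hd.tendsto_interaction hk).const_mul (1 / 2)))
  simpa only [flippedEnergy, add_assoc, add_sub_cancel_left] using hlim

theorem DominatedConvergence.tendsto_flippedEnergy (hd : DominatedConvergence γn αn g a h)
    (hk : IsKernel k M L C) (hh : Integrable fun p => ‖p‖ ^ 2 * h p) :
    Tendsto (fun n => flippedEnergy k r (γn n) (αn n)) atTop (𝓝 (flippedEnergy k r g a)) := by
  simpa using (hd.tendsto_flippedEnergy_sub hk).add (hd.tendsto_integral_kinetic hh)

theorem DominatedConvergence.flippedEnergy_le (hd : DominatedConvergence γn αn g a h)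
    (hk : IsKernel k M L C) (hkin : ∀ n, Integrable fun p => ‖p‖ ^ 2 * γn n p)
    (hle : ∀ᶠ n in atTop, flippedEnergy k r (γn n) (αn n) ≤ I) :
    flippedEnergy k r g a ≤ I := by
  refine le_of_forall_pos_le_add fun η hη => ?_
  have hrest := (hd.tendsto_flippedEnergy_sub hk (r := r)).eventually_const_lt
    (sub_lt_self _ hη)
  have hkinle : ∃ᶠ n in atTop, ∫ p, ‖p‖ ^ 2 * γn n p
      ≤ I + η - (flippedEnergy k r g a - ∫ p, ‖p‖ ^ 2 * g p)  := by
    refine (hrest.and hle).frequently.mono fun n hn => ?_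
    linarith [hn.1, hn.2]
  have hfatou := (integrable_and_integral_le_of_tendsto hkin
    (fun n => (hd.isAdmissible n).nonneg.mono fun p h0 => mul_nonneg (sq_nonneg _) h0)
    (hd.tendsto_left.mono fun p hp => hp.const_mul _) hkinle).2
  linarith

lemma tendsto_volume_real_ball_zero [Nontrivial E] :
    Tendsto (fun s => volume.real (Metric.ball (0 : E) s)) (𝓝[≥] 0) (𝓝 0) := by
  have hpow : Tendsto (fun s : ℝ => s ^ Module.finrank ℝ E * volume.real (Metric.ball (0 : E) 1))
      (𝓝[≥] 0) (𝓝 (0 ^ Module.finrank ℝ E * volume.real (Metric.ball (0 : E) 1))) :=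
    (Continuous.tendsto (by fun_prop) 0).mono_left nhdsWithin_le_nhds
  rw [zero_pow Module.finrank_pos.ne', zero_mul] at hpow
  refine hpow.congr' (eventually_mem_nhdsWithin.mono fun s hs => ?_)
  simp only [measureReal_def, Measure.addHaar_ball volume (0 : E) hs, ENNReal.toReal_mul,
    ENNReal.toReal_ofReal (pow_nonneg hs _)]

lemma tendsto_condensationError [Nontrivial E] :
    Tendsto (fun s => condensationError E M L r K s) (𝓝[≥] 0) (𝓝 0) := by
  have hid : Tendsto (fun s : ℝ => s) (𝓝[≥] 0) (𝓝 0) := nhdsWithin_le_nhds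
  simpa [condensationError] using ((hid.const_mul (L : ℝ)).mul_const ((r + K) ^ 2)).add
    ((tendsto_volume_real_ball_zero.div_const 2).mul_const (M * (r + K)))

/-- A sequence of pairs with bounded masses converging almost everywhere to `(g, a)`, with energies
asymptotically at most `I`. The limit of the masses may exceed the mass of the limit: particles
may condense at momentum zero. -/
structure IsMinimizingSequence (k : E → ℝ) (r K I : ℝ) (γn αn : ℕ → E → ℝ) (g a : E → ℝ) :
    Prop where
  isPair : ∀ n, IsPair (γn n) (αn n)
  integrable_right : ∀ n, Integrable (αn n)
  mass_le : ∀ n, ∫ p, γn n p ≤ r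
  integral_abs_right_le : ∀ n, ∫ p, |αn n p| ≤ K
  eventually_pairEnergy_lt : ∀ η > 0, ∀ᶠ n in atTop, pairEnergy k r (γn n) (αn n) < I + η
  tendsto_left : ∀ᵐ p, Tendsto (fun n => γn n p) atTop (𝓝 (g p))
  tendsto_right : ∀ᵐ p, Tendsto (fun n => αn n p) atTop (𝓝 (a p))

lemma IsKernel.integral_kinetic_le (hk : IsKernel k M L C) (hp : IsPair γ α)
    (hα : Integrable α) (hmass : ∫ p, γ p ≤ r) :
    ∫ p, ‖p‖ ^ 2 * γ p ≤ pairEnergy k r γ α + r * (1 / 2 * ∫ p, k p) := by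
  have hcoupling := mul_le_mul_of_nonneg_left (hk.neg_le_coupling hp.toIsAdmissible)
    (sub_nonneg.mpr hmass)
  have hinteraction : 0 ≤ interaction k γ α := by
    rw [hk.interaction_eq_pairing hp.integrable hα]
    exact add_nonneg (hk.pairing_self_nonneg _ hp.integrable) (hk.pairing_self_nonneg _ hα)
  have hmass_mul := mul_nonneg hp.mass_nonneg (integral_nonneg (μ := volume) hk.nonneg)
  unfold pairEnergy
  linarith

namespace IsMinimizingSequence

lemma integrable_left_and_mass_le (h : IsMinimizingSequence k r K I γn αn g a) :
    Integrable g ∧ ∫ p, g p ≤ r :=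
  integrable_and_integral_le_of_tendsto (fun n => (h.isPair n).integrable)
    (fun n => (h.isPair n).nonneg) h.tendsto_left (.of_forall h.mass_le)

theorem isPair_limit (h : IsMinimizingSequence k r K I γn αn g a) (hk : IsKernel k M L C) :
    IsPair g a where
  toIsAdmissible := .of_tendsto (fun n => (h.isPair n).toIsAdmissible)
    h.integrable_left_and_mass_le.1 h.tendsto_left h.tendsto_right
  integrable_kinetic := by
    have hkin : ∀ᶠ n in atTop, ∫ p, ‖p‖ ^ 2 * γn n p ≤ I + 1 + r * (1 / 2 * ∫ p, k p) := by
      filter_upwards [h.eventually_pairEnergy_lt 1 one_pos] with n hn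
      linarith [hk.integral_kinetic_le (h.isPair n) (h.integrable_right n) (h.mass_le n)]
    exact (integrable_and_integral_le_of_tendsto (fun n => (h.isPair n).integrable_kinetic)
      (fun n => (h.isPair n).nonneg.mono fun p h0 => mul_nonneg (sq_nonneg _) h0)
      (h.tendsto_left.mono fun p hp => hp.const_mul _) hkin.frequently).1

theorem flippedEnergy_indicator_le (h : IsMinimizingSequence k r K I γn αn g a)
    (hk : IsKernel k M L C) (hs : 0 ≤ s) (hf : Integrable f)
    (hle : ∀ᶠ n in atTop, ∀ᵐ p, s ≤ ‖p‖ → γn n p ≤ f p) :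
    flippedEnergy k r ((Metric.ball 0 s)ᶜ.indicator g) ((Metric.ball 0 s)ᶜ.indicator a)
      ≤ I + condensationError E M L r K s := by
  set S : Set E := (Metric.ball 0 s)ᶜ
  have hS : MeasurableSet S := measurableSet_ball.compl
  obtain ⟨N, hN⟩ := eventually_atTop.mp hle
  have hlim {u : ℕ → E → ℝ} {v : E → ℝ} (hu : ∀ᵐ p, Tendsto (fun n => u n p) atTop (𝓝 (v p))) :
      ∀ᵐ p, Tendsto (fun n => S.indicator (u (n + N)) p) atTop (𝓝 (S.indicator v p)) := by
    filter_upwards [hu] with p hp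
    have hp' := (tendsto_add_atTop_iff_nat N).mpr hp
    by_cases hpS : p ∈ S <;> simp [hpS, hp']
  have hbound (n : ℕ) : ∀ᵐ p, S.indicator (γn (n + N)) p ≤ S.indicator f p := by
    filter_upwards [hN (n + N) (Nat.le_add_left _ _)] with p hp
    by_cases hpS : p ∈ S
    · simpa only [Set.indicator_of_mem hpS] using hp (by simpa [S] using hpS)
    · simp [hpS]
  have hd : DominatedConvergence (fun n => S.indicator (γn (n + N)))
      (fun n => S.indicator (αn (n + N))) (S.indicator g) (S.indicator a) (S.indicator f) :=
    ⟨hf.indicator hS, fun n => ((h.isPair _).indicator hS).toIsAdmissible, hbound,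
      hlim h.tendsto_left, hlim h.tendsto_right⟩
  refine le_of_forall_pos_le_add fun η hη => ?_
  refine hd.flippedEnergy_le hk (fun n => ((h.isPair _).indicator hS).integrable_kinetic) ?_
  filter_upwards [(tendsto_add_atTop_nat N).eventually (h.eventually_pairEnergy_lt η hη)] with n hn
  linarith [hk.flippedEnergy_indicator_le (h.isPair (n + N)) (h.integrable_right _) (h.mass_le _)
    (h.integral_abs_right_le _) hs]

theorem flippedEnergy_le [Nontrivial E] (h : IsMinimizingSequence k r K I γn αn g a)
    (hk : IsKernel k M L C) (hmaj : ∀ s > 0, ∃ f : E → ℝ, Integrable f ∧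
      ∀ᶠ n in atTop, ∀ᵐ p, s ≤ ‖p‖ → γn n p ≤ f p) :
    flippedEnergy k r g a ≤ I := by
  have hpair := h.isPair_limit hk
  have hs0 : Tendsto (fun n : ℕ => 1 / ((n : ℝ) + 1)) atTop (𝓝 0) :=
    tendsto_one_div_add_atTop_nhds_zero_nat
  have hpos (n : ℕ) : (0 : ℝ) < 1 / (n + 1) := by positivity
  have hne : ∀ᵐ p : E, p ≠ 0 := by simp [ae_iff]
  have herror : Tendsto (fun n : ℕ => I + condensationError E M L r K (1 / ((n : ℝ) + 1))) atTop
      (𝓝 I) := by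
    simpa using (tendsto_condensationError.comp (tendsto_nhdsWithin_iff.mpr
      ⟨hs0, .of_forall fun n => (hpos n).le⟩)).const_add I
  have hexhaust : ∀ᵐ p : E, ∀ᶠ n : ℕ in atTop, p ∈ (Metric.ball 0 (1 / ((n : ℝ) + 1)))ᶜ := by
    filter_upwards [hne] with p hp
    simpa using hs0.eventually_le_const (norm_pos_iff.mpr hp)
  have hd := hpair.dominatedConvergence_indicator (fun n => measurableSet_ball.compl) hexhaust
  refine le_of_tendsto_of_tendsto' (hd.tendsto_flippedEnergy hk hpair.integrable_kinetic) herror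
    fun n => ?_
  obtain ⟨f, hf, hle⟩ := hmaj _ (hpos n)
  exact h.flippedEnergy_indicator_le hk (hpos n).le hf hle

end IsMinimizingSequence

/-- The energy depends on the sign of `α` only through the coupling to the condensate. -/
theorem IsKernel.exists_pairEnergy_eq_flippedEnergy (hk : IsKernel k M L C) (hp : IsPair γ α) :
    ∃ σ : ℝ, IsPair γ (fun p => σ * α p)
      ∧ pairEnergy k r γ (fun p => σ * α p) = flippedEnergy k r γ α := by
  obtain ⟨σ, hσ, hσα⟩ : ∃ σ : ℝ, σ ^ 2 = 1 ∧ σ * ∫ p, k p * α p = -|∫ p, k p * α p| := by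
    rcases le_total 0 (∫ p, k p * α p) with h | h
    · exact ⟨-1, by norm_num, by rw [abs_of_nonneg h, neg_one_mul]⟩
    · exact ⟨1, by norm_num, by rw [abs_of_nonpos h, one_mul, neg_neg]⟩
  have hpσ : IsPair γ (fun p => σ * α p) := hp.const_mul_right hσ.le
  refine ⟨σ, hpσ, ?_⟩
  have hint : ∫ p, k p * (σ * α p) = -|∫ p, k p * α p| := by
    rw [← hσα, ← integral_const_mul]
    exact integral_congr_ae (.of_forall fun p => mul_left_comm _ _ _)
  rw [pairEnergy, flippedEnergy, hk.coupling_eq_add hpσ.toIsAdmissible, hint,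
    interaction_const_mul_right hσ, sub_eq_add_neg (∫ p, k p * γ p)]

end Condensation

section Existence

variable {k : E3 → ℝ} {M : ℝ} {L : ℝ≥0} {C r I : ℝ} {γ α : E3 → ℝ}

lemma pairEnergy_zero : pairEnergy k r (fun _ => 0) (fun _ => 0) = 0 := by
  simp [pairEnergy, coupling, interaction]

theorem IsKernel.neg_le_pairEnergy (hk : IsKernel k M L C) (hp : IsPair γ α)
    (hmass : ∫ p, γ p ≤ r) : -(r * (1 / 2 * ∫ p, k p)) ≤ pairEnergy k r γ α := by
  refine le_of_forall_pos_le_add fun η hη => ?_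
  obtain ⟨g, a, hreg, hlt⟩ := hk.exists_isRegularPair hp hmass hη
  have hle := hk.neg_le_regEnergy (ε := 0) le_rfl hreg
  rw [regEnergy, zero_mul, add_zero] at hle
  linarith

theorem IsKernel.exists_isMinimizingSequence (hk : IsKernel k M L C) (hr : 0 < r) (hI : I < 0)
    (hinf : ∀ η > 0, ∃ γ α, IsPair γ α ∧ ∫ p, γ p ≤ r ∧ pairEnergy k r γ α < I + η) :
    ∃ K γn αn g a, IsMinimizingSequence k r K I γn αn g a ∧
      ∀ s > 0, ∃ f : E3 → ℝ, Integrable f ∧ ∀ᶠ n in atTop, ∀ᵐ p, s ≤ ‖p‖ → γn n p ≤ f p := by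
  obtain ⟨ε, γ, α, hε, hε0, hstat, henergy⟩ := hk.exists_stationary_sequence hr hI hinf
  have hδ : 0 < -I / 2 / r := div_pos (by linarith) hr
  obtain ⟨K, hK, φ, hφ, A, B, hF⟩ := hk.exists_fieldsConverge hr.le hδ hε hε0 hstat
  obtain ⟨g, a, hg, ha⟩ := hF.exists_limit hk hδ hK
  exact ⟨K, fun n => γ (φ n), fun n => α (φ n), g, a,
    { isPair := fun n => (hF.stationary n).pair.isPair
      integrable_right := fun n => (hF.stationary n).pair.right.integrable
      mass_le := fun n => (hF.stationary n).pair.mass_le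
      integral_abs_right_le := fun n => (hF.bound n).integral_abs_right_le
      eventually_pairEnergy_lt := fun η hη => hφ.tendsto_atTop.eventually (henergy η hη)
      tendsto_left := hg
      tendsto_right := ha },
    fun s hs => hF.exists_majorant hk hδ hK hs⟩

theorem IsKernel.exists_pairEnergy_le (hk : IsKernel k M L C) (hr : 0 < r) (hI : I < 0)
    (hinf : ∀ η > 0, ∃ γ α, IsPair γ α ∧ ∫ p, γ p ≤ r ∧ pairEnergy k r γ α < I + η) :
    ∃ γ α, IsPair γ α ∧ ∫ p, γ p ≤ r ∧ pairEnergy k r γ α ≤ I := by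
  obtain ⟨K, γn, αn, g, a, hseq, hmaj⟩ := hk.exists_isMinimizingSequence hr hI hinf
  obtain ⟨σ, hpair, henergy⟩ := hk.exists_pairEnergy_eq_flippedEnergy (hseq.isPair_limit hk)
  exact ⟨g, _, hpair, hseq.integrable_left_and_mass_le.2,
    henergy.trans_le (hseq.flippedEnergy_le hk hmaj)⟩

theorem IsKernel.exists_minimizer (hk : IsKernel k M L C) (hr : 0 ≤ r) :
    ∃ γ α, IsPair γ α ∧ ∫ p, γ p ≤ r ∧
      ∀ g a, IsPair g a → ∫ p, g p ≤ r → pairEnergy k r γ α ≤ pairEnergy k r g a := by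
  set S : Set ℝ := {x | ∃ g a, IsPair g a ∧ ∫ p, g p ≤ r ∧ pairEnergy k r g a = x}
  have hzero : (0 : ℝ) ∈ S := ⟨_, _, .zero, by simpa using hr, pairEnergy_zero⟩
  have hlow : ∀ x ∈ S, -(r * (1 / 2 * ∫ p, k p)) ≤ x := by
    rintro x ⟨g, a, hp, hmass, rfl⟩
    exact hk.neg_le_pairEnergy hp hmass
  have hinf (g a : E3 → ℝ) (hp : IsPair g a) (hmass : ∫ p, g p ≤ r) :
      sInf S ≤ pairEnergy k r g a := csInf_le ⟨_, hlow⟩ ⟨g, a, hp, hmass, rfl⟩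
  rcases le_or_gt 0 (sInf S) with hI | hI
  · refine ⟨_, _, .zero, by simpa using hr, fun g a hp hmass => ?_⟩
    rw [pairEnergy_zero]
    exact hI.trans (hinf g a hp hmass)
  · have hr' : 0 < r := by
      refine hr.lt_of_ne fun hr0 => hI.not_ge ?_
      simpa [← hr0] using le_csInf ⟨_, hzero⟩ hlow
    obtain ⟨γ, α, hp, hmass, hle⟩ := hk.exists_pairEnergy_le hr' hI fun η hη => by
      obtain ⟨_, ⟨g, a, hp, hmass, rfl⟩, hlt⟩ := exists_lt_of_csInf_lt ⟨_, hzero⟩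
        (lt_add_of_pos_right (sInf S) hη)
      exact ⟨g, a, hp, hmass, hlt⟩
    exact ⟨γ, α, hp, hmass, fun g a hp' hmass' => hle.trans (hinf g a hp' hmass')⟩

end Existence

/-! ### The canonical problem -/

section AngularFourier

variable {E : Type*} [NormedAddCommGroup E] [InnerProductSpace ℝ E] [FiniteDimensional ℝ E]
  [MeasurableSpace E] [BorelSpace E]

/-- The Fourier integral `p ↦ ∫ e^{-i p·x} f(x) dx` in the angular normalization, which is that of
`fourierC`; Mathlib's `𝓕` has `2π` in the exponent. -/
def angularFourier (f : E → ℂ) : E → ℂ :=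
  VectorFourier.fourierIntegral Real.probChar volume (innerₗ E) f

lemma angularFourier_apply (f : E → ℂ) (p : E) :
    angularFourier f p = ∫ x, Complex.exp (-(Complex.I * ((inner ℝ p x : ℝ) : ℂ))) * f x := by
  simp only [angularFourier, VectorFourier.fourierIntegral_probChar, innerₗ_apply_apply,
    smul_eq_mul, neg_mul, real_inner_comm p, mul_comm Complex.I]

lemma continuous_angularFourier {f : E → ℂ} (hf : Integrable f) : Continuous (angularFourier f) :=
  VectorFourier.fourierIntegral_continuous Real.continuous_probChar continuous_inner hf

lemma norm_angularFourier_le (f : E → ℂ) (p : E) : ‖angularFourier f p‖ ≤ ∫ x, ‖f x‖ :=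
  VectorFourier.norm_fourierIntegral_le_integral_norm _ _ _ f p

lemma integral_angularFourier_mul {f g : E → ℂ} (hf : Integrable f) (hg : Integrable g) :
    ∫ p, angularFourier f p * g p = ∫ x, f x * angularFourier g x := by
  have hflip : (innerₗ E).flip = innerₗ E := by ext x y; exact real_inner_comm x y
  simpa only [angularFourier, smul_eq_mul, hflip] using
    VectorFourier.integral_fourierIntegral_smul_eq_flip (L := innerₗ E)
      Real.continuous_probChar continuous_inner hf hg

lemma angularFourier_exp_mul (f : E → ℂ) (p q : E) :
    angularFourier (fun x => Complex.exp (Complex.I * ((inner ℝ p x : ℝ) : ℂ)) * f x) q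
      = angularFourier f (q - p) := by
  simp only [angularFourier_apply, ← mul_assoc, ← Complex.exp_add, inner_sub_left]
  congr! 4
  push_cast
  ring

lemma integral_angularFourier_sub_mul {f g : E → ℂ} (hf : Integrable f) (hg : Integrable g)
    (p : E) : ∫ q, angularFourier f (q - p) * g q
      = ∫ x, Complex.exp (Complex.I * ((inner ℝ p x : ℝ) : ℂ)) * (f x * angularFourier g x) := by
  have hmod : Integrable fun x => Complex.exp (Complex.I * ((inner ℝ p x : ℝ) : ℂ)) * f x :=
    hf.bdd_mul (c := 1) (Continuous.aestronglyMeasurable (by fun_prop)) (.of_forall fun x => by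
      rw [mul_comm, Complex.norm_exp_ofReal_mul_I])
  simp only [← angularFourier_exp_mul, integral_angularFourier_mul hmod hg, mul_assoc]

end AngularFourier

section FourierKernel

variable {V f : E3 → ℝ}

lemma fourierC_eq_angularFourier (p : E3) : fourierC V p = angularFourier (fun x => (V x : ℂ)) p :=
  (angularFourier_apply _ p).symm

lemma fourier_radial (hr : IsRadial V) : IsRadial (fourier V) := by
  intro p q hpq
  obtain ⟨R, rfl⟩ : ∃ R : E3 ≃ₗᵢ[ℝ] E3, R p = q := ⟨_, Submodule.reflection_sub hpq⟩
  unfold fourier fourierC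
  rw [← R.measurePreserving.integral_comp R.toHomeomorph.measurableEmbedding
    fun x => Complex.exp (-(Complex.I * ((inner ℝ (R p) x : ℝ) : ℂ))) * (V x : ℂ)]
  simp only [R.inner_map_map, fun x => hr (R x) x (R.norm_map x)]

lemma ofReal_conv_fourier (hV : Integrable V) (hr : IsRadial V) (hf : Integrable f) (p : E3) :
    (conv (fourier V) f p : ℂ) = starRingEnd ℂ (angularFourier
      (fun x => V x * starRingEnd ℂ (angularFourier (fun q => (f q : ℂ)) x)) p) := by
  have hVc : Integrable fun x => (V x : ℂ) := hV.ofReal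
  have hfc : Integrable fun q => (f q : ℂ) := hf.ofReal
  calc (conv (fourier V) f p : ℂ)
      = ∫ q, angularFourier (fun x => (V x : ℂ)) (q - p) * (f q : ℂ) := by
        simp only [conv, ← integral_complex_ofReal, Complex.ofReal_mul,
          fourier_radial hr (p - _) (_ - p) (norm_sub_rev _ _), ofReal_fourier hr,
          fourierC_eq_angularFourier]
    _ = _ := by
        rw [integral_angularFourier_sub_mul hVc hfc, angularFourier_apply,
          ← integral_conj]
        simp [← Complex.exp_conj]

theorem pairing_fourier_eq_integral (hV : Integrable V) (hr : IsRadial V) (hf : Integrable f) :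
    pairing (fourier V) f f = ∫ x, V x * ‖angularFourier (fun p => (f p : ℂ)) x‖ ^ 2 := by
  have hVc : Integrable fun x => (V x : ℂ) := hV.ofReal
  have hfc : Integrable fun p => (f p : ℂ) := hf.ofReal
  set F := angularFourier fun p => (f p : ℂ) with hF
  have hVF : Integrable fun x => (V x : ℂ) * starRingEnd ℂ (F x) :=
    hVc.mul_bdd (Complex.continuous_conj.comp
      (continuous_angularFourier hfc)).aestronglyMeasurable (.of_forall fun x => by
        rw [RCLike.norm_conj]; exact norm_angularFourier_le _ x)
  apply Complex.ofReal_injective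
  calc (pairing (fourier V) f f : ℂ)
      = starRingEnd ℂ (∫ p, angularFourier (fun x => V x * starRingEnd ℂ (F x)) p * (f p : ℂ)) := by
        simp only [pairing, ← integral_complex_ofReal, Complex.ofReal_mul,
          ofReal_conv_fourier hV hr hf, ← integral_conj, map_mul, Complex.conj_ofReal, ← hF,
          mul_comm]
    _ = starRingEnd ℂ (∫ x, V x * starRingEnd ℂ (F x) * F x) := by
        rw [integral_angularFourier_mul hVF hfc]
    _ = _ := by
        simp only [mul_assoc, ← Complex.normSq_eq_conj_mul_self, Complex.normSq_eq_norm_sq,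
          ← Complex.ofReal_mul, integral_complex_ofReal, Complex.conj_ofReal]

end FourierKernel

section SecondDifference

variable {E F : Type*} [NormedAddCommGroup E] [NormedSpace ℝ E] [NormedAddCommGroup F]
  [NormedSpace ℝ F] {f : E → F} {c : ℝ}

lemma lipschitzWith_of_norm_fderiv_le (hf : Differentiable ℝ f) (hc : ∀ x, ‖fderiv ℝ f x‖ ≤ c) :
    LipschitzWith c.toNNReal f :=
  lipschitzWith_of_nnnorm_fderiv_le hf fun x => NNReal.le_toNNReal_of_coe_le (hc x)

lemma norm_second_diff_le {K : ℝ≥0} (hf : Differentiable ℝ f) (hK : LipschitzWith K (fderiv ℝ f))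
    (x h : E) : ‖f (x + h) + f (x - h) - (2 : ℝ) • f x‖ ≤ 2 * K * ‖h‖ ^ 2 := by
  have hderiv (t : ℝ) : HasDerivAt (fun t : ℝ => f (x + t • h) + f (x - t • h))
      (fderiv ℝ f (x + t • h) h + fderiv ℝ f (x - t • h) (-h)) t := by
    have hadd : HasDerivAt (fun t : ℝ => x + t • h) h t := by
      simpa using ((hasDerivAt_id t).smul_const h).const_add x
    have hsub : HasDerivAt (fun t : ℝ => x - t • h) (-h) t := by
      simpa using ((hasDerivAt_id t).smul_const h).const_sub x
    exact ((hf _).hasFDerivAt.comp_hasDerivAt t hadd).add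
      ((hf _).hasFDerivAt.comp_hasDerivAt t hsub)
  have hbound (t : ℝ) (ht : t ∈ Set.Ico (0 : ℝ) 1) :
      ‖fderiv ℝ f (x + t • h) h + fderiv ℝ f (x - t • h) (-h)‖ ≤ 2 * K * ‖h‖ ^ 2 := by
    have hdist : ‖x + t • h - (x - t • h)‖ ≤ 2 * ‖h‖ := by
      rw [show x + t • h - (x - t • h) = (2 * t) • h by rw [mul_smul, two_smul]; abel, norm_smul,
        Real.norm_of_nonneg (by linarith [ht.1])]
      exact mul_le_mul_of_nonneg_right (by linarith [ht.2]) (norm_nonneg _)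
    calc ‖fderiv ℝ f (x + t • h) h + fderiv ℝ f (x - t • h) (-h)‖
        = ‖(fderiv ℝ f (x + t • h) - fderiv ℝ f (x - t • h)) h‖ := by
          rw [map_neg, ← sub_eq_add_neg, ← sub_apply]
      _ ≤ K * (2 * ‖h‖) * ‖h‖ := (ContinuousLinearMap.le_opNorm _ _).trans
          (mul_le_mul_of_nonneg_right (hK.norm_sub_le_of_le hdist) (norm_nonneg _))
      _ = 2 * K * ‖h‖ ^ 2 := by ring
  have hseg := norm_image_sub_le_of_norm_deriv_le_segment_01'
    (fun t _ => (hderiv t).hasDerivWithinAt) hbound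
  simpa only [one_smul, zero_smul, add_zero, sub_zero, ← two_smul ℝ (f x)] using hseg

end SecondDifference

theorem exists_isKernel_fourier {V : E3 → ℝ} (hV : Integrable V) (hr : IsRadial V)
    (h0 : ∀ x, 0 ≤ V x) (hF0 : ∀ p, 0 ≤ fourier V p) (hF : Integrable (fourier V))
    (hC2 : ContDiff ℝ 2 (fourier V))
    (hbdd : ∀ j ≤ 2, ∃ C : ℝ, ∀ p, ‖iteratedFDeriv ℝ j (fourier V) p‖ ≤ C) :
    ∃ M L C, IsKernel (fourier V) M L C := by
  obtain ⟨c₀, hc₀⟩ := hbdd 0 (by norm_num)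
  obtain ⟨c₁, hc₁⟩ := hbdd 1 (by norm_num)
  obtain ⟨c₂, hc₂⟩ := hbdd 2 le_rfl
  have hdiff : Differentiable ℝ (fourier V) := hC2.differentiable (by norm_num)
  have hdiff' : Differentiable ℝ (fderiv ℝ (fourier V)) :=
    (hC2.fderiv_right (m := 1) (by norm_num)).differentiable (by norm_num)
  have hlip : LipschitzWith c₂.toNNReal (fderiv ℝ (fourier V)) :=
    lipschitzWith_of_norm_fderiv_le hdiff' fun p => by
      rw [← norm_iteratedFDeriv_one, norm_iteratedFDeriv_fderiv]; exact hc₂ p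
  exact ⟨c₀, c₁.toNNReal, 2 * c₂.toNNReal,
    { nonneg := hF0
      integrable := hF
      le := fun p => (Real.le_norm_self _).trans
        (by simpa only [norm_iteratedFDeriv_zero] using hc₀ p)
      radial := fourier_radial hr
      lipschitz := lipschitzWith_of_norm_fderiv_le hdiff fun p => by
        rw [← norm_iteratedFDeriv_one]; exact hc₁ p
      abs_second_diff_le := norm_second_diff_le hdiff hlip
      pairing_self_nonneg := fun f hf => by
        rw [pairing_fourier_eq_integral hV hr hf]
        exact integral_nonneg fun x => mul_nonneg (h0 x) (sq_nonneg _) }⟩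

section Canonical

variable {V : E3 → ℝ} {ρ : ℝ}

lemma mem_domain_iff {u : (E3 → ℝ) × (E3 → ℝ) × ℝ} :
    u ∈ domain ↔ IsPair u.1 u.2.1 ∧ 0 ≤ u.2.2 := by
  refine ⟨fun ⟨hint, hmeas, hγ, hα, hρ₀⟩ => ?_, fun ⟨hp, hρ₀⟩ => ?_⟩
  · have hint' := integrable_one_add_norm_sq_mul_iff.mp hint
    exact ⟨⟨⟨hint'.1, hmeas, hγ, hα⟩, hint'.2⟩, hρ₀⟩
  · exact ⟨integrable_one_add_norm_sq_mul_iff.mpr ⟨hp.integrable, hp.integrable_kinetic⟩,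
      hp.aestronglyMeasurable, hp.nonneg, hp.sq_le, hρ₀⟩

lemma rhoGamma_le_iff {γ : E3 → ℝ} : rhoGamma γ ≤ ρ ↔ ∫ p, γ p ≤ (2 * Real.pi) ^ 3 * ρ :=
  inv_mul_le_iff₀ (by positivity)

lemma canonicalFreeEnergy_eq {u : (E3 → ℝ) × (E3 → ℝ) × ℝ} (hu : u.2.2 + rhoGamma u.1 = ρ) :
    canonicalFreeEnergy V 0 u = fourier V 0 / 2 * ρ ^ 2 + ((2 * Real.pi) ^ 3)⁻¹
      * pairEnergy (fun p => ((2 * Real.pi) ^ 3)⁻¹ * fourier V p) ((2 * Real.pi) ^ 3 * ρ)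
        u.1 u.2.1 := by
  have hpi : ((2 * Real.pi) ^ 3 : ℝ) ≠ 0 := by positivity
  have hρ₀ : u.2.2 = ((2 * Real.pi) ^ 3)⁻¹ * ((2 * Real.pi) ^ 3 * ρ - ∫ p, u.1 p) := by
    rw [mul_sub, inv_mul_cancel_left₀ hpi, ← hu, rhoGamma]; ring
  have hsq : ((2 * Real.pi) ^ 6 : ℝ)⁻¹ = ((2 * Real.pi) ^ 3)⁻¹ * ((2 * Real.pi) ^ 3)⁻¹ := by
    rw [← mul_inv, ← pow_add]
  simp only [canonicalFreeEnergy, hu]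
  rw [pairEnergy, coupling_const_mul_kernel, interaction_const_mul_kernel, hρ₀, hsq, coupling,
    interaction]
  ring

theorem IsKernel.exists_isMinOn_canonicalFreeEnergy {M : ℝ} {L : ℝ≥0} {C : ℝ}
    (hk : IsKernel (fourier V) M L C) (hρ : 0 ≤ ρ) :
    ∃ u ∈ canonicalDomain ρ, IsMinOn (canonicalFreeEnergy V 0) (canonicalDomain ρ) u := by
  have hpi : (0 : ℝ) ≤ ((2 * Real.pi) ^ 3)⁻¹ := by positivity
  obtain ⟨γ, α, hp, hmass, hmin⟩ := (hk.const_mul ⟨_, hpi⟩).exists_minimizer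
    (r := (2 * Real.pi) ^ 3 * ρ) (by positivity)
  have hmem : (γ, α, ρ - rhoGamma γ) ∈ canonicalDomain ρ :=
    ⟨mem_domain_iff.mpr ⟨hp, sub_nonneg.mpr (rhoGamma_le_iff.mpr hmass)⟩, sub_add_cancel _ _⟩
  refine ⟨_, hmem, fun u ⟨hu, hdensity⟩ => ?_⟩
  obtain ⟨hp', hρ₀⟩ := mem_domain_iff.mp hu
  rw [Set.mem_ofPred_eq, canonicalFreeEnergy_eq hmem.2, canonicalFreeEnergy_eq hdensity]
  gcongr
  exact hmin u.1 u.2.1 hp' (rhoGamma_le_iff.mp (by linarith))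

end Canonical

end Bogoliubov

end

theorem theorem2p4_general {V : Bogoliubov.E3 → ℝ} (hV : MeasureTheory.Integrable V)
    (hr : Bogoliubov.IsRadial V) (h0 : ∀ x, 0 ≤ V x) (hF0 : ∀ p, 0 ≤ Bogoliubov.fourier V p)
    (hF : MeasureTheory.Integrable (Bogoliubov.fourier V))
    (hC2 : ContDiff ℝ 2 (Bogoliubov.fourier V))
    (hbdd : ∀ k : ℕ, k ≤ 2 → ∃ C : ℝ, ∀ p : Bogoliubov.E3,
      ‖iteratedFDeriv ℝ k (Bogoliubov.fourier V) p‖ ≤ C)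
    {ρ : ℝ} (hρ : 0 ≤ ρ) :
    ∃ u ∈ Bogoliubov.canonicalDomain ρ,
      IsMinOn (Bogoliubov.canonicalFreeEnergy V 0) (Bogoliubov.canonicalDomain ρ) u := by
  obtain ⟨M, L, C, hk⟩ := Bogoliubov.exists_isKernel_fourier hV hr h0 hF0 hF hC2 hbdd
  exact hk.exists_isMinOn_canonicalFreeEnergy hρ

theorem theorem2p4 (V : Bogoliubov.E3 → ℝ) (hV : Bogoliubov.IsInteractionPotential V)
    (hC3 : ContDiff ℝ 3 (Bogoliubov.fourier V))
    (hbdd : ∀ k : ℕ, k ≤ 3 → ∃ C : ℝ, ∀ p : Bogoliubov.E3,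
      ‖iteratedFDeriv ℝ k (Bogoliubov.fourier V) p‖ ≤ C)
    (ρ : ℝ) (hρ : 0 ≤ ρ) :
    ∃ u ∈ Bogoliubov.canonicalDomain ρ,
      IsMinOn (Bogoliubov.canonicalFreeEnergy V 0) (Bogoliubov.canonicalDomain ρ) u :=
  theorem2p4_general hV.integrable hV.radial hV.nonneg hV.fourier_nonneg hV.fourier_integrable
    (hC3.of_le (by norm_num)) (fun k hk => hbdd k (by omega)) hρ
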